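/- **Setting.** Write $A(r,s)=\{x\in\mathbb{R}^3: r\le |x|\le s\}$. For $u,v\in[-1,1]$ put $M=\max\{|u|,|v|\}$ and $$h(u,v)=\left(\frac{u\sin(\pi M/2)}{\sqrt{u^2+v^2}},\ \frac{v\sin(\pi M/2)}{\sqrt{u^2+v^2}},\ \cos(\pi M/2)\right),\qquad h(0,0)=(0,0,1).$$ Let $\mathcal Z:\mathbb{R}^3\to\mathbb{R}^3\setminus\{0\}$ be the Zorich map that equals $e^{x_3}h(x_1,x_2)$ on the beam $[-1,1]^2\times\mathbb{R}$ and is extended to $\mathbb{R}^3$ by reflections in the planes $\{x_i=n\}$ ($i=1,2$, $n$ odd) in the domain and in the plane $\{x_3=0\}$ in the range. For an odd positive integer $d$ let $p_d:\mathbb{R}^3\to\mathbb{R}^3$ be the power map determined by $p_d(\mathcal Z(x))=\mathcal Z(dx)$ and $p_d(0)=0$. For $K\ge 1$, a map on a closed ring $A$ is called $K$-quasiregular if it is continuous on $A$, belongs to $W^{1,3}_{\mathrm{loc}}$ of the interior of $A$, and satisfies $|Df|^3\le K J_f$ and $J_f\le K\min_{|v|=1}|Df\,v|^3$ almost everywhere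 there (so its maximal dilatation is at most $K$). **Theorem.** There is a constant $K\ge 1$ such that for every odd positive integer $d$ there is a $K$-quasiregular map $P_d:A(1,e^{1/d})\to\overline{B(0,e^3)}$ with $P_d=p_d$ on $|x|=1$ and $P_d=p_{3d}$ on $|x|=e^{1/d}$, and such that for all $R>1$ and $c>0$, with $c'=cR^{-2d}$, the map $$F_{R,d,c}(x)=c'R^{3d}\,P_d(x/R)$$ is a $K$-quasiregular map $$F_{R,d,c}:A(R,Re^{1/d})\to\{x: |x|\le c'R^{3d}e^3\}$$ that equals $c\cdot p_d$ when $|x|=R$ and equals $c'\cdot p_{3d}$ when $|x|=Re^{1/d}$. In particular the bound $K$ on the dilatation does not depend on $d$, $c$ or $R$. -/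

import Mathlib

open MeasureTheory Set
open scoped ContDiff

/-- Three-dimensional Euclidean space. -/
abbrev E3 : Type := EuclideanSpace ℝ (Fin 3)

/-- The closed round ring `A(r,s) = {x : r ≤ |x| ≤ s}`. -/
def closedRing (r s : ℝ) : Set E3 := {x | r ≤ ‖x‖ ∧ ‖x‖ ≤ s}

/-! ### Quasiregular maps -/

/-- `Df` is the weak (distributional) derivative of `f` on the open set `U`: integration by parts
holds, in every direction `v`, against all test functions `φ ∈ C_c^∞(U)`. -/
def IsWeakDerivOn (f : E3 → E3) (Df : E3 → E3 →L[ℝ] E3) (U : Set E3) : Prop :=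
  ∀ φ : E3 → ℝ, ContDiff ℝ ∞ φ → HasCompactSupport φ → tsupport φ ⊆ U →
    ∀ v : E3, ∫ x, (fderiv ℝ φ x v) • f x = -∫ x, φ x • Df x v

/-- `f` is a `K`-quasiregular map on `D`. For open `D` this is the usual analytic definition:
`f` is continuous, lies in the Sobolev space `W^{1,3}_loc(D)`, and almost everywhere in `D`
`|Df(x)|³ ≤ K J_f(x)` (that is, `K_O(f) ≤ K`) and `J_f(x) ≤ K ℓ(Df(x))³` with
`ℓ(A) = min_{|v|=1} |A v|` (that is, `K_I(f) ≤ K`); so the maximal dilatation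
`max {K_I(f), K_O(f)}` is at most `K`. On a closed ring `D`, `f` is continuous on `D` and
`K`-quasiregular on the interior of `D`. -/
def IsQuasiregularOn (K : ℝ) (f : E3 → E3) (D : Set E3) : Prop :=
  ContinuousOn f D ∧
  ∃ Df : E3 → E3 →L[ℝ] E3,
    (∀ C ⊆ interior D, IsCompact C → MemLp Df 3 (volume.restrict C)) ∧
    IsWeakDerivOn f Df (interior D) ∧
    ∀ᵐ x ∂(volume.restrict (interior D)),
      ‖Df x‖ ^ 3 ≤ K * (Df x).det ∧ ∀ v : E3, ‖v‖ = 1 → (Df x).det ≤ K * ‖Df x v‖ ^ 3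

/-! ### The Zorich map -/

/-- The map `h` from the square `[-1,1]²` onto the upper unit hemisphere,
`h(u,v) = (u sin(πM/2)/√(u²+v²), v sin(πM/2)/√(u²+v²), cos(πM/2))`, `M = max {|u|,|v|}`.
At `u = v = 0` the first two entries are `0 / 0 = 0`, which is the continuous extension. -/
noncomputable def hemisphereMap (u v : ℝ) : E3 :=
  !₂[u * Real.sin (Real.pi * max |u| |v| / 2) / √(u ^ 2 + v ^ 2),
     v * Real.sin (Real.pi * max |u| |v| / 2) / √(u ^ 2 + v ^ 2),
     Real.cos (Real.pi * max |u| |v| / 2)]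

/-- The `n` for which `t` lies in the interval `[2n-1, 2n+1)`. -/
noncomputable def beamIndex (t : ℝ) : ℤ := round (t / 2)

/-- The point of `[-1,1]` to which `t` is folded by `|beamIndex t|` successive reflections
in odd integers. -/
noncomputable def beamCoord (t : ℝ) : ℝ := (-1) ^ beamIndex t * (t - 2 * beamIndex t)

/-- The reflection in the plane `{x₃ = 0}`. -/
def reflect3 (y : E3) : E3 := !₂[y 0, y 1, -y 2]

/-- The Zorich map. On the beam `[-1,1]² × ℝ` it is `e^{x₃} h(x₁,x₂)`, and it is extended to `ℝ³`
by reflecting in the sides of beams in the domain and in the plane `{x₃ = 0}` in the range: the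
beam with index `(n,m)` is reached from the central one by `|n| + |m|` reflections. -/
noncomputable def zorich (x : E3) : E3 :=
  Real.exp (x 2) •
    (if Even (beamIndex (x 0) + beamIndex (x 1)) then
      hemisphereMap (beamCoord (x 0)) (beamCoord (x 1))
    else reflect3 (hemisphereMap (beamCoord (x 0)) (beamCoord (x 1))))

/-! ### Power maps -/

open Classical in
/-- The power map `p_d` associated with the Zorich map `Z`: `p_d(Z(x)) = Z(d x)` on
`Z(ℝ³) = ℝ³ \ {0}`, and `p_d(0) = 0`. For odd `d` the value does not depend on the choice of a
preimage, see `powerMap_zorich` below. -/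
noncomputable def powerMap (d : ℕ) (y : E3) : E3 :=
  if h : ∃ x, zorich x = y then zorich ((d : ℝ) • h.choose) else 0

theorem beamCoord_eq (t : ℝ) : t = 2 * beamIndex t + (-1) ^ beamIndex t * beamCoord t := by
  unfold beamCoord
  rcases Int.even_or_odd (beamIndex t) with h | h
  · rw [h.neg_one_zpow]; ring
  · rw [h.neg_one_zpow]; ring

theorem abs_beamCoord_le (t : ℝ) : |beamCoord t| ≤ 1 := by
  have h := abs_sub_round (t / 2)
  rw [abs_le] at h
  unfold beamCoord beamIndex
  rw [abs_le]
  rcases Int.even_or_odd (round (t / 2)) with h' | h' <;> rw [h'.neg_one_zpow] <;>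
    constructor <;> linarith [h.1, h.2]

theorem beam_eq_of_abs_lt {N : ℤ} {w : ℝ} (hw : |w| < 1) :
    beamIndex (2 * N + (-1) ^ N * w) = N ∧ beamCoord (2 * N + (-1) ^ N * w) = w := by
  have h1 : beamIndex (2 * N + (-1) ^ N * w) = N := by
    rw [abs_lt] at hw
    unfold beamIndex
    rw [round_eq_iff]
    rcases Int.even_or_odd N with h' | h' <;> rw [h'.neg_one_zpow] <;>
      constructor <;> linarith [hw.1, hw.2]
  refine ⟨h1, ?_⟩
  unfold beamCoord
  rw [h1]
  rcases Int.even_or_odd N with h' | h' <;> rw [h'.neg_one_zpow] <;> ring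

theorem beamCoord_eq_of_abs_le {N : ℤ} {w : ℝ} (hw : |w| ≤ 1) :
    beamCoord (2 * N + (-1) ^ N * w) = w := by
  rcases hw.lt_or_eq with h | h
  · exact (beam_eq_of_abs_lt h).2
  · have key : ∀ M : ℤ, beamIndex (2 * M + 1) = M + 1 := fun M => by
      unfold beamIndex
      rw [round_eq_iff]
      push_cast
      constructor <;> linarith
    have key' : ∀ M : ℤ, beamIndex (2 * M - 1) = M := fun M => by
      unfold beamIndex
      rw [round_eq_iff]
      constructor <;> linarith
    rcases (abs_eq one_pos.le).1 h with rfl | rfl <;>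
      rcases Int.even_or_odd N with h' | h' <;> rw [h'.neg_one_zpow]
    · rw [mul_one, beamCoord, key, h'.add_one.neg_one_zpow]; push_cast; ring
    · rw [show (2 * (N : ℝ) + -1 * 1) = 2 * N - 1 by ring, beamCoord, key', h'.neg_one_zpow]; ring
    · rw [show (2 * (N : ℝ) + 1 * -1) = 2 * N - 1 by ring, beamCoord, key', h'.neg_one_zpow]; ring
    · rw [show (2 * (N : ℝ) + -1 * -1) = 2 * N + 1 by ring, beamCoord, key,
        h'.add_one.neg_one_zpow]; push_cast; ring

/-- Multiplication by an odd integer respects the folding. -/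
theorem beam_odd_mul {d : ℕ} (hd : Odd d) (t : ℝ) :
    beamCoord (d * t) = beamCoord (d * beamCoord t) ∧
      (|beamCoord (d * beamCoord t)| < 1 →
        (Even (beamIndex (d * t)) ↔
          (Even (beamIndex t) ↔ Even (beamIndex (d * beamCoord t))))) := by
  set n := beamIndex t with hn
  set w := beamCoord t with hw
  set q := beamIndex (d * w) with hq
  set z := beamCoord (d * w) with hz
  have e1 : t = 2 * n + (-1) ^ n * w := beamCoord_eq t
  have e2 : d * w = 2 * q + (-1) ^ q * z := beamCoord_eq (d * w)
  have hd' : Odd (d : ℤ) := by exact_mod_cast hd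
  obtain ⟨N, hN, hpar⟩ : ∃ N : ℤ, d * t = 2 * N + (-1) ^ N * z ∧
      (Even N ↔ (Even n ↔ Even q)) := by
    have e3 : d * t = 2 * (d * n) + (-1) ^ n * (2 * q + (-1) ^ q * z) := by
      rw [← e2]
      nth_rw 1 [e1]
      ring
    have hdn : ¬ Even (d : ℤ) := by simpa using hd'
    rcases Int.even_or_odd n with h' | h'
    · have hp : Even (d * n + q) ↔ (Even n ↔ Even q) := by
        rw [Int.even_add, Int.even_mul]; tauto
      refine ⟨d * n + q, ?_, hp⟩
      rw [e3, zpow_add₀ (by norm_num), h'.neg_one_zpow, (h'.mul_left _).neg_one_zpow]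
      push_cast; ring
    · have hp : Even (d * n - q) ↔ (Even n ↔ Even q) := by
        rw [Int.even_sub, Int.even_mul]; tauto
      refine ⟨d * n - q, ?_, hp⟩
      have h2 : ((-1 : ℝ) ^ (d * n - q)) = -(-1) ^ q := by
        rcases Int.even_or_odd q with h | h
        · rw [((hd'.mul h').sub_even h).neg_one_zpow, h.neg_one_zpow]
        · rw [((hd'.mul h').sub_odd h).neg_one_zpow, h.neg_one_zpow]; norm_num
      rw [e3, h2, h'.neg_one_zpow]
      push_cast; ring
  constructor
  · rw [hN]; exact beamCoord_eq_of_abs_le (abs_beamCoord_le _)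
  · intro hlt
    rw [hN, (beam_eq_of_abs_lt hlt).1]
    exact hpar

theorem abs_beamCoord_odd_mul {d : ℕ} (hd : Odd d) {w : ℝ} (hw : |w| = 1) :
    |beamCoord (d * w)| = 1 := by
  obtain ⟨j, rfl⟩ := hd
  obtain ⟨N, s, hs, h⟩ : ∃ (N : ℤ) (s : ℝ), |s| = 1 ∧
      ((2 * j + 1 : ℕ) : ℝ) * w = 2 * N + (-1) ^ N * s := by
    have hsq : ∀ N : ℤ, ((-1 : ℝ) ^ N) * (-1) ^ N = 1 := fun N => by
      rcases Int.even_or_odd N with h' | h' <;> rw [h'.neg_one_zpow] <;> norm_num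
    have habs : ∀ N : ℤ, |(-1 : ℝ) ^ N| = 1 := fun N => by
      rcases Int.even_or_odd N with h' | h' <;> rw [h'.neg_one_zpow] <;> norm_num
    rcases (abs_eq one_pos.le).1 hw with rfl | rfl
    · exact ⟨j, (-1) ^ (j : ℤ), habs _, by rw [hsq]; push_cast; ring⟩
    · exact ⟨-j, -(-1) ^ (-j : ℤ), by rw [abs_neg, habs], by
        linear_combination (norm := (push_cast; ring)) hsq (-j)⟩
  rw [h, beamCoord_eq_of_abs_le hs.le, hs]

theorem sq_add_sq_hemisphere (u v : ℝ) :
    (hemisphereMap u v 0) ^ 2 + (hemisphereMap u v 1) ^ 2 + (hemisphereMap u v 2) ^ 2 = 1 := by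
  simp only [hemisphereMap, PiLp.toLp_apply, Matrix.cons_val]
  rcases eq_or_ne (u ^ 2 + v ^ 2) 0 with h | h
  · have hu : u = 0 := by nlinarith [sq_nonneg u, sq_nonneg v]
    have hv : v = 0 := by nlinarith [sq_nonneg u, sq_nonneg v]
    subst hu hv; simp
  · have h0 : 0 ≤ u ^ 2 + v ^ 2 := by positivity
    rw [div_pow, div_pow, Real.sq_sqrt h0, ← add_div, mul_pow, mul_pow, ← add_mul,
      mul_div_cancel_left₀ _ h]
    exact Real.sin_sq_add_cos_sq _

theorem neg_one_zpow_congr {k l : ℤ} (h : Even k ↔ Even l) : (-1 : ℝ) ^ k = (-1) ^ l := by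
  rcases Int.even_or_odd k with hk | hk
  · rw [hk.neg_one_zpow, (h.1 hk).neg_one_zpow]
  · have hl : Odd l := Int.not_even_iff_odd.1 fun hl => Int.not_even_iff_odd.2 hk (h.2 hl)
    rw [hk.neg_one_zpow, hl.neg_one_zpow]

theorem zorich_apply (x : E3) :
    zorich x 0 = Real.exp (x 2) * hemisphereMap (beamCoord (x 0)) (beamCoord (x 1)) 0 ∧
    zorich x 1 = Real.exp (x 2) * hemisphereMap (beamCoord (x 0)) (beamCoord (x 1)) 1 ∧
    zorich x 2 = Real.exp (x 2) * ((-1) ^ (beamIndex (x 0) + beamIndex (x 1)) *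
      hemisphereMap (beamCoord (x 0)) (beamCoord (x 1)) 2) := by
  unfold zorich
  split_ifs with h
  · simp [h.neg_one_zpow]
  · simp [reflect3, (Int.not_even_iff_odd.1 h).neg_one_zpow]

theorem norm_zorich (x : E3) : ‖zorich x‖ = Real.exp (x 2) := by
  obtain ⟨h0, h1, h2⟩ := zorich_apply x
  rw [EuclideanSpace.norm_eq, Fin.sum_univ_three, h0, h1, h2]
  have h := sq_add_sq_hemisphere (beamCoord (x 0)) (beamCoord (x 1))
  rw [Real.sqrt_eq_iff_mul_self_eq (by positivity) (Real.exp_pos _).le]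
  simp only [Real.norm_eq_abs, sq_abs]
  rcases Int.even_or_odd (beamIndex (x 0) + beamIndex (x 1)) with h' | h' <;>
    rw [h'.neg_one_zpow] <;> linear_combination (Real.exp (x 2) ^ 2) * h

/-- `h` is injective on the square. -/
theorem hemisphereMap_inj {u v u' v' : ℝ} (hu : |u| ≤ 1) (hv : |v| ≤ 1) (hu' : |u'| ≤ 1)
    (hv' : |v'| ≤ 1) (h0 : hemisphereMap u v 0 = hemisphereMap u' v' 0)
    (h1 : hemisphereMap u v 1 = hemisphereMap u' v' 1)
    (h2 : hemisphereMap u v 2 = hemisphereMap u' v' 2) : u = u' ∧ v = v' := by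
  simp only [hemisphereMap, PiLp.toLp_apply, Matrix.cons_val] at h0 h1 h2
  have hpi := Real.pi_pos
  have hM0 : 0 ≤ max |u| |v| := le_max_of_le_left (abs_nonneg _)
  have hM0' : 0 ≤ max |u'| |v'| := le_max_of_le_left (abs_nonneg _)
  have hM1 : max |u| |v| ≤ 1 := max_le hu hv
  have hM1' : max |u'| |v'| ≤ 1 := max_le hu' hv'
  have hM : max |u| |v| = max |u'| |v'| := by
    have := Real.injOn_cos ⟨by positivity, by nlinarith⟩ ⟨by positivity, by nlinarith⟩ h2
    have h3 : Real.pi * max |u| |v| = Real.pi * max |u'| |v'| := by linarith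
    exact mul_left_cancel₀ hpi.ne' h3
  rcases hM0.eq_or_lt with hz | hpos
  · have a1 : |u| = 0 := le_antisymm (hz ▸ le_max_left _ _) (abs_nonneg _)
    have a2 : |v| = 0 := le_antisymm (hz ▸ le_max_right _ _) (abs_nonneg _)
    have hz' := hz.trans hM
    have a3 : |u'| = 0 := le_antisymm (hz' ▸ le_max_left _ _) (abs_nonneg _)
    have a4 : |v'| = 0 := le_antisymm (hz' ▸ le_max_right _ _) (abs_nonneg _)
    rw [abs_eq_zero] at a1 a2 a3 a4
    simp [a1, a2, a3, a4]
  · rw [← hM] at h0 h1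
    have hs : 0 < Real.sin (Real.pi * max |u| |v| / 2) :=
      Real.sin_pos_of_pos_of_lt_pi (by positivity) (by nlinarith)
    have hne : ∀ a b : ℝ, 0 < max |a| |b| → 0 < √(a ^ 2 + b ^ 2) := fun a b hab => by
      apply Real.sqrt_pos.2
      rcases lt_max_iff.1 hab with h | h
      · have := abs_pos.1 h; positivity
      · have := abs_pos.1 h; positivity
    have p := hne u v hpos
    have p' := hne u' v' (hM ▸ hpos)
    rw [div_eq_div_iff p.ne' p'.ne'] at h0 h1
    set r := √(u ^ 2 + v ^ 2)
    set r' := √(u' ^ 2 + v' ^ 2)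
    have e0 : u * r' = u' * r := mul_right_cancel₀ hs.ne' (by linear_combination h0)
    have e1 : v * r' = v' * r := mul_right_cancel₀ hs.ne' (by linear_combination h1)
    have e : max |u| |v| * r' = max |u'| |v'| * r := by
      have q : ∀ a b : ℝ, 0 < b → |a| * b = |a * b| := fun a b hb => by
        rw [abs_mul, abs_of_pos hb]
      rw [max_mul_of_nonneg _ _ p'.le, max_mul_of_nonneg _ _ p.le, q _ _ p', q _ _ p', q _ _ p,
        q _ _ p, e0, e1]
    rw [← hM] at e
    have er : r' = r := mul_left_cancel₀ hpos.ne' e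
    rw [er] at e0 e1
    exact ⟨mul_right_cancel₀ p.ne' e0, mul_right_cancel₀ p.ne' e1⟩

theorem hemisphereMap_two_nonneg {u v : ℝ} (hu : |u| ≤ 1) (hv : |v| ≤ 1) :
    0 ≤ hemisphereMap u v 2 := by
  simp only [hemisphereMap, PiLp.toLp_apply, Matrix.cons_val]
  have hM0 : 0 ≤ max |u| |v| := le_max_of_le_left (abs_nonneg _)
  have hM1 : max |u| |v| ≤ 1 := max_le hu hv
  have hpi := Real.pi_pos
  exact Real.cos_nonneg_of_mem_Icc ⟨by nlinarith, by nlinarith⟩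

theorem hemisphereMap_two_pos {u v : ℝ} (hu : |u| < 1) (hv : |v| < 1) :
    0 < hemisphereMap u v 2 := by
  simp only [hemisphereMap, PiLp.toLp_apply, Matrix.cons_val]
  have hM0 : 0 ≤ max |u| |v| := le_max_of_le_left (abs_nonneg _)
  have hM1 : max |u| |v| < 1 := max_lt hu hv
  have hpi := Real.pi_pos
  exact Real.cos_pos_of_mem_Ioo ⟨by nlinarith, by nlinarith⟩

theorem hemisphereMap_two_eq_zero {u v : ℝ} (hu : |u| ≤ 1) (hv : |v| ≤ 1)
    (h : |u| = 1 ∨ |v| = 1) : hemisphereMap u v 2 = 0 := by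
  simp only [hemisphereMap, PiLp.toLp_apply, Matrix.cons_val]
  have hM : max |u| |v| = 1 := by
    rcases h with h | h
    · rw [h, max_eq_left hv]
    · rw [h, max_eq_right hu]
  rw [hM, mul_one, Real.cos_pi_div_two]

/-- If `Z(a) = Z(b)` then `a` and `b` fold to the same point of the central beam, by numbers of
reflections of the same parity unless that point is on the boundary of the beam. -/
theorem zorich_eq {a b : E3} (h : zorich a = zorich b) :
    a 2 = b 2 ∧ beamCoord (a 0) = beamCoord (b 0) ∧ beamCoord (a 1) = beamCoord (b 1) ∧
      (|beamCoord (a 0)| < 1 → |beamCoord (a 1)| < 1 →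
        (Even (beamIndex (a 0) + beamIndex (a 1)) ↔
          Even (beamIndex (b 0) + beamIndex (b 1)))) := by
  have h2 : a 2 = b 2 := by
    have := norm_zorich a
    rw [h, norm_zorich] at this
    exact (Real.exp_injective this).symm
  obtain ⟨a0, a1, a2⟩ := zorich_apply a
  obtain ⟨b0, b1, b2⟩ := zorich_apply b
  rw [h, b0, h2] at a0
  rw [h, b1, h2] at a1
  rw [h, b2, h2] at a2
  have hexp := (Real.exp_pos (b 2)).ne'
  have c0 := mul_left_cancel₀ hexp a0
  have c1 := mul_left_cancel₀ hexp a1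
  have c2 := mul_left_cancel₀ hexp a2
  have n1 := hemisphereMap_two_nonneg (abs_beamCoord_le (a 0)) (abs_beamCoord_le (a 1))
  have n2 := hemisphereMap_two_nonneg (abs_beamCoord_le (b 0)) (abs_beamCoord_le (b 1))
  have c2' : hemisphereMap (beamCoord (b 0)) (beamCoord (b 1)) 2 =
      hemisphereMap (beamCoord (a 0)) (beamCoord (a 1)) 2 := by
    rcases Int.even_or_odd (beamIndex (a 0) + beamIndex (a 1)) with i | i <;>
      rcases Int.even_or_odd (beamIndex (b 0) + beamIndex (b 1)) with j | j <;>
      rw [i.neg_one_zpow, j.neg_one_zpow] at c2 <;> linarith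
  obtain ⟨hu, hv⟩ := hemisphereMap_inj (abs_beamCoord_le (b 0)) (abs_beamCoord_le (b 1))
    (abs_beamCoord_le (a 0)) (abs_beamCoord_le (a 1)) c0 c1 c2'
  refine ⟨h2, hu.symm, hv.symm, fun p q => ?_⟩
  have pos := hemisphereMap_two_pos p q
  rw [c2'] at c2
  rcases Int.even_or_odd (beamIndex (a 0) + beamIndex (a 1)) with i | i <;>
    rcases Int.even_or_odd (beamIndex (b 0) + beamIndex (b 1)) with j | j
  · exact iff_of_true i j
  · rw [i.neg_one_zpow, j.neg_one_zpow] at c2; linarith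
  · rw [i.neg_one_zpow, j.neg_one_zpow] at c2; linarith
  · exact iff_of_false (Int.not_even_iff_odd.2 i) (Int.not_even_iff_odd.2 j)

/-- For odd `d`, `Z(d x)` depends on `Z(x)` only. -/
theorem zorich_smul_eq {d : ℕ} (hd : Odd d) {a b : E3} (h : zorich a = zorich b) :
    zorich ((d : ℝ) • a) = zorich ((d : ℝ) • b) := by
  obtain ⟨h2, h0, h1, hpar⟩ := zorich_eq h
  obtain ⟨A0, A0'⟩ := beam_odd_mul hd (a 0)
  obtain ⟨A1, A1'⟩ := beam_odd_mul hd (a 1)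
  obtain ⟨B0, B0'⟩ := beam_odd_mul hd (b 0)
  obtain ⟨B1, B1'⟩ := beam_odd_mul hd (b 1)
  have e0 : beamCoord (d * a 0) = beamCoord (d * b 0) := by rw [A0, B0, h0]
  have e1 : beamCoord (d * a 1) = beamCoord (d * b 1) := by rw [A1, B1, h1]
  obtain ⟨a0, a1, a2⟩ := zorich_apply ((d : ℝ) • a)
  obtain ⟨b0, b1, b2⟩ := zorich_apply ((d : ℝ) • b)
  simp only [PiLp.smul_apply, smul_eq_mul] at a0 a1 a2 b0 b1 b2
  have L0 := abs_beamCoord_le (d * b 0)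
  have L1 := abs_beamCoord_le (d * b 1)
  ext i
  fin_cases i
  · exact a0.trans (by rw [e0, e1, h2]; exact b0.symm)
  · exact a1.trans (by rw [e0, e1, h2]; exact b1.symm)
  · refine a2.trans (Eq.trans ?_ b2.symm)
    rw [e0, e1, h2]
    by_cases hb : |beamCoord (d * b 0)| = 1 ∨ |beamCoord (d * b 1)| = 1
    · simp only [hemisphereMap_two_eq_zero L0 L1 hb, mul_zero]
    · push Not at hb
      have l0 := lt_of_le_of_ne L0 hb.1
      have l1 := lt_of_le_of_ne L1 hb.2
      have m0 : |beamCoord (a 0)| < 1 := lt_of_le_of_ne (abs_beamCoord_le _) fun hh =>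
        hb.1 (by rw [← e0, A0]; exact abs_beamCoord_odd_mul hd hh)
      have m1 : |beamCoord (a 1)| < 1 := lt_of_le_of_ne (abs_beamCoord_le _) fun hh =>
        hb.2 (by rw [← e1, A1]; exact abs_beamCoord_odd_mul hd hh)
      have p := hpar m0 m1
      have A0' := A0' (by rw [← A0, e0]; exact l0)
      have A1' := A1' (by rw [← A1, e1]; exact l1)
      have B0' := B0' (by rw [← B0]; exact l0)
      have B1' := B1' (by rw [← B1]; exact l1)
      rw [h0] at A0'
      rw [h1] at A1'
      have : Even (beamIndex (d * a 0) + beamIndex (d * a 1)) ↔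
          Even (beamIndex (d * b 0) + beamIndex (d * b 1)) := by
        have aux : ∀ x y x' y' q r : Prop, ((x ↔ y) ↔ (x' ↔ y')) →
            (((x ↔ q) ↔ (y ↔ r)) ↔ ((x' ↔ q) ↔ (y' ↔ r))) := by
          clear * -
          intro x y x' y' q r
          by_cases q <;> by_cases r <;> grind
        rw [Int.even_add, Int.even_add] at p ⊢
        rw [A0', A1', B0', B1']
        exact aux _ _ _ _ _ _ p
      rw [neg_one_zpow_congr this]

/-- The Schröder equation `p_d ∘ Z = Z ∘ (d ·)` for odd `d`. -/
theorem powerMap_zorich {d : ℕ} (hd : Odd d) (x : E3) :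
    powerMap d (zorich x) = zorich ((d : ℝ) • x) := by
  have hex : ∃ x', zorich x' = zorich x := ⟨x, rfl⟩
  rw [powerMap, dif_pos hex]
  exact zorich_smul_eq hd hex.choose_spec

theorem zorich_ne_zero (x : E3) : zorich x ≠ 0 := by
  rw [← norm_ne_zero_iff, norm_zorich]
  exact (Real.exp_pos _).ne'

/-- `h` maps the square onto the closed upper unit hemisphere. -/
theorem hemisphereMap_surj {a b c : ℝ} (h : a ^ 2 + b ^ 2 + c ^ 2 = 1) (hc : 0 ≤ c) :
    ∃ u v : ℝ, |u| ≤ 1 ∧ |v| ≤ 1 ∧ (0 < c → |u| < 1 ∧ |v| < 1) ∧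
      hemisphereMap u v 0 = a ∧ hemisphereMap u v 1 = b ∧ hemisphereMap u v 2 = c := by
  have hpi := Real.pi_pos
  rcases eq_or_ne (a ^ 2 + b ^ 2) 0 with h0 | h0
  · have ha : a = 0 := by nlinarith [sq_nonneg a, sq_nonneg b]
    have hb : b = 0 := by nlinarith [sq_nonneg a, sq_nonneg b]
    subst ha hb
    have hc1 : c = 1 := by nlinarith
    subst hc1
    exact ⟨0, 0, by simp, by simp, by simp, by simp [hemisphereMap], by simp [hemisphereMap],
      by simp [hemisphereMap]⟩
  set ρ := √(a ^ 2 + b ^ 2) with hρ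
  have hρ2 : ρ ^ 2 = a ^ 2 + b ^ 2 := Real.sq_sqrt (by positivity)
  have hρ0 : 0 < ρ := Real.sqrt_pos.2 (lt_of_le_of_ne (by positivity) h0.symm)
  set m := max |a| |b| with hm
  have hm0 : 0 < m := by
    by_contra hcon
    have h1 : |a| ≤ 0 := (le_max_left _ _).trans (not_lt.1 hcon)
    have h2 : |b| ≤ 0 := (le_max_right _ _).trans (not_lt.1 hcon)
    apply h0
    rw [abs_nonpos_iff.1 h1, abs_nonpos_iff.1 h2]
    norm_num
  have hc1 : c < 1 := by nlinarith [sq_nonneg c]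
  set M := 2 / Real.pi * Real.arccos c with hM
  have hM0 : 0 < M := by have := Real.arccos_pos.2 hc1; positivity
  have hM1 : M ≤ 1 := by
    have := Real.arccos_le_pi_div_two.2 hc
    rw [hM, div_mul_eq_mul_div, div_le_one hpi]; linarith
  have hMc : Real.pi * M / 2 = Real.arccos c := by rw [hM]; field_simp
  have hk : 0 < M / m := by positivity
  have hau : |M / m * a| = M / m * |a| := by rw [abs_mul, abs_of_pos hk]
  have hav : |M / m * b| = M / m * |b| := by rw [abs_mul, abs_of_pos hk]
  have hmax : max |M / m * a| |M / m * b| = M := by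
    rw [hau, hav, ← mul_max_of_nonneg _ _ hk.le, ← hm]; field_simp
  have hcos : Real.cos (Real.pi * M / 2) = c := by
    rw [hMc, Real.cos_arccos (by linarith) hc1.le]
  have hsin : Real.sin (Real.pi * M / 2) = ρ := by
    rw [hMc, Real.sin_arccos, hρ]; congr 1; linarith
  have hroot : √((M / m * a) ^ 2 + (M / m * b) ^ 2) = M / m * ρ := by
    rw [mul_pow, mul_pow, ← mul_add, ← hρ2, ← mul_pow, Real.sqrt_sq (by positivity)]
  refine ⟨M / m * a, M / m * b, (le_max_left _ _).trans (hmax.le.trans hM1),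
    (le_max_right _ _).trans (hmax.le.trans hM1), fun hcpos => ?_, ?_, ?_, ?_⟩
  · have hM1' : M < 1 := by
      have := Real.arccos_lt_pi_div_two.2 hcpos
      rw [hM, div_mul_eq_mul_div, div_lt_one hpi]; linarith
    exact ⟨(le_max_left _ _).trans_lt (hmax.le.trans_lt hM1'),
      (le_max_right _ _).trans_lt (hmax.le.trans_lt hM1')⟩
  · simp only [hemisphereMap, PiLp.toLp_apply, Matrix.cons_val]
    rw [hmax, hsin, hroot]; field_simp
  · simp only [hemisphereMap, PiLp.toLp_apply, Matrix.cons_val]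
    rw [hmax, hsin, hroot]; field_simp
  · simp only [hemisphereMap, PiLp.toLp_apply, Matrix.cons_val]
    rw [hmax, hcos]

/-- The Zorich map is onto `ℝ³ \ {0}`. -/
theorem range_zorich : range zorich = {0}ᶜ := by
  ext y
  constructor
  · rintro ⟨x, rfl⟩
    exact zorich_ne_zero x
  · intro hy
    have hr : 0 < ‖y‖ := norm_pos_iff.2 hy
    have hn : (y 0 / ‖y‖) ^ 2 + (y 1 / ‖y‖) ^ 2 + (|y 2| / ‖y‖) ^ 2 = 1 := by
      have h := EuclideanSpace.real_norm_sq_eq y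
      rw [Fin.sum_univ_three] at h
      rw [div_pow, div_pow, div_pow, sq_abs, ← add_div, ← add_div, ← h, div_self (by positivity)]
    obtain ⟨u, v, hu, hv, hlt, h0, h1, h2⟩ := hemisphereMap_surj hn (by positivity)
    obtain ⟨N, hN⟩ : ∃ N : ℤ, y 2 = (-1) ^ N * |y 2| := by
      rcases le_or_gt 0 (y 2) with hs | hs
      · exact ⟨0, by simp [abs_of_nonneg hs]⟩
      · exact ⟨1, by simp [abs_of_neg hs]⟩
    have hu' := beamCoord_eq_of_abs_le (N := N) hu
    have hv' := beamCoord_eq_of_abs_le (N := 0) hv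
    refine ⟨!₂[2 * N + (-1) ^ N * u, 2 * ((0 : ℤ) : ℝ) + (-1) ^ (0 : ℤ) * v, Real.log ‖y‖], ?_⟩
    obtain ⟨c0, c1, c2⟩ := zorich_apply
      !₂[2 * N + (-1) ^ N * u, 2 * ((0 : ℤ) : ℝ) + (-1) ^ (0 : ℤ) * v, Real.log ‖y‖]
    simp only [Matrix.cons_val, hu', hv', Real.exp_log hr] at c0 c1 c2
    rw [h0, mul_div_cancel₀ _ hr.ne'] at c0
    rw [h1, mul_div_cancel₀ _ hr.ne'] at c1
    rw [h2, mul_left_comm, mul_div_cancel₀ _ hr.ne'] at c2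
    ext i
    fin_cases i
    · exact c0
    · exact c1
    · refine c2.trans (Eq.trans ?_ hN.symm)
      rcases (abs_nonneg (y 2)).eq_or_lt with hz | hz
      · simp [← hz]
      · obtain ⟨l0, l1⟩ := hlt (by positivity)
        have hI : beamIndex (2 * N + (-1) ^ N * u) +
            beamIndex (2 * ((0 : ℤ) : ℝ) + (-1) ^ (0 : ℤ) * v) = N := by
          rw [(beam_eq_of_abs_lt l0).1, (beam_eq_of_abs_lt l1).1, add_zero]
        rw [hI]

/-! The Zorich map factors as `zorich = roundMap ∘ boxMap`. Here `boxMap` is `exp` of the height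
times a piecewise linear folding; it sends horizontal planes to boundaries of bipyramids, and
`roundMap` is a bi-Lipschitz homogeneous map taking bipyramids to round balls. In these coordinates
`p_d` is `boxMap y ↦ boxMap (d y)`. So a single map `interpMap` of the slab `0 ≤ y 2 ≤ 1`,
independent of `d`, suffices, provided that it equals `boxMap y` at the bottom and `boxMap (3 y)` at
the top and has compatible reflection symmetries. Then `P_d` is `interpMap ∘ (d ·)` conjugated back
through `boxMap` and `roundMap`. Oddness of `d` makes this independent of the chosen preimage under
`boxMap`: only the central beam is used, with a reflection for the lower half space.

The uniformity in `d` comes from this form. The dilation by `d` multiplies the norm of the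
derivative by `d` and the Jacobian by `d ^ 3`, which leaves their ratio of dilatation unchanged, and
on `1 ≤ N ≤ e^{1/d} ≤ e` the logarithmic coordinates have bounded distortion.

The slab map is assembled from a planar one. The point `(beamCoord y, beamCoord (y + 1))` runs
around `|a| + |b| = 1` as `(sin, cos)` runs around the circle, and the third coordinate of `boxMap`
at height zero is the signed minimum of the two cosine-like values. A piecewise affine planar map
`(F, S)` (`foldFst`, `foldSnd`) joins this curve at `s = 0` to the curve run three times as fast and
scaled by `l = e^3` at `s = 1`. On the unit square it is affine on five triangles; the edge `t = 1`
runs out along the axis from `(1, 0)`, turns back at the parameter `(1, 1/2)` and passes through the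
origin to `(-l, 0)`. After reflection the turning point is a branch point. The spatial map is `(F(y
0, s), F(y 1, s), signedMin (S(y 0, s)) (S(y 1, s)))`. Where `|S(y 0, s)| < |S(y 1, s)|`, its
Jacobian is the planar Jacobian at `(y 0, s)` times `∂F/∂y` at `(y 1, s)` times the sign of `S(y 1,
s)`. The planar map is therefore arranged so that `∂F/∂y` has the sign of `S` and absolute value at
least one (`exists_affine_planar`), and the spatial Jacobian is at least one
(`interpMap_hasDerivBoundsOn`).

All maps are Lipschitz on the relevant sets, so weak derivatives are the almost everywhere
derivatives. Bounds on norm and Jacobian multiply under composition (`HasDerivBoundsOn.comp`), and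
Hadamard's inequality gives the inner dilatation from the outer one (`isQuasiregularOn_closedRing`).
-/

/-! ### Determinant estimates -/

/-- A form of Hadamard's inequality in dimension three. -/
theorem abs_det_le_norm_sq_mul (A : E3 →L[ℝ] E3) {v : E3} (hv : ‖v‖ = 1) :
    |A.det| ≤ ‖A‖ ^ 2 * ‖A v‖ := by
  have hv' : Orthonormal ℝ ((↑) : ({v} : Set E3) → E3) := by
    rw [orthonormal_subtype_iff_ite]
    intro x hx y hy
    rw [mem_singleton_iff] at hx hy
    subst hx hy
    simp [hv]
  -- With `v` completed to an orthonormal basis, Hadamard bounds the determinant by the product of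
  -- the three image lengths: one is `‖A v‖`, the other two are at most `‖A‖`.
  obtain ⟨u, b, hu, hb⟩ := hv'.exists_orthonormalBasis_extension
  have hc : Fintype.card u = 3 := by
    have := Module.finrank_eq_card_basis b.toBasis
    rw [← this]; simp
  obtain ⟨e⟩ : Nonempty (u ≃ Fin 3) := ⟨Fintype.equivFinOfCardEq hc⟩
  set b' := b.reindex e with hb'
  have : Fact (Module.finrank ℝ E3 = 3) := ⟨by simp⟩
  have h1 := b'.toBasis.orientation.abs_volumeForm_apply_le (fun i => A (b' i))
  rw [b'.toBasis.orientation.volumeForm_robust b' rfl] at h1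
  have h2 : b'.toBasis.det (fun i => A (b' i)) = A.det := by
    have := b'.toBasis.det_comp (A : E3 →ₗ[ℝ] E3) b'
    have h3 : b'.toBasis.det (b' : Fin 3 → E3) = 1 := by
      have := b'.toBasis.det_self
      rwa [OrthonormalBasis.coe_toBasis] at this
    rw [h3, mul_one] at this
    exact this
  rw [h2] at h1
  refine h1.trans ?_
  have hmem : v ∈ u := hu (mem_singleton v)
  set j := e ⟨v, hmem⟩ with hj
  have hbj : b' j = v := by
    rw [hb', OrthonormalBasis.reindex_apply, hj, Equiv.symm_apply_apply, hb]
  have hle : ∀ i, ‖A (b' i)‖ ≤ ‖A‖ := fun i => by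
    simpa using A.le_opNorm (b' i)
  rw [← Finset.mul_prod_erase Finset.univ _ (Finset.mem_univ j), hbj, mul_comm]
  gcongr
  calc ∏ i ∈ Finset.univ.erase j, ‖A (b' i)‖ ≤ ∏ i ∈ Finset.univ.erase j, ‖A‖ :=
        Finset.prod_le_prod (fun _ _ => norm_nonneg _) (fun i _ => hle i)
    _ = ‖A‖ ^ 2 := by
        rw [Finset.prod_const, Finset.card_erase_of_mem (Finset.mem_univ j)]; simp

theorem abs_det_le_norm_pow (A : E3 →L[ℝ] E3) : |A.det| ≤ ‖A‖ ^ 3 := by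
  obtain ⟨v, hv⟩ := exists_norm_eq E3 (zero_le_one)
  refine (abs_det_le_norm_sq_mul A hv).trans ?_
  have := A.le_opNorm v
  rw [hv, mul_one] at this
  calc ‖A‖ ^ 2 * ‖A v‖ ≤ ‖A‖ ^ 2 * ‖A‖ := by gcongr
    _ = ‖A‖ ^ 3 := by ring

/-! ### Null sets -/

/-- Both measures are Haar measures. The Hausdorff measure is convenient because its bounds under
Lipschitz and antilipschitz maps hold for arbitrary sets, measurable or not. -/
theorem hausdorffMeasure_three_eq_zero_iff (s : Set E3) :
    Measure.hausdorffMeasure 3 s = 0 ↔ volume s = 0 := by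
  have h : Module.finrank ℝ E3 = 3 := by simp
  have : (Measure.hausdorffMeasure 3 : Measure E3).IsAddHaarMeasure := by
    have := isAddHaarMeasure_hausdorffMeasure (E := E3)
    rw [h] at this
    exact_mod_cast this
  exact ⟨fun h => Measure.absolutelyContinuous_isAddHaarMeasure volume _ h,
    fun h => Measure.absolutelyContinuous_isAddHaarMeasure _ volume h⟩

theorem volume_image_eq_zero_of_lipschitzWith {K : NNReal} {f : E3 → E3} (hf : LipschitzWith K f)
    {s : Set E3} (hs : volume s = 0) : volume (f '' s) = 0 := by
  rw [← hausdorffMeasure_three_eq_zero_iff] at hs ⊢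
  have := hf.hausdorffMeasure_image_le (d := 3) (by norm_num) s
  rw [hs, mul_zero] at this
  exact le_antisymm this bot_le

theorem volume_eq_zero_of_antilipschitzWith_domRestrict {K : NNReal} {f : E3 → E3} {s : Set E3}
    (hf : AntilipschitzWith K (s.domRestrict f)) (hs : volume (f '' s) = 0) : volume s = 0 := by
  rw [← hausdorffMeasure_three_eq_zero_iff] at hs ⊢
  have := hf.le_hausdorffMeasure_image (d := 3) (by norm_num) univ
  rw [image_univ, range_domRestrict, hs, mul_zero] at this
  have h2 := (isometry_subtype_coe (s := s)).hausdorffMeasure_image (d := 3)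
    (Or.inl (by norm_num)) univ
  rw [image_univ, Subtype.range_coe] at h2
  rw [h2]
  exact le_antisymm this bot_le

/-- The points at which `f` has an invertible derivative and takes values in a given null set form
a null set. -/
theorem volume_preimage_eq_zero_of_det_ne_zero (f : E3 → E3) {N : Set E3} (hN : volume N = 0) :
    volume {x | DifferentiableAt ℝ f x ∧ (fderiv ℝ f x).det ≠ 0 ∧ f x ∈ N} = 0 := by
  set s := {x | DifferentiableAt ℝ f x ∧ (fderiv ℝ f x).det ≠ 0 ∧ f x ∈ N} with hs
  -- The radius is half of `‖A⁻¹‖⁻¹`, so a map this close to the linear map `A` on a piece is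
  -- antilipschitz there. The value `1` for singular `A` is a dummy: on nonempty `s` the pieces use
  -- derivatives at points of `s`, which are invertible.
  have hr : ∀ A : E3 →L[ℝ] E3, ∃ c : NNReal, c ≠ 0 ∧
      ∀ h : A.det ≠ 0, c < ‖((A.toContinuousLinearEquivOfDetNeZero h).symm : E3 →L[ℝ] E3)‖₊⁻¹ := by
    intro A
    by_cases h : A.det ≠ 0
    · have hpos := (A.toContinuousLinearEquivOfDetNeZero h).nnnorm_symm_pos
      exact ⟨_, (half_pos (inv_pos.2 hpos)).ne', fun _ => half_lt_self (inv_pos.2 hpos)⟩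
    · exact ⟨1, one_ne_zero, fun h' => absurd h' h⟩
  choose r r0 hr using hr
  rcases s.eq_empty_or_nonempty with he | hne
  · rw [he]; simp
  obtain ⟨t, A, -, -, hcov, happ, hA⟩ := exists_partition_approximatesLinearOn_of_hasFDerivWithinAt
    f s (fderiv ℝ f) (fun x hx => hx.1.hasFDerivAt.hasFDerivWithinAt) r r0
  have hn : ∀ n, volume (s ∩ t n) = 0 := by
    intro n
    obtain ⟨y, hy, hAy⟩ := hA hne n
    have hdet : (A n).det ≠ 0 := hAy ▸ hy.2.1
    have h1 : ApproximatesLinearOn f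
        (((A n).toContinuousLinearEquivOfDetNeZero hdet : E3 ≃L[ℝ] E3) : E3 →L[ℝ] E3)
        (s ∩ t n) (r (A n)) := by
      rw [ContinuousLinearMap.coe_toContinuousLinearEquivOfDetNeZero]; exact happ n
    refine volume_eq_zero_of_antilipschitzWith_domRestrict
      (h1.antilipschitz (Or.inr (hr _ hdet))) (measure_mono_null ?_ hN)
    rintro _ ⟨x, hx, rfl⟩
    exact hx.1.2.2
  refine measure_mono_null (t := ⋃ n, s ∩ t n) (fun x hx => ?_) (measure_iUnion_null hn)
  obtain ⟨n, hn⟩ := mem_iUnion.1 (hcov hx)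
  exact mem_iUnion.2 ⟨n, hx, hn⟩

/-! ### Bounds for the derivative almost everywhere -/

/-- At almost every point of `U` the map `f` is differentiable, with derivative of norm at most
`a` and with Jacobian of absolute value at least `b` and of sign `ε`. -/
def HasDerivBoundsOn (f : E3 → E3) (U : Set E3) (a b ε : ℝ) : Prop :=
  ∀ᵐ x : E3, x ∈ U →
    DifferentiableAt ℝ f x ∧ ‖fderiv ℝ f x‖ ≤ a ∧ b ≤ ε * (fderiv ℝ f x).det

theorem HasDerivBoundsOn.mono {f : E3 → E3} {U U' : Set E3} {a b ε : ℝ}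
    (h : HasDerivBoundsOn f U a b ε) (hU : U' ⊆ U) : HasDerivBoundsOn f U' a b ε := by
  filter_upwards [h] with x hx hxU using hx (hU hxU)

theorem HasDerivBoundsOn.congr {f g : E3 → E3} {U : Set E3} {a b ε : ℝ}
    (h : HasDerivBoundsOn f U a b ε) (hU : IsOpen U) (hfg : EqOn g f U) :
    HasDerivBoundsOn g U a b ε := by
  filter_upwards [h] with x hx hxU
  have he : g =ᶠ[nhds x] f := hfg.eventuallyEq_of_mem (hU.mem_nhds hxU)
  rw [he.fderiv_eq, he.differentiableAt_iff]
  exact hx hxU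

/-- The chain rule at `x` needs `g x` to avoid the exceptional null set of `f`. Points with
invertible derivative that `g` sends into a null set form a null set, and `0 < b'` guarantees
invertibility almost everywhere. -/
theorem HasDerivBoundsOn.comp {f g : E3 → E3} {U V : Set E3} {a b ε a' b' ε' : ℝ}
    (hf : HasDerivBoundsOn f V a b ε) (hg : HasDerivBoundsOn g U a' b' ε') (hgU : MapsTo g U V)
    (ha : 0 ≤ a) (hb : 0 ≤ b) (hb' : 0 < b') :
    HasDerivBoundsOn (f ∘ g) U (a * a') (b * b') (ε * ε') := by
  have hnull := measure_eq_zero_iff_ae_notMem.1 (volume_preimage_eq_zero_of_det_ne_zero g hf)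
  filter_upwards [hnull, hg] with x hx hgx hxU
  obtain ⟨d1, n1, e1⟩ := hgx hxU
  have hdet : (fderiv ℝ g x).det ≠ 0 := by
    intro h0
    rw [h0, mul_zero] at e1
    exact absurd e1 (not_le.2 hb')
  have h2 : g x ∈ V → DifferentiableAt ℝ f (g x) ∧ ‖fderiv ℝ f (g x)‖ ≤ a ∧
      b ≤ ε * (fderiv ℝ f (g x)).det := by
    by_contra hcon
    exact hx ⟨d1, hdet, hcon⟩
  obtain ⟨d2, n2, e2⟩ := h2 (hgU hxU)
  refine ⟨d2.comp x d1, ?_, ?_⟩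
  · rw [fderiv_comp x d2 d1]
    exact (ContinuousLinearMap.opNorm_comp_le _ _).trans (by gcongr)
  · rw [fderiv_comp x d2 d1]
    have : ((fderiv ℝ f (g x)).comp (fderiv ℝ g x)).det =
        (fderiv ℝ f (g x)).det * (fderiv ℝ g x).det := LinearMap.det_comp _ _
    rw [this]
    calc b * b' ≤ (ε * (fderiv ℝ f (g x)).det) * (ε' * (fderiv ℝ g x).det) :=
          mul_le_mul e2 e1 hb'.le (hb.trans e2)
      _ = _ := by ring

/-! ### A sufficient condition for quasiregularity -/

/-- Integration by parts for Lipschitz functions applies to the components of a global Lipschitz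
extension `g` of `f`. Test functions and their derivatives vanish off `U`, so it does not matter
that `g` differs from `f` outside `D`. -/
theorem isWeakDerivOn_of_lipschitzOn {f : E3 → E3} {U D : Set E3} {C : NNReal}
    (hU : IsOpen U) (hUD : U ⊆ D) (hf : LipschitzOnWith C f D) :
    IsWeakDerivOn f (fderiv ℝ f) U := by
  obtain ⟨g, hg, hfg⟩ := hf.extend_finite_dimension
  intro φ hφ hφc hφU v
  have hφ1 : Differentiable ℝ φ := hφ.differentiable (by simp)
  have hsupp : ∀ x, x ∉ U → φ x = 0 ∧ fderiv ℝ φ x v = 0 := fun x hx => by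
    have hx' : x ∉ tsupport φ := fun h => hx (hφU h)
    refine ⟨image_eq_zero_of_notMem_tsupport hx', ?_⟩
    have : x ∉ tsupport (fderiv ℝ φ) := fun h => hx' (tsupport_fderiv_subset ℝ h)
    rw [image_eq_zero_of_notMem_tsupport this]; rfl
  have e1 : ∀ x, (fderiv ℝ φ x v) • f x = (fderiv ℝ φ x v) • g x := fun x => by
    by_cases hx : x ∈ U
    · rw [hfg (hUD hx)]
    · rw [(hsupp x hx).2, zero_smul, zero_smul]
  have e2 : ∀ x, φ x • fderiv ℝ f x v = φ x • fderiv ℝ g x v := fun x => by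
    by_cases hx : x ∈ U
    · have : f =ᶠ[nhds x] g := (hfg.mono hUD).eventuallyEq_of_mem (hU.mem_nhds hx)
      rw [this.fderiv_eq]
    · rw [(hsupp x hx).1, zero_smul, zero_smul]
  simp_rw [e1, e2]
  obtain ⟨L, hL⟩ := (hφ.of_le (by simp)).lipschitzWith_of_hasCompactSupport hφc (n := 1) (by simp)
  have hgd := hg.ae_differentiableAt (μ := (volume : Measure E3))
  have hφ' : Continuous fun x => fderiv ℝ φ x v :=
    (hφ.continuous_fderiv (by simp)).clm_apply continuous_const
  have hφ'c : HasCompactSupport fun x => fderiv ℝ φ x v := hφc.fderiv_apply ℝ v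
  have i1 : Integrable fun x => (fderiv ℝ φ x v) • g x :=
    (hφ'.smul hg.continuous).integrable_of_hasCompactSupport hφ'c.smul_right
  have i2 : Integrable fun x => φ x • fderiv ℝ g x v := by
    have hb : Integrable fun x => ((lipschitzExtensionConstant E3 * C : NNReal) * ‖v‖) * ‖φ x‖ :=
      ((hφ.continuous.norm).integrable_of_hasCompactSupport hφc.norm).const_mul _
    refine hb.mono' (hφ.continuous.aestronglyMeasurable.smul
      (measurable_fderiv_apply_const ℝ g v).aestronglyMeasurable) (Filter.Eventually.of_forall
        fun x => ?_)
    rw [norm_smul, mul_comm]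
    gcongr
    exact (ContinuousLinearMap.le_opNorm _ _).trans
      (by gcongr; exact norm_fderiv_le_of_lipschitz ℝ hg)
  ext i
  have p := (EuclideanSpace.proj i : E3 →L[ℝ] ℝ).integral_comp_comm i1
  have q := (EuclideanSpace.proj i : E3 →L[ℝ] ℝ).integral_comp_comm i2
  simp only [EuclideanSpace.coe_proj, PiLp.smul_apply, smul_eq_mul] at p q
  rw [PiLp.neg_apply, ← p, ← q, ← integral_neg]
  have hgi : LipschitzWith (1 * (lipschitzExtensionConstant E3 * C)) fun x => g x i :=
    (LipschitzWith.of_dist_le_mul fun x y => by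
      rw [NNReal.coe_one, one_mul, Real.dist_eq, dist_eq_norm, ← PiLp.sub_apply,
        ← Real.norm_eq_abs]
      exact PiLp.norm_apply_le _ i : LipschitzWith 1 fun y : E3 => y i).comp hg
  have hmain := hgi.integral_lineDeriv_mul_eq (μ := (volume : Measure E3)) hL hφc v
  have r1 : ∫ x, φ x * fderiv ℝ g x v i = ∫ x, lineDeriv ℝ (fun x => g x i) x v * φ x := by
    refine integral_congr_ae ?_
    filter_upwards [hgd] with x hx
    have h1 := ((EuclideanSpace.proj i : E3 →L[ℝ] ℝ).hasFDerivAt.comp x hx.hasFDerivAt)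
    have h2 : lineDeriv ℝ (fun x => g x i) x v = fderiv ℝ g x v i :=
      (h1.hasLineDerivAt v).lineDeriv
    rw [h2, mul_comm]
  have r2 : ∫ x, lineDeriv ℝ φ x (-v) * g x i = -∫ x, fderiv ℝ φ x v * g x i := by
    rw [← integral_neg]
    congr 1
    ext x
    rw [(hφ1 x).lineDeriv_eq_fderiv, map_neg, neg_mul]
  rw [integral_neg, r1, hmain, r2, neg_neg]

/-- The scale `κ` cancels in `‖A‖³ / det A ≤ a³ / b`, where `A` is the derivative. Hadamard's
inequality then gives `(det A)³ ≤ (‖A‖³)² ‖A v‖³ ≤ (a³/b)² (det A)² ‖A v‖³`, hence the inner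
dilatation bound with the squared constant. -/
theorem isQuasiregularOn_closedRing {f : E3 → E3} {r s a b κ K : ℝ} {C : NNReal}
    (hf : LipschitzOnWith C f (closedRing r s)) (hb : 0 < b) (hκ : 0 < κ)
    (h : HasDerivBoundsOn f {x | r < ‖x‖ ∧ ‖x‖ < s} (a * κ) (b * κ ^ 3) 1)
    (hK : a ^ 3 / b ≤ K) (hK' : (a ^ 3 / b) ^ 2 ≤ K) : IsQuasiregularOn K f (closedRing r s) := by
  have hle : ∀ x ∈ interior (closedRing r s), ‖fderiv ℝ f x‖ ≤ C := fun x hx =>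
    norm_fderiv_le_of_lipschitzOn ℝ (mem_interior_iff_mem_nhds.1 hx) hf
  refine ⟨hf.continuousOn, fderiv ℝ f, fun A hA hAc => ?_,
    isWeakDerivOn_of_lipschitzOn isOpen_interior interior_subset hf, ?_⟩
  · have : IsFiniteMeasure (volume.restrict A) := ⟨by
      rw [Measure.restrict_apply_univ]; exact hAc.measure_lt_top⟩
    refine MemLp.of_bound (measurable_fderiv ℝ f).aestronglyMeasurable C ?_
    exact (ae_restrict_iff' hAc.measurableSet).2
      (Filter.Eventually.of_forall fun x hx => hle x (hA hx))
  · rw [ae_restrict_iff' isOpen_interior.measurableSet]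
    -- The interior of the ring need not be computed: it lies in the closed ring, and the two
    -- boundary spheres are null.
    have s1 := measure_eq_zero_iff_ae_notMem.1
      (Measure.addHaar_sphere (volume : Measure E3) 0 r)
    have s2 := measure_eq_zero_iff_ae_notMem.1
      (Measure.addHaar_sphere (volume : Measure E3) 0 s)
    filter_upwards [h, s1, s2] with x hx h1 h2 hxU
    rw [mem_sphere_zero_iff_norm] at h1 h2
    have hxr := interior_subset hxU
    obtain ⟨-, n1, d1⟩ := hx ⟨lt_of_le_of_ne hxr.1 (Ne.symm h1), lt_of_le_of_ne hxr.2 h2⟩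
    rw [one_mul] at d1
    set A := fderiv ℝ f x
    have hd0 : 0 < A.det := lt_of_lt_of_le (by positivity) d1
    have n3 : ‖A‖ ^ 3 ≤ a ^ 3 / b * A.det := by
      calc ‖A‖ ^ 3 ≤ (a * κ) ^ 3 := by gcongr
        _ = a ^ 3 / b * (b * κ ^ 3) := by field_simp
        _ ≤ a ^ 3 / b * A.det := by
          have : 0 ≤ a := by
            have := (norm_nonneg A).trans n1
            exact nonneg_of_mul_nonneg_left this hκ
          gcongr
    refine ⟨n3.trans (by gcongr), fun v hv => ?_⟩
    have hH := (le_abs_self _).trans (abs_det_le_norm_sq_mul A hv)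
    have hA0 : 0 < ‖A‖ := by
      by_contra hcon
      have : ‖A‖ = 0 := le_antisymm (not_lt.1 hcon) (norm_nonneg _)
      rw [this] at hH; simp at hH; linarith
    have hA3 : 0 ≤ ‖A‖ ^ 3 := by positivity
    have h6 : (‖A‖ ^ 3) ^ 2 ≤ K * A.det ^ 2 := by
      calc (‖A‖ ^ 3) ^ 2 ≤ (a ^ 3 / b * A.det) ^ 2 := by gcongr
        _ = (a ^ 3 / b) ^ 2 * A.det ^ 2 := by ring
        _ ≤ K * A.det ^ 2 := by gcongr
    have h7 : A.det ^ 3 ≤ (‖A‖ ^ 3) ^ 2 * ‖A v‖ ^ 3 := by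
      calc A.det ^ 3 ≤ (‖A‖ ^ 2 * ‖A v‖) ^ 3 := by gcongr
        _ = _ := by ring
    have h8 : A.det ^ 2 * A.det ≤ A.det ^ 2 * (K * ‖A v‖ ^ 3) := by
      calc A.det ^ 2 * A.det = A.det ^ 3 := by ring
        _ ≤ (‖A‖ ^ 3) ^ 2 * ‖A v‖ ^ 3 := h7
        _ ≤ (K * A.det ^ 2) * ‖A v‖ ^ 3 := by gcongr
        _ = _ := by ring
    exact le_of_mul_le_mul_left h8 (by positivity)

/-! ### Folding -/

theorem beamIndex_mem (t : ℝ) : 2 * (beamIndex t : ℝ) - 1 ≤ t ∧ t < 2 * beamIndex t + 1 := by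
  have := (round_eq_iff (x := t / 2) (n := beamIndex t)).1 rfl
  constructor <;> linarith [this.1, this.2]

theorem beamIndex_eq {t : ℝ} {n : ℤ} (h1 : 2 * (n : ℝ) - 1 ≤ t) (h2 : t < 2 * n + 1) :
    beamIndex t = n := by
  unfold beamIndex
  rw [round_eq_iff]
  constructor <;> linarith

/-- A shift by one is a quarter period: `beamCoord t` and `beamCoord (t + 1)` behave like sine and
cosine, with `|a| + |b| = 1` in place of the unit circle. -/
theorem beamCoord_add_one (t : ℝ) :
    beamCoord (t + 1) = (-1) ^ beamIndex t * (1 - |beamCoord t|) := by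
  have h := beamIndex_mem t
  have hc : beamCoord t = (-1) ^ beamIndex t * (t - 2 * beamIndex t) := rfl
  generalize beamIndex t = n at *
  have habs : |beamCoord t| = |t - 2 * n| := by
    rw [hc, abs_mul, abs_neg_one_zpow, one_mul]
  rw [habs]
  rcases lt_or_ge (t - 2 * n) 0 with h0 | h0
  · rw [abs_of_neg h0, beamCoord, beamIndex_eq (t := t + 1) (n := n) (by linarith) (by linarith)]
    ring
  · rw [abs_of_nonneg h0, beamCoord, beamIndex_eq (t := t + 1) (n := n + 1)
      (by push_cast; linarith) (by push_cast; linarith), zpow_add_one₀ (by norm_num)]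
    push_cast
    ring

theorem abs_beamCoord_sub_le (t u : ℝ) : |beamCoord t - beamCoord u| ≤ |t - u| := by
  wlog htu : t ≤ u generalizing t u
  · rw [abs_sub_comm, abs_sub_comm t]; exact this u t (le_of_not_ge htu)
  rw [abs_sub_comm t, abs_of_nonneg (sub_nonneg.2 htu)]
  -- At distance at least `2` the bound is trivial, since all values lie in `[-1, 1]`; otherwise the
  -- two points lie in the same beam or in adjacent ones.
  rcases le_or_gt 2 (u - t) with h2 | h2
  · have h3 := abs_le.1 (abs_beamCoord_le t)
    have h4 := abs_le.1 (abs_beamCoord_le u)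
    rw [abs_le]; constructor <;> linarith [h3.1, h3.2, h4.1, h4.2]
  have a := beamIndex_mem t
  have b := beamIndex_mem u
  unfold beamCoord
  generalize beamIndex t = n at *
  generalize beamIndex u = m at *
  have h3 : (n : ℝ) < m + 1 := by linarith [a.1, b.2]
  have h4 : (m : ℝ) < n + 2 := by linarith [a.2, b.1]
  have h5 : m = n ∨ m = n + 1 := by
    have : n < m + 1 := by exact_mod_cast h3
    have : m < n + 2 := by exact_mod_cast h4
    omega
  rcases h5 with rfl | rfl
  · rw [← mul_sub, abs_mul, abs_neg_one_zpow, one_mul, abs_le]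
    constructor <;> linarith
  · rw [zpow_add_one₀ (by norm_num),
      show ∀ c : ℝ, c * (t - 2 * n) - c * -1 * (u - 2 * ((n + 1 : ℤ) : ℝ))
      = c * ((t - 2 * n) + (u - 2 * ((n + 1 : ℤ) : ℝ))) by intro c; ring, abs_mul,
      abs_neg_one_zpow, one_mul, abs_le]
    push_cast at b ⊢
    constructor <;> linarith [a.1, a.2, b.1, b.2]

/-! ### The odd extension of a function of two variables -/

/-- The extension of `f` to negative first arguments as an odd function. -/
noncomputable def oddExt (f : ℝ → ℝ → ℝ) (x s : ℝ) : ℝ := if 0 ≤ x then f x s else -f (-x) s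

theorem oddExt_of_nonneg {f : ℝ → ℝ → ℝ} {x s : ℝ} (hx : 0 ≤ x) : oddExt f x s = f x s := if_pos hx

theorem oddExt_of_nonpos {f : ℝ → ℝ → ℝ} {x s : ℝ} (h0 : f 0 s = 0) (hx : x ≤ 0) :
    oddExt f x s = -f (-x) s := by
  rcases hx.lt_or_eq with h | rfl
  · exact if_neg (not_le.2 h)
  · rw [oddExt, if_pos le_rfl, neg_zero, h0, neg_zero]

theorem oddExt_neg {f : ℝ → ℝ → ℝ} {s : ℝ} (h0 : f 0 s = 0) (x : ℝ) :
    oddExt f (-x) s = -oddExt f x s := by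
  rcases le_total 0 x with h | h
  · rw [oddExt_of_nonpos h0 (neg_nonpos.2 h), oddExt_of_nonneg h, neg_neg]
  · rw [oddExt_of_nonneg (neg_nonneg.2 h), oddExt_of_nonpos h0 h, neg_neg]

theorem oddExt_sign_mul {f : ℝ → ℝ → ℝ} {s : ℝ} (h0 : f 0 s = 0) {a : ℝ} (ha : a = 1 ∨ a = -1)
    (x : ℝ) : oddExt f (a * x) s = a * oddExt f x s := by
  rcases ha with rfl | rfl
  · simp
  · rw [neg_one_mul, oddExt_neg h0, neg_one_mul]

theorem abs_oddExt {f : ℝ → ℝ → ℝ} (x s : ℝ) : |oddExt f x s| = |f |x| s| := by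
  unfold oddExt
  split_ifs with h
  · rw [abs_of_nonneg h]
  · rw [abs_neg, abs_of_neg (not_le.1 h)]

/-- For arguments of opposite signs the comparison passes through `0`, where `f` vanishes for both
parameters; there the distance in the first variable alone suffices. -/
theorem abs_oddExt_sub_le {f : ℝ → ℝ → ℝ} {C : ℝ} {s s' x x' : ℝ}
    (hf : ∀ t s t' s' : ℝ, |f t s - f t' s'| ≤ C * (|t - t'| + |s - s'|))
    (h0 : f 0 s = 0) (h0' : f 0 s' = 0) :
    |oddExt f x s - oddExt f x' s'| ≤ C * (|x - x'| + |s - s'|) := by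
  have hf' : ∀ t t' σ : ℝ, |f t σ - f t' σ| ≤ C * |t - t'| := fun t t' σ => by
    simpa using hf t σ t' σ
  have hC : 0 ≤ C := by
    have := (abs_nonneg _).trans (hf' 1 0 0)
    simpa using this
  have key : ∀ a b σ τ : ℝ, 0 ≤ a → b ≤ 0 → f 0 σ = 0 → f 0 τ = 0 →
      |oddExt f a σ - oddExt f b τ| ≤ C * |a - b| := fun a b σ τ ha hb h1 h2 => by
    rw [oddExt_of_nonneg ha, oddExt_of_nonpos h2 hb, abs_of_nonneg (a := a - b) (by linarith)]
    have e1 := hf' a 0 σ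
    have e2 := hf' (-b) 0 τ
    rw [h1, sub_zero, sub_zero, abs_of_nonneg ha] at e1
    rw [h2, sub_zero, sub_zero, abs_of_nonneg (neg_nonneg.2 hb)] at e2
    calc |f a σ - -f (-b) τ| = |f a σ + f (-b) τ| := by rw [sub_neg_eq_add]
      _ ≤ |f a σ| + |f (-b) τ| := abs_add_le _ _
      _ ≤ C * (a - b) := by linarith
  have hs : C * |x - x'| ≤ C * (|x - x'| + |s - s'|) := by
    gcongr; linarith [abs_nonneg (s - s')]
  rcases le_total 0 x with hx | hx <;> rcases le_total 0 x' with hx' | hx'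
  · rw [oddExt_of_nonneg hx, oddExt_of_nonneg hx']; exact hf x s x' s'
  · exact (key x x' s s' hx hx' h0 h0').trans hs
  · rw [abs_sub_comm]
    exact (key x' x s' s hx' hx h0' h0).trans (by rw [abs_sub_comm]; exact hs)
  · rw [oddExt_of_nonpos h0 hx, oddExt_of_nonpos h0' hx']
    have := hf (-x) s (-x') s'
    rw [show -x - -x' = -(x - x') by ring, abs_neg] at this
    rwa [show -f (-x) s - -f (-x') s' = -(f (-x) s - f (-x') s') by ring, abs_neg]

/-! ### The planar interpolation -/

/-- The first coordinate of a piecewise linear homeomorphism of the unit square into the plane. -/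
noncomputable def planarFst (l t s : ℝ) : ℝ :=
  t + (l - 1 / 3) * s - (l - 1 / 3) * max 0 (s - 3 * t) - (l + 1 / 3) * max 0 (3 * t + 4 * s - 5)

/-- The second coordinate of a piecewise linear homeomorphism of the unit square into the plane,
which on `s = 0` traces a side of the square `|x| + |y| = 1` and on `s = 1` three sides of
`|x| + |y| = l`. -/
noncomputable def planarSnd (l t s : ℝ) : ℝ :=
  (5 - 3 * t - 4 * s) / 5 - 2 / 5 * max 0 (t - 2 * s) + (l - 1 / 5) * max 0 (s - 3 * t)
    - (l - 1 / 5) * max 0 (3 * t + 4 * s - 5) + 2 * l * max 0 (3 * t + 2 * s - 4)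

theorem planarFst_zero (l : ℝ) {s : ℝ} (h0 : 0 ≤ s) (h1 : s ≤ 1) : planarFst l 0 s = 0 := by
  unfold planarFst
  rw [max_eq_right (by linarith), max_eq_left (by linarith)]; ring

/-- The vertical edges of the square go into coordinate axes: `t = 0` into the second, `t = 1` into
the first. This is what allows the planar map to be continued by reflections. -/
theorem planarSnd_one (l : ℝ) {s : ℝ} (h1 : s ≤ 1) : planarSnd l 1 s = 0 := by
  unfold planarSnd
  rw [max_eq_left (a := (0 : ℝ)) (b := s - 3 * 1) (by linarith)]
  rcases le_total s (1 / 2) with h | h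
  · rw [max_eq_right (by linarith), max_eq_left (by linarith), max_eq_left (by linarith)]; ring
  · rw [max_eq_left (by linarith), max_eq_right (by linarith), max_eq_right (by linarith)]; ring

theorem planarFst_bottom (l : ℝ) {t : ℝ} (h0 : 0 ≤ t) (h1 : t ≤ 1) : planarFst l t 0 = t := by
  unfold planarFst
  rw [max_eq_left (by linarith), max_eq_left (by linarith)]; ring

theorem planarSnd_bottom (l : ℝ) {t : ℝ} (h0 : 0 ≤ t) (h1 : t ≤ 1) : planarSnd l t 0 = 1 - t := by
  unfold planarSnd
  rw [max_eq_right (by linarith), max_eq_left (by linarith), max_eq_left (by linarith),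
    max_eq_left (by linarith)]; ring

theorem abs_max_zero_sub_le (a b : ℝ) : |max 0 a - max 0 b| ≤ |a - b| := by
  have := abs_max_sub_max_le_abs a b 0
  rwa [max_comm a, max_comm b] at this

theorem abs_mul_max_zero_sub_le {c l a b e : ℝ} (hc : 0 ≤ c) (hcl : c ≤ l) (he : |a - b| ≤ e) :
    |c * (max 0 a - max 0 b)| ≤ l * e := by
  rw [abs_mul, abs_of_nonneg hc]
  exact mul_le_mul hcl ((abs_max_zero_sub_le a b).trans he) (abs_nonneg _) (hc.trans hcl)

theorem abs_planarFst_sub_le {l : ℝ} (hl : 1 ≤ l) (t s t' s' : ℝ) :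
    |planarFst l t s - planarFst l t' s'| ≤ 20 * l * (|t - t'| + |s - s'|) := by
  have hA := abs_nonneg (t - t')
  have hB := abs_nonneg (s - s')
  set A := |t - t'| with hAd
  set B := |s - s'| with hBd
  have e1 : |(s - 3 * t) - (s' - 3 * t')| ≤ 3 * A + B := by
    rw [show (s - 3 * t) - (s' - 3 * t') = (s - s') - 3 * (t - t') by ring]
    refine (abs_sub _ _).trans ?_
    rw [abs_mul, abs_of_pos (by norm_num : (0 : ℝ) < 3)]; linarith
  have e2 : |(3 * t + 4 * s - 5) - (3 * t' + 4 * s' - 5)| ≤ 3 * A + 4 * B := by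
    rw [show (3 * t + 4 * s - 5) - (3 * t' + 4 * s' - 5) = 3 * (t - t') + 4 * (s - s') by ring]
    refine (abs_add_le _ _).trans ?_
    rw [abs_mul, abs_mul, abs_of_pos (by norm_num : (0 : ℝ) < 3),
      abs_of_pos (by norm_num : (0 : ℝ) < 4)]
  have m1 := abs_le.1 (abs_mul_max_zero_sub_le (c := l - 1 / 3) (l := l) (by linarith)
    (by linarith) e1)
  have m2 := abs_le.1 (abs_mul_max_zero_sub_le (c := l + 1 / 3) (l := 2 * l) (by linarith)
    (by linarith) e2)
  have m3 : |(l - 1 / 3) * (s - s')| ≤ l * B := by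
    rw [abs_mul, abs_of_nonneg (by linarith)]; gcongr; linarith
  rw [abs_le] at m3
  have m4 := abs_le.1 hAd.ge
  have lA : A ≤ l * A := le_mul_of_one_le_left hA hl
  have lB : B ≤ l * B := le_mul_of_one_le_left hB hl
  unfold planarFst
  rw [abs_le]
  constructor <;> linarith [m1.1, m1.2, m2.1, m2.2, m3.1, m3.2, m4.1, m4.2]

theorem abs_planarSnd_sub_le {l : ℝ} (hl : 1 ≤ l) (t s t' s' : ℝ) :
    |planarSnd l t s - planarSnd l t' s'| ≤ 20 * l * (|t - t'| + |s - s'|) := by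
  have hA := abs_nonneg (t - t')
  have hB := abs_nonneg (s - s')
  set A := |t - t'| with hAd
  set B := |s - s'| with hBd
  have m4 := abs_le.1 hAd.ge
  have m5 := abs_le.1 hBd.ge
  have e1 : |(s - 3 * t) - (s' - 3 * t')| ≤ 3 * A + B := by
    rw [abs_le]; constructor <;> linarith [m4.1, m4.2, m5.1, m5.2]
  have e2 : |(3 * t + 4 * s - 5) - (3 * t' + 4 * s' - 5)| ≤ 3 * A + 4 * B := by
    rw [abs_le]; constructor <;> linarith [m4.1, m4.2, m5.1, m5.2]
  have e3 : |(t - 2 * s) - (t' - 2 * s')| ≤ A + 2 * B := by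
    rw [abs_le]; constructor <;> linarith [m4.1, m4.2, m5.1, m5.2]
  have e4 : |(3 * t + 2 * s - 4) - (3 * t' + 2 * s' - 4)| ≤ 3 * A + 2 * B := by
    rw [abs_le]; constructor <;> linarith [m4.1, m4.2, m5.1, m5.2]
  have m1 := abs_le.1 (abs_mul_max_zero_sub_le (c := l - 1 / 5) (l := l) (by linarith)
    (by linarith) e1)
  have m2 := abs_le.1 (abs_mul_max_zero_sub_le (c := l - 1 / 5) (l := l) (by linarith)
    (by linarith) e2)
  have m3 := abs_le.1 (abs_mul_max_zero_sub_le (c := 2 / 5) (l := 1) (by norm_num)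
    (by norm_num) e3)
  have m6 := abs_le.1 (abs_mul_max_zero_sub_le (c := 2 * l) (l := 2 * l) (by linarith)
    le_rfl e4)
  have lA : A ≤ l * A := le_mul_of_one_le_left hA hl
  have lB : B ≤ l * B := le_mul_of_one_le_left hB hl
  unfold planarSnd
  rw [abs_le]
  constructor <;>
    linarith [m1.1, m1.2, m2.1, m2.2, m3.1, m3.2, m4.1, m4.2, m5.1, m5.2, m6.1, m6.2]

theorem abs_add_abs_le_of_forall {a b c : ℝ} (h1 : a + b ≤ c) (h2 : a - b ≤ c) (h3 : -a + b ≤ c)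
    (h4 : -a - b ≤ c) : |a| + |b| ≤ c := by
  rcases abs_cases a with h | h <;> rcases abs_cases b with h' | h' <;> linarith [h.1, h'.1]

/-- On each of the five triangles the map is affine, and the target region is convex, so this is a
statement about the vertices; the only image not on one of the curves `|x| + |y| = 1`, `|x| + |y| =
l` is that of `(1, 1/2)`, namely `((3 l + 5) / 6, 0)`. -/
theorem abs_planar_add_le {l t s : ℝ} (hl : 8 ≤ l) (ht : 0 ≤ t) (ht' : t ≤ 1) (hs : 0 ≤ s)
    (hs' : s ≤ 1) : |planarFst l t s| + |planarSnd l t s| ≤ l := by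
  have hl0 : 0 ≤ l - 8 := by linarith
  have p1 := mul_nonneg hl0 ht
  have p2 := mul_nonneg hl0 (sub_nonneg.2 ht')
  have p3 := mul_nonneg hl0 hs
  have p4 := mul_nonneg hl0 (sub_nonneg.2 hs')
  unfold planarFst planarSnd
  rcases le_total (s - 3 * t) 0 with h1 | h1 <;>
  rcases le_total (3 * t + 4 * s - 5) 0 with h2 | h2 <;>
  rcases le_total (t - 2 * s) 0 with h3 | h3 <;>
  rcases le_total (3 * t + 2 * s - 4) 0 with h4 | h4 <;>
  first
  | (exfalso; linarith)
  | skip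
  -- Once the signs are fixed, the only nonlinear terms are products of `l` with `t` and `s`. The
  -- linear constraints multiplied by `l - 8 ≥ 0` make these accessible to linear arithmetic.
  all_goals
    have p5 := mul_nonneg hl0 (abs_nonneg (s - 3 * t))
    have p6 := mul_nonneg hl0 (abs_nonneg (3 * t + 4 * s - 5))
    have p7 := mul_nonneg hl0 (abs_nonneg (t - 2 * s))
    have p8 := mul_nonneg hl0 (abs_nonneg (3 * t + 2 * s - 4))
    simp only [abs_of_nonneg, abs_of_nonpos, max_eq_left, max_eq_right, h1, h2, h3, h4]
      at p5 p6 p7 p8 ⊢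
    refine abs_add_abs_le_of_forall ?_ ?_ ?_ ?_ <;> linarith

/-- Points off the lines along which the piecewise linear planar map has a break. -/
def PlanarGeneric (t s : ℝ) : Prop :=
  s - 3 * t ≠ 0 ∧ 3 * t + 4 * s - 5 ≠ 0 ∧ t - 2 * s ≠ 0 ∧ 3 * t + 2 * s - 4 ≠ 0

theorem eventually_max_zero_eq {f : ℝ × ℝ → ℝ} (hf : Continuous f) {p : ℝ × ℝ} (hp : f p ≠ 0) :
    ∃ e : ℝ, (∀ᶠ q in nhds p, max 0 (f q) = e * f q) ∧ (e = 0 ∧ f p < 0 ∨ e = 1 ∧ 0 < f p) := by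
  rcases hp.lt_or_gt with h | h
  · refine ⟨0, ?_, Or.inl ⟨rfl, h⟩⟩
    filter_upwards [hf.continuousAt.eventually (gt_mem_nhds h)] with q hq
    rw [max_eq_left hq.le, zero_mul]
  · refine ⟨1, ?_, Or.inr ⟨rfl, h⟩⟩
    filter_upwards [hf.continuousAt.eventually (lt_mem_nhds h)] with q hq
    rw [max_eq_right hq.le, one_mul]

/-- The triangulation has vertices `(0,0)`, `(1,0)`, `(1,1/2)`, `(1,1)`, `(2/3,1)`, `(1/3,1)`,
`(0,1)`. The second coordinate is positive below the line `3 t + 4 s = 5` and negative above it. The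
agreement of its sign with that of `a`, the derivative of the first coordinate in `t`, makes the
spatial Jacobian positive; `a' ≠ 0` serves to show that ties in the signed minimum are negligible.
-/
theorem exists_affine_planar {l t s : ℝ} (hl : 8 ≤ l) (ht : 0 < t) (ht' : t < 1) (hs : 0 < s)
    (hs' : s < 1) (hg : PlanarGeneric t s) :
    ∃ a b c a' b' c' : ℝ, (∀ᶠ p : ℝ × ℝ in nhds (t, s),
      planarFst l p.1 p.2 = a * p.1 + b * p.2 + c ∧
      planarSnd l p.1 p.2 = a' * p.1 + b' * p.2 + c') ∧ 1 ≤ a * b' - b * a' ∧ a' ≠ 0 ∧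
      ((0 < planarSnd l t s ∧ 1 ≤ a) ∨ (planarSnd l t s < 0 ∧ a ≤ -1)) := by
  obtain ⟨g1, g2, g3, g4⟩ := hg
  obtain ⟨e1, E1, c1⟩ := eventually_max_zero_eq (f := fun p => p.2 - 3 * p.1) (by fun_prop)
    (p := (t, s)) g1
  obtain ⟨e2, E2, c2⟩ := eventually_max_zero_eq (f := fun p => 3 * p.1 + 4 * p.2 - 5) (by fun_prop)
    (p := (t, s)) g2
  obtain ⟨e3, E3', c3⟩ := eventually_max_zero_eq (f := fun p => p.1 - 2 * p.2) (by fun_prop)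
    (p := (t, s)) g3
  obtain ⟨e4, E4, c4⟩ := eventually_max_zero_eq (f := fun p => 3 * p.1 + 2 * p.2 - 4) (by fun_prop)
    (p := (t, s)) g4
  have hev : ∀ᶠ p : ℝ × ℝ in nhds (t, s),
      planarFst l p.1 p.2 = (1 + 3 * (l - 1 / 3) * e1 - 3 * (l + 1 / 3) * e2) * p.1
        + ((l - 1 / 3) - (l - 1 / 3) * e1 - 4 * (l + 1 / 3) * e2) * p.2 + 5 * (l + 1 / 3) * e2 ∧
      planarSnd l p.1 p.2 = (-3 / 5 - 2 / 5 * e3 - 3 * (l - 1 / 5) * e1 - 3 * (l - 1 / 5) * e2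
          + 6 * l * e4) * p.1
        + (-4 / 5 + 4 / 5 * e3 + (l - 1 / 5) * e1 - 4 * (l - 1 / 5) * e2 + 4 * l * e4) * p.2
        + (1 + 5 * (l - 1 / 5) * e2 - 8 * l * e4) := by
    filter_upwards [E1, E2, E3', E4] with p h1 h2 h3 h4
    unfold planarFst planarSnd
    rw [h1, h2, h3, h4]
    constructor <;> ring
  refine ⟨_, _, _, _, _, _, hev, ?_⟩
  rw [(hev.self_of_nhds).2]
  dsimp only at c1 c2 c3 c4 ⊢
  clear hev E1 E2 E3' E4 g1 g2 g3 g4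
  have hl0 : 0 < l := by linarith
  -- Of the sixteen sign patterns only five occur in the open square, one for each triangle; the
  -- others contradict the linear constraints.
  rcases c1 with ⟨rfl, c1⟩ | ⟨rfl, c1⟩ <;> rcases c2 with ⟨rfl, c2⟩ | ⟨rfl, c2⟩ <;>
  rcases c3 with ⟨rfl, c3⟩ | ⟨rfl, c3⟩ <;> rcases c4 with ⟨rfl, c4⟩ | ⟨rfl, c4⟩ <;>
  first
  | (exfalso; linarith)
  | skip
  · refine ⟨by nlinarith, by norm_num, Or.inl ⟨by linarith, by linarith⟩⟩
  · refine ⟨by nlinarith, by norm_num, Or.inl ⟨by linarith, by linarith⟩⟩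
  · have := mul_pos hl0 c2
    refine ⟨by nlinarith, by nlinarith, Or.inr ⟨by nlinarith, by nlinarith⟩⟩
  · have := mul_pos hl0 (sub_pos.2 ht')
    refine ⟨by nlinarith, by nlinarith, Or.inr ⟨by nlinarith, by nlinarith⟩⟩
  · have := mul_pos hl0 c1
    refine ⟨by nlinarith, by nlinarith, Or.inl ⟨by nlinarith, by nlinarith⟩⟩

/-! ### Symmetries of the folding under sign changes, shifts and odd multiples. -/

theorem abs_neg_one_zpow_cases (n : ℤ) : (-1 : ℝ) ^ n = 1 ∨ (-1 : ℝ) ^ n = -1 := by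
  rcases Int.even_or_odd n with h | h
  · exact Or.inl h.neg_one_zpow
  · exact Or.inr h.neg_one_zpow

theorem beamCoord_of_abs_le {w : ℝ} (hw : |w| ≤ 1) : beamCoord w = w := by
  simpa using beamCoord_eq_of_abs_le (N := 0) hw

theorem beamCoord_neg (t : ℝ) : beamCoord (-t) = -beamCoord t := by
  have h := beamCoord_eq_of_abs_le (N := -beamIndex t) (w := -beamCoord t)
    (by rw [abs_neg]; exact abs_beamCoord_le t)
  rw [← h]
  congr 1
  nth_rw 1 [beamCoord_eq t]
  rw [neg_one_zpow_congr (k := -beamIndex t) (l := beamIndex t) (by simp)]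
  push_cast; ring

theorem beamCoord_sub_two_mul (t : ℝ) (j : ℤ) : beamCoord (t - 2 * j) = (-1) ^ j * beamCoord t := by
  have h := beamCoord_eq_of_abs_le (N := beamIndex t - j) (w := (-1) ^ j * beamCoord t)
    (by rw [abs_mul, abs_neg_one_zpow, one_mul]; exact abs_beamCoord_le t)
  rw [← h]
  congr 1
  nth_rw 1 [beamCoord_eq t]
  rw [zpow_sub₀ (by norm_num)]
  have : (-1 : ℝ) ^ j ≠ 0 := by rcases abs_neg_one_zpow_cases j with h | h <;> rw [h] <;> norm_num
  push_cast; field_simp; ring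

theorem beamCoord_three_mul {t : ℝ} (h0 : 0 ≤ t) (h1 : t ≤ 1) :
    beamCoord (3 * t) = if t ≤ 1 / 3 then 3 * t else 2 - 3 * t := by
  split_ifs with h
  · exact beamCoord_of_abs_le (by rw [abs_le]; constructor <;> linarith)
  · have := beamCoord_eq_of_abs_le (N := 1) (w := 2 - 3 * t)
      (by rw [abs_le]; constructor <;> linarith)
    rw [← this]; congr 1; norm_num

theorem beamCoord_sign_mul {a : ℝ} (ha : a = 1 ∨ a = -1) (t : ℝ) :
    beamCoord (a * t) = a * beamCoord t := by
  rcases ha with rfl | rfl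
  · simp
  · rw [neg_one_mul, beamCoord_neg, neg_one_mul]

/-- For `d = 2 j + 1` one has `d y + 1 = d (y + 1) - 2 j`, which reduces the cosine-like value to an
odd multiple of `y + 1`, up to the sign `(-1)^j` that occurs on both sides. -/
theorem beamCoord_odd_mul_add_one {d : ℕ} (hd : Odd d) (y : ℝ) :
    beamCoord (d * y + 1) = (-1) ^ beamIndex y * beamCoord (d * beamCoord y + 1) := by
  obtain ⟨j, rfl⟩ := hd
  have h1 : ∀ x : ℝ, beamCoord (((2 * j + 1 : ℕ) : ℝ) * x + 1) =
      (-1) ^ (j : ℤ) * beamCoord (((2 * j + 1 : ℕ) : ℝ) * beamCoord (x + 1)) := fun x => by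
    rw [← (beam_odd_mul ⟨j, rfl⟩ (x + 1)).1, ← beamCoord_sub_two_mul]
    congr 1
    push_cast; ring
  have h2 : beamCoord (beamCoord y + 1) = 1 - |beamCoord y| := by
    have hb := abs_le.1 (abs_beamCoord_le y)
    rcases le_total 0 (beamCoord y) with h | h
    · rw [abs_of_nonneg h]
      have := beamCoord_eq_of_abs_le (N := 1) (w := 1 - beamCoord y)
        (by rw [abs_le]; constructor <;> linarith)
      rw [← this]; congr 1; norm_num; ring
    · rw [abs_of_nonpos h, beamCoord_of_abs_le (by rw [abs_le]; constructor <;> linarith)]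
      ring
  rw [h1, h1, beamCoord_add_one y, h2, mul_left_comm _ ((-1 : ℝ) ^ beamIndex y),
    beamCoord_sign_mul (abs_neg_one_zpow_cases _)]
  ring

/-! ### The periodic planar interpolation -/

/-- The first coordinate of the planar map `planarFst, planarSnd`, extended by reflections. -/
noncomputable def foldFst (l y s : ℝ) : ℝ := oddExt (planarFst l) (beamCoord y) s

/-- The second coordinate of the planar map `planarFst, planarSnd`, extended by reflections. -/
noncomputable def foldSnd (l y s : ℝ) : ℝ :=
  oddExt (fun t s => planarSnd l (1 - t) s) (beamCoord (y + 1)) s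

theorem abs_foldFst_sub_le {l : ℝ} (hl : 1 ≤ l) {y s y' s' : ℝ} (hs : s ∈ Icc (0 : ℝ) 1)
    (hs' : s' ∈ Icc (0 : ℝ) 1) :
    |foldFst l y s - foldFst l y' s'| ≤ 20 * l * (|y - y'| + |s - s'|) := by
  refine (abs_oddExt_sub_le (abs_planarFst_sub_le hl) (planarFst_zero l hs.1 hs.2)
    (planarFst_zero l hs'.1 hs'.2)).trans ?_
  exact mul_le_mul_of_nonneg_left (add_le_add_left (abs_beamCoord_sub_le y y') _) (by linarith)

theorem planarSnd_one_sub_zero (l : ℝ) {s : ℝ} (hs : s ≤ 1) :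
    (fun t s => planarSnd l (1 - t) s) 0 s = 0 := by
  simpa using planarSnd_one l hs

theorem abs_foldSnd_sub_le {l : ℝ} (hl : 1 ≤ l) {y s y' s' : ℝ} (hs : s ∈ Icc (0 : ℝ) 1)
    (hs' : s' ∈ Icc (0 : ℝ) 1) :
    |foldSnd l y s - foldSnd l y' s'| ≤ 20 * l * (|y - y'| + |s - s'|) := by
  refine (abs_oddExt_sub_le (C := 20 * l) (fun t s t' s' => ?_) (planarSnd_one_sub_zero l hs.2)
    (planarSnd_one_sub_zero l hs'.2)).trans ?_
  · have := abs_planarSnd_sub_le hl (1 - t) s (1 - t') s'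
    rwa [show 1 - t - (1 - t') = -(t - t') by ring, abs_neg] at this
  · have := abs_beamCoord_sub_le (y + 1) (y' + 1)
    rw [show y + 1 - (y' + 1) = y - y' by ring] at this
    exact mul_le_mul_of_nonneg_left (add_le_add_left this _) (by linarith)

theorem foldSnd_eq (l y : ℝ) {s : ℝ} (hs : s ≤ 1) :
    foldSnd l y s = (-1) ^ beamIndex y * planarSnd l |beamCoord y| s := by
  rw [foldSnd, beamCoord_add_one, oddExt_sign_mul (planarSnd_one_sub_zero l hs)
    (abs_neg_one_zpow_cases _), oddExt_of_nonneg (sub_nonneg.2 (abs_beamCoord_le y))]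
  simp

theorem abs_fold_add_le {l s : ℝ} (hl : 8 ≤ l) (hs : s ∈ Icc (0 : ℝ) 1) (y : ℝ) :
    |foldFst l y s| + |foldSnd l y s| ≤ l := by
  rw [foldSnd_eq l y hs.2, foldFst, abs_oddExt, abs_mul, abs_neg_one_zpow, one_mul]
  exact abs_planar_add_le hl (abs_nonneg _) (abs_beamCoord_le y) hs.1 hs.2

theorem foldSnd_eq_zero (l : ℝ) {y s : ℝ} (hs : s ≤ 1) (hy : |beamCoord y| = 1) :
    foldSnd l y s = 0 := by
  rw [foldSnd_eq l y hs, hy, planarSnd_one l hs, mul_zero]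

theorem foldFst_odd_mul (l : ℝ) {d : ℕ} (hd : Odd d) (y s : ℝ) :
    foldFst l (d * beamCoord y) s = foldFst l (d * y) s := by
  rw [foldFst, foldFst, ← (beam_odd_mul hd y).1]

/-- Moving `y` to the central beam leaves the first planar coordinate alone and changes the second
by the parity of the beam. For a pair of variables, the product of the two signs is the reflection
built into the Zorich map. -/
theorem foldSnd_odd_mul (l : ℝ) {d : ℕ} (hd : Odd d) (y : ℝ) {s : ℝ} (hs : s ≤ 1) :
    foldSnd l (d * y) s = (-1) ^ beamIndex y * foldSnd l (d * beamCoord y) s := by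
  rw [foldSnd, foldSnd, beamCoord_odd_mul_add_one hd, oddExt_sign_mul (planarSnd_one_sub_zero l hs)
    (abs_neg_one_zpow_cases _)]

theorem oddExt_eq_self {f : ℝ → ℝ → ℝ} {s x : ℝ} {g : ℝ → ℝ} (hg : ∀ x, g (-x) = -g x)
    (hf : ∀ t, 0 ≤ t → t ≤ 1 → f t s = g t) (hx : |x| ≤ 1) : oddExt f x s = g x := by
  rw [abs_le] at hx
  have h0 : f 0 s = 0 := by
    have h1 := hg 0
    rw [neg_zero] at h1
    rw [hf 0 le_rfl zero_le_one]; linarith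
  rcases le_total 0 x with h | h
  · rw [oddExt_of_nonneg h, hf x h hx.2]
  · rw [oddExt_of_nonpos h0 h, hf (-x) (by linarith) (by linarith), hg, neg_neg]

theorem foldFst_bottom (l y : ℝ) : foldFst l y 0 = beamCoord y :=
  oddExt_eq_self (g := fun x => x) (fun _ => rfl) (fun _ h h' => planarFst_bottom l h h')
    (abs_beamCoord_le y)

theorem foldSnd_bottom (l y : ℝ) : foldSnd l y 0 = beamCoord (y + 1) :=
  oddExt_eq_self (g := fun x => x) (fun _ => rfl)
    (fun t h h' => by
      have := planarSnd_bottom l (t := 1 - t) (by linarith) (by linarith)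
      simpa using this)
    (abs_beamCoord_le _)

theorem planarFst_top (l : ℝ) {t : ℝ} (h0 : 0 ≤ t) (h1 : t ≤ 1) :
    planarFst l t 1 = l * beamCoord (3 * t) := by
  rw [beamCoord_three_mul h0 h1]
  unfold planarFst
  split_ifs with h
  · rw [max_eq_right (by linarith), max_eq_left (by linarith)]; ring
  · rw [max_eq_left (by linarith), max_eq_right (by linarith)]; ring

theorem planarSnd_top (l : ℝ) {t : ℝ} (h0 : 0 ≤ t) (h1 : t ≤ 1) :
    planarSnd l (1 - t) 1 = -l * beamCoord (3 * t) := by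
  rw [beamCoord_three_mul h0 h1]
  unfold planarSnd
  rw [max_eq_left (a := (0 : ℝ)) (b := 1 - t - 2 * 1) (by linarith)]
  split_ifs with h
  · rw [max_eq_left (by linarith), max_eq_right (by linarith), max_eq_right (by linarith)]; ring
  · rw [max_eq_left (a := (0 : ℝ)) (b := 3 * (1 - t) + 2 * 1 - 4) (by linarith)]
    rcases le_total (1 - 3 * (1 - t)) 0 with h' | h'
    · rw [max_eq_left h', max_eq_right (by linarith)]; ring
    · rw [max_eq_right h', max_eq_left (by linarith)]; ring

theorem foldFst_top (l y : ℝ) : foldFst l y 1 = l * beamCoord (3 * y) := by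
  have h := (beam_odd_mul (d := 3) (by decide) y).1
  push_cast at h
  rw [h]
  exact oddExt_eq_self (g := fun x => l * beamCoord (3 * x))
    (fun x => by rw [mul_neg, beamCoord_neg, mul_neg]) (fun _ h h' => planarFst_top l h h')
    (abs_beamCoord_le y)

theorem foldSnd_top (l y : ℝ) : foldSnd l y 1 = l * beamCoord (3 * y + 1) := by
  have h := (beam_odd_mul (d := 3) (by decide) (y + 1)).1
  push_cast at h
  have h2 := beamCoord_sub_two_mul (3 * (y + 1)) 1
  rw [show 3 * (y + 1) - 2 * ((1 : ℤ) : ℝ) = 3 * y + 1 by push_cast; ring, h] at h2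
  rw [h2]
  have := oddExt_eq_self (g := fun x => -l * beamCoord (3 * x))
    (fun x => by rw [mul_neg, beamCoord_neg, mul_neg]) (fun _ h h' => planarSnd_top l h h')
    (abs_beamCoord_le (y + 1))
  rw [foldSnd, this]; simp

/-- Away from the integers the folding is locally affine: `c` is the centre of the beam, `b` the
parity sign of the beam and `σ` the sign of `beamCoord y`. -/
theorem eventually_beamCoord_eq {y : ℝ} (h0 : 0 < |beamCoord y|) (h1 : |beamCoord y| < 1) :
    ∃ σ b c : ℝ, (σ = 1 ∨ σ = -1) ∧ (b = 1 ∨ b = -1) ∧ |beamCoord y| = σ * b * (y - c) ∧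
      ∀ᶠ z in nhds y, 0 < σ * b * (z - c) ∧ beamCoord z = σ * (σ * b * (z - c)) ∧
        beamCoord (z + 1) = b * (1 - σ * b * (z - c)) := by
  set n := beamIndex y with hn
  set b : ℝ := (-1) ^ n with hb
  have hb1 : b = 1 ∨ b = -1 := abs_neg_one_zpow_cases n
  have hbb : b * b = 1 := by rcases hb1 with h | h <;> rw [h] <;> norm_num
  have hS : beamCoord y = b * (y - 2 * n) := rfl
  have habs : |beamCoord y| = |y - 2 * n| := by
    rw [hS, abs_mul, hb, abs_neg_one_zpow, one_mul]
  rw [habs] at h0 h1 ⊢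
  have hne : y - 2 * n ≠ 0 := abs_pos.1 h0
  obtain ⟨η, hη, hpos⟩ : ∃ η : ℝ, (η = 1 ∨ η = -1) ∧ |y - 2 * n| = η * (y - 2 * n) := by
    rcases abs_choice (y - 2 * n) with h | h
    · exact ⟨1, Or.inl rfl, by rw [h, one_mul]⟩
    · exact ⟨-1, Or.inr rfl, by rw [h, neg_one_mul]⟩
  have hηη : η * η = 1 := by rcases hη with h | h <;> rw [h] <;> norm_num
  have hσ : b * η * b = η := by linear_combination η * hbb
  refine ⟨b * η, b, 2 * n, ?_, hb1, by rw [hσ, hpos], ?_⟩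
  · rcases hb1 with h | h <;> rcases hη with h' | h' <;> rw [h, h'] <;> norm_num
  rw [hσ]
  have hc1 : ∀ᶠ z in nhds y, 0 < η * (z - 2 * n) :=
    (by fun_prop : Continuous fun z : ℝ => η * (z - 2 * n)).continuousAt.eventually
      (lt_mem_nhds (by simpa only [← hpos] using h0))
  have hc2 : ∀ᶠ z in nhds y, η * (z - 2 * n) < 1 :=
    (by fun_prop : Continuous fun z : ℝ => η * (z - 2 * n)).continuousAt.eventually
      (gt_mem_nhds (by simpa only [← hpos] using h1))
  filter_upwards [hc1, hc2] with z z1 z2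
  have hi : beamIndex z = n := by
    apply beamIndex_eq <;> rcases hη with h | h <;> rw [h] at z1 z2 <;> linarith
  have hz : beamCoord z = b * η * (η * (z - 2 * n)) := by
    rw [beamCoord, hi]; linear_combination -(b * (z - 2 * n)) * hηη
  refine ⟨z1, hz, ?_⟩
  rw [beamCoord_add_one, hi, hz, abs_mul, abs_of_pos z1, abs_mul, hb, abs_neg_one_zpow, one_mul]
  rcases hη with h | h <;> rw [h] <;> norm_num

/-- Locally the folded map is `(σ f, β g)` evaluated at `(σ β (y - k), s)`, with `(f, g)` the planar
map. The signs cancel in the Jacobian, while `∂F/∂y` and `S` both acquire the factor `β`, so that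
their signs still agree. -/
theorem exists_affine_fold {l y s : ℝ} (hl : 8 ≤ l) (h0 : 0 < |beamCoord y|)
    (h1 : |beamCoord y| < 1) (hs : 0 < s) (hs' : s < 1) (hg : PlanarGeneric |beamCoord y| s) :
    ∃ a b c a' b' c' : ℝ, (∀ᶠ p : ℝ × ℝ in nhds (y, s), foldFst l p.1 p.2 = a * p.1 + b * p.2 + c ∧
      foldSnd l p.1 p.2 = a' * p.1 + b' * p.2 + c') ∧ 1 ≤ a * b' - b * a' ∧ a' ≠ 0 ∧
      ((0 < foldSnd l y s ∧ 1 ≤ a) ∨ (foldSnd l y s < 0 ∧ a ≤ -1)) := by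
  obtain ⟨σ, β, k, hσ, hβ, hk, hev⟩ := eventually_beamCoord_eq h0 h1
  obtain ⟨a, b, c, a', b', c', hq, hdet, hne, hsgn⟩ := exists_affine_planar hl h0 h1 hs hs' hg
  have hσσ : σ * σ = 1 := by rcases hσ with h | h <;> rw [h] <;> norm_num
  have hββ : β * β = 1 := by rcases hβ with h | h <;> rw [h] <;> norm_num
  have hcont : Filter.Tendsto (fun p : ℝ × ℝ => (σ * β * (p.1 - k), p.2)) (nhds (y, s))
      (nhds (|beamCoord y|, s)) := by
    rw [hk]
    exact (by fun_prop : Continuous fun p : ℝ × ℝ => (σ * β * (p.1 - k), p.2)).tendsto (y, s)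
  have hS : ∀ᶠ p : ℝ × ℝ in nhds (y, s), p.2 < 1 :=
    continuous_snd.continuousAt.eventually (gt_mem_nhds hs')
  have hS0 : ∀ᶠ p : ℝ × ℝ in nhds (y, s), 0 < p.2 :=
    continuous_snd.continuousAt.eventually (lt_mem_nhds hs)
  have hmain : ∀ᶠ p : ℝ × ℝ in nhds (y, s),
      foldFst l p.1 p.2 = σ * planarFst l (σ * β * (p.1 - k)) p.2 ∧
      foldSnd l p.1 p.2 = β * planarSnd l (σ * β * (p.1 - k)) p.2 := by
    filter_upwards [continuous_fst.continuousAt.eventually hev, hS, hS0] with p hp hp1 hp0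
    obtain ⟨z1, z2, z3⟩ := hp
    constructor
    · rw [foldFst, z2, oddExt_sign_mul (planarFst_zero l hp0.le hp1.le) hσ, oddExt_of_nonneg z1.le]
    · rw [foldSnd, z3, oddExt_sign_mul (planarSnd_one_sub_zero l hp1.le) hβ, oddExt_of_nonneg]
      · simp
      · have := abs_beamCoord_le (p.1 + 1)
        rw [z3, abs_mul] at this
        have h2 := abs_beamCoord_le p.1
        rw [z2, abs_mul, abs_of_pos z1] at h2
        have h3 : |σ| = 1 := by rcases hσ with h | h <;> rw [h] <;> norm_num
        rw [h3] at h2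
        linarith
  refine ⟨β * a, σ * b, σ * c - β * a * k, σ * a', β * b', β * c' - σ * a' * k, ?_, ?_, ?_, ?_⟩
  · filter_upwards [hmain, hcont.eventually hq] with p h1 h2
    rw [h1.1, h1.2, h2.1, h2.2]
    constructor
    · linear_combination (β * a * (p.1 - k)) * hσσ
    · linear_combination (σ * a' * (p.1 - k)) * hββ
  · have : β * a * (β * b') - σ * b * (σ * a') = a * b' - b * a' := by
      linear_combination (a * b') * hββ - (b * a') * hσσ
    rw [this]; exact hdet
  · rcases hσ with h | h <;> rw [h] <;> simpa using hne
  · have h2 := (hmain.self_of_nhds).2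
    dsimp only at h2
    rw [← hk] at h2
    rw [h2]
    rcases hβ with h | h <;> rw [h]
    · simpa using hsgn
    · rcases hsgn with h3 | h3
      · exact Or.inr ⟨by linarith [h3.1], by linarith [h3.2]⟩
      · exact Or.inl ⟨by linarith [h3.1], by linarith [h3.2]⟩

/-! ### Coordinates in Euclidean space -/

theorem abs_apply_le_norm (x : E3) (i : Fin 3) : |x i| ≤ ‖x‖ := by
  rw [← Real.norm_eq_abs]; exact PiLp.norm_apply_le x i

theorem abs_sub_apply_le_norm (x y : E3) (i : Fin 3) : |x i - y i| ≤ ‖x - y‖ :=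
  abs_apply_le_norm (x - y) i

theorem norm_le_sum_abs (x : E3) : ‖x‖ ≤ |x 0| + |x 1| + |x 2| := by
  have h := EuclideanSpace.real_norm_sq_eq x
  rw [Fin.sum_univ_three, ← sq_abs (x 0), ← sq_abs (x 1), ← sq_abs (x 2)] at h
  have h0 := abs_nonneg (x 0)
  have h1 := abs_nonneg (x 1)
  have h2 := abs_nonneg (x 2)
  refine abs_le_of_sq_le_sq' ?_ (by positivity) |>.2
  nlinarith [mul_nonneg h0 h1, mul_nonneg h0 h2, mul_nonneg h1 h2]

theorem lipschitzOnWith_of_abs_sub_le {f : E3 → E3} {D : Set E3} {C : ℝ} (hC : 0 ≤ C)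
    (h : ∀ x ∈ D, ∀ y ∈ D, ∀ i, |f x i - f y i| ≤ C * ‖x - y‖) :
    LipschitzOnWith (3 * C.toNNReal) f D := by
  refine LipschitzOnWith.of_dist_le_mul fun x hx y hy => ?_
  rw [dist_eq_norm, dist_eq_norm]
  have := norm_le_sum_abs (f x - f y)
  simp only [PiLp.sub_apply] at this
  have h0 := h x hx y hy 0
  have h1 := h x hx y hy 1
  have h2 := h x hx y hy 2
  push_cast
  rw [Real.coe_toNNReal _ hC]
  linarith

theorem det_eq_matrix_det (A : E3 →L[ℝ] E3) {r : Matrix (Fin 3) (Fin 3) ℝ}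
    (h : ∀ v i, A v i = r i 0 * v 0 + r i 1 * v 1 + r i 2 * v 2) : A.det = r.det := by
  have : A.det = LinearMap.det (A : E3 →ₗ[ℝ] E3) := rfl
  rw [this, ← LinearMap.det_toMatrix (EuclideanSpace.basisFun (Fin 3) ℝ).toBasis]
  congr 1
  ext i j
  rw [LinearMap.toMatrix_apply]
  simp only [OrthonormalBasis.coe_toBasis, EuclideanSpace.basisFun_apply,
    OrthonormalBasis.coe_toBasis_repr_apply, EuclideanSpace.basisFun_repr,
    ContinuousLinearMap.coe_coe, h]
  fin_cases j <;> simp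

theorem fderiv_det_eq_matrix_det {f : E3 → E3} {x : E3} (r : Matrix (Fin 3) (Fin 3) ℝ)
    (h : ∀ i, HasFDerivAt (fun x => f x i) (r i 0 • (EuclideanSpace.proj 0 : E3 →L[ℝ] ℝ)
      + r i 1 • (EuclideanSpace.proj 1 : E3 →L[ℝ] ℝ)
      + r i 2 • (EuclideanSpace.proj 2 : E3 →L[ℝ] ℝ)) x) :
    DifferentiableAt ℝ f x ∧ (fderiv ℝ f x).det = r.det := by
  have hd : DifferentiableAt ℝ f x := differentiableAt_euclidean.2 fun i => (h i).differentiableAt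
  refine ⟨hd, det_eq_matrix_det _ fun v i => ?_⟩
  have := ((EuclideanSpace.proj i : E3 →L[ℝ] ℝ).hasFDerivAt.comp x hd.hasFDerivAt).unique (h i)
  have := congrArg (fun L : E3 →L[ℝ] ℝ => L v) this
  simpa using this

theorem hasFDerivAt_of_eventually_affine {f : E3 → ℝ} {x : E3} {a b c k : ℝ}
    (h : ∀ᶠ z in nhds x, f z = a * z 0 + b * z 1 + c * z 2 + k) :
    HasFDerivAt f (a • (EuclideanSpace.proj 0 : E3 →L[ℝ] ℝ)
      + b • (EuclideanSpace.proj 1 : E3 →L[ℝ] ℝ) + c • (EuclideanSpace.proj 2 : E3 →L[ℝ] ℝ)) x := by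
  have := ((a • (EuclideanSpace.proj 0 : E3 →L[ℝ] ℝ)
      + b • (EuclideanSpace.proj 1 : E3 →L[ℝ] ℝ)
      + c • (EuclideanSpace.proj 2 : E3 →L[ℝ] ℝ)).hasFDerivAt (x := x)).add_const k
  refine this.congr_of_eventuallyEq ?_
  filter_upwards [h] with z hz
  simp [hz]

theorem ae_linear_ne {ℓ : E3 →ₗ[ℝ] ℝ} (hℓ : ℓ ≠ 0) (c : ℝ) : ∀ᵐ y : E3, ℓ y ≠ c := by
  rw [ae_iff]
  push Not
  rcases Set.eq_empty_or_nonempty {y : E3 | ℓ y = c} with h | ⟨p, hp⟩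
  · rw [h]; simp
  · have := Measure.addHaar_affineSubspace (volume : Measure E3)
      (AffineSubspace.mk' p (LinearMap.ker ℓ)) fun htop => hℓ (by
        have h1 := AffineSubspace.direction_mk' p (LinearMap.ker ℓ)
        rw [htop, AffineSubspace.direction_top] at h1
        exact LinearMap.ker_eq_top.1 h1.symm)
    refine measure_mono_null (fun y hy => ?_) this
    rw [SetLike.mem_coe, AffineSubspace.mem_mk', LinearMap.mem_ker, vsub_eq_sub, map_sub]
    rw [mem_ofPred_eq] at hy hp
    rw [hy, hp, sub_self]

theorem ae_coord_ne {i : Fin 3} (hi : i ≠ 2) {a b : ℝ} (ha : a ≠ 0) (c : ℝ) :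
    ∀ᵐ y : E3, a * y i + b * y 2 ≠ c := by
  have := ae_linear_ne (ℓ := a • (EuclideanSpace.proj i : E3 →L[ℝ] ℝ).toLinearMap
    + b • (EuclideanSpace.proj 2 : E3 →L[ℝ] ℝ).toLinearMap) (fun h => ha (by
      have := congrArg (fun L : E3 →ₗ[ℝ] ℝ => L (EuclideanSpace.single i 1)) h
      simpa [hi.symm] using this)) c
  simpa using this

/-! ### The signed minimum -/

/-- The number of absolute value `min |a| |b|` and of the sign of `a * b`. -/
noncomputable def signedMin (a b : ℝ) : ℝ := (|a + b| - |a - b|) / 2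

theorem signedMin_comm (a b : ℝ) : signedMin a b = signedMin b a := by
  rw [signedMin, signedMin, add_comm, abs_sub_comm]

theorem abs_signedMin_sub_le (a b a' b' : ℝ) :
    |signedMin a b - signedMin a' b'| ≤ |a - a'| + |b - b'| := by
  unfold signedMin
  have h1 := abs_le.1 ((abs_abs_sub_abs_le (a + b) (a' + b')))
  have h2 := abs_le.1 ((abs_abs_sub_abs_le (a - b) (a' - b')))
  have h3 : |a + b - (a' + b')| ≤ |a - a'| + |b - b'| := by
    rw [show a + b - (a' + b') = (a - a') + (b - b') by ring]; exact abs_add_le _ _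
  have h4 : |a - b - (a' - b')| ≤ |a - a'| + |b - b'| := by
    rw [show a - b - (a' - b') = (a - a') - (b - b') by ring]; exact abs_sub _ _
  rw [abs_le]
  constructor <;> linarith [h1.1, h1.2, h2.1, h2.2]

theorem signedMin_of_pos {a b : ℝ} (h : |a| ≤ b) : signedMin a b = a := by
  rw [abs_le] at h
  rw [signedMin, abs_of_nonneg (by linarith), abs_of_nonpos (by linarith)]; ring

theorem signedMin_of_neg {a b : ℝ} (h : |a| ≤ -b) : signedMin a b = -a := by
  rw [abs_le] at h
  rw [signedMin, abs_of_nonpos (by linarith), abs_of_nonneg (by linarith)]; ring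

theorem signedMin_zero (a : ℝ) : signedMin a 0 = 0 := by simp [signedMin]

theorem zero_signedMin (a : ℝ) : signedMin 0 a = 0 := by simp [signedMin]

theorem signedMin_neg_left (a b : ℝ) : signedMin (-a) b = -signedMin a b := by
  rw [signedMin, signedMin, show -a + b = -(a - b) by ring, show -a - b = -(a + b) by ring,
    abs_neg, abs_neg]; ring

theorem signedMin_sign_mul {ε δ : ℝ} (hε : ε = 1 ∨ ε = -1) (hδ : δ = 1 ∨ δ = -1) (a b : ℝ) :
    signedMin (ε * a) (δ * b) = ε * δ * signedMin a b := by
  rcases hε with rfl | rfl <;> rcases hδ with rfl | rfl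
  · simp
  · rw [one_mul, neg_one_mul, signedMin_comm, signedMin_neg_left, signedMin_comm]; ring
  · rw [one_mul, neg_one_mul, signedMin_neg_left]; ring
  · rw [neg_one_mul, neg_one_mul, signedMin_neg_left, signedMin_comm, signedMin_neg_left,
      signedMin_comm]; ring

theorem signedMin_mul_left {c : ℝ} (hc : 0 ≤ c) (a b : ℝ) :
    signedMin (c * a) (c * b) = c * signedMin a b := by
  rw [signedMin, signedMin, ← mul_add, ← mul_sub, abs_mul, abs_mul, abs_of_nonneg hc]; ring

theorem abs_signedMin (a b : ℝ) : |signedMin a b| = min |a| |b| := by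
  have key : ∀ a b : ℝ, |a| ≤ |b| → |signedMin a b| = |a| := fun a b h => by
    rcases abs_choice b with hb | hb <;> rw [hb] at h
    · rw [signedMin_of_pos h]
    · rw [signedMin_of_neg h, abs_neg]
  rcases le_total |a| |b| with h | h
  · rw [key a b h, min_eq_left h]
  · rw [signedMin_comm, key b a h, min_eq_right h]

/-! ### The interpolation in the coordinates of the Zorich map -/

/-- The interpolation between the Zorich map at height `0` and its value at the triple point at
height `1`, in piecewise linear coordinates. -/
noncomputable def interpMap (l : ℝ) (y : E3) : E3 :=
  !₂[foldFst l (y 0) (y 2), foldFst l (y 1) (y 2),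
    signedMin (foldSnd l (y 0) (y 2)) (foldSnd l (y 1) (y 2))]

theorem interpMap_lipschitzOnWith {l : ℝ} (hl : 1 ≤ l) :
    LipschitzOnWith (3 * (80 * l).toNNReal) (interpMap l) {y | 0 ≤ y 2 ∧ y 2 ≤ 1} := by
  refine lipschitzOnWith_of_abs_sub_le (by linarith) fun x hx y hy i => ?_
  have h2 := abs_sub_apply_le_norm x y 2
  have hF : ∀ j, 20 * l * (|x j - y j| + |x 2 - y 2|) ≤ 40 * l * ‖x - y‖ := fun j => by
    have := mul_le_mul_of_nonneg_left (add_le_add (abs_sub_apply_le_norm x y j) h2)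
      (by linarith : 0 ≤ 20 * l)
    linarith
  have hn : 0 ≤ l * ‖x - y‖ := by positivity
  fin_cases i
  · have := (abs_foldFst_sub_le hl hx hy).trans (hF 0)
    simp [interpMap]; linarith
  · have := (abs_foldFst_sub_le hl hx hy).trans (hF 1)
    simp [interpMap]; linarith
  · have h0 := (abs_foldSnd_sub_le hl hx hy).trans (hF 0)
    have h1 := (abs_foldSnd_sub_le hl hx hy).trans (hF 1)
    have := abs_signedMin_sub_le (foldSnd l (x 0) (x 2)) (foldSnd l (x 1) (x 2))
      (foldSnd l (y 0) (y 2)) (foldSnd l (y 1) (y 2))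
    simp [interpMap]; linarith

theorem ae_generic {i : Fin 3} (hi : i ≠ 2) : ∀ᵐ y : E3,
    0 < |beamCoord (y i)| ∧ |beamCoord (y i)| < 1 ∧ PlanarGeneric |beamCoord (y i)| (y 2) := by
  -- Since `|beamCoord t|` is always one of the affine functions `±(t - 2 n)`, the excluded set lies
  -- in countably many planes.
  have key : ∀ a b c : ℝ, a ≠ 0 → ∀ᵐ y : E3, a * |beamCoord (y i)| + b * y 2 ≠ c := by
    intro a b c ha
    have h1 : ∀ᵐ y : E3, ∀ n : ℤ, a * y i + b * y 2 ≠ c + 2 * a * n :=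
      ae_all_iff.2 fun n => ae_coord_ne hi ha _
    have h2 : ∀ᵐ y : E3, ∀ n : ℤ, -a * y i + b * y 2 ≠ c - 2 * a * n :=
      ae_all_iff.2 fun n => ae_coord_ne hi (neg_ne_zero.2 ha) _
    filter_upwards [h1, h2] with y h1 h2 h
    have h3 : |beamCoord (y i)| = |y i - 2 * beamIndex (y i)| := by
      rw [beamCoord, abs_mul, abs_neg_one_zpow, one_mul]
    rw [h3] at h
    rcases abs_choice (y i - 2 * beamIndex (y i)) with h4 | h4 <;> rw [h4] at h
    · exact h1 (beamIndex (y i)) (by linarith)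
    · exact h2 (beamIndex (y i)) (by linarith)
  filter_upwards [key 1 0 0 (by norm_num), key 1 0 1 (by norm_num), key (-3) 1 0 (by norm_num),
    key 3 4 5 (by norm_num), key 1 (-2) 0 (by norm_num), key 3 2 4 (by norm_num)]
    with y k1 k2 k3 k4 k5 k6
  refine ⟨lt_of_le_of_ne (abs_nonneg _) fun h => k1 (by linarith),
    lt_of_le_of_ne (abs_beamCoord_le _) fun h => k2 (by linarith), fun h => k3 (by linarith),
    fun h => k4 (by linarith), fun h => k5 (by linarith), fun h => k6 (by linarith)⟩

theorem tendsto_pair (y : E3) (i : Fin 3) :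
    Filter.Tendsto (fun z : E3 => (z i, z 2)) (nhds y) (nhds (y i, y 2)) :=
  (by fun_prop : Continuous fun z : E3 => (z i, z 2)).tendsto y

/-- Taking `S(y 0, s) - ε S(y 1, s)` as a new coordinate in place of `y 0` gives a map with Jacobian
`a' ≠ 0` at generic points. It sends the coincidence set into a plane, so that set is null. -/
theorem ae_foldSnd_ne {l : ℝ} (hl : 8 ≤ l) : ∀ᵐ y : E3, 0 < y 2 → y 2 < 1 →
    |foldSnd l (y 0) (y 2)| ≠ |foldSnd l (y 1) (y 2)| := by
  have key : ∀ ε : ℝ, ∀ᵐ y : E3, 0 < y 2 → y 2 < 1 →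
      foldSnd l (y 0) (y 2) - ε * foldSnd l (y 1) (y 2) ≠ 0 := by
    intro ε
    set H : E3 → E3 := fun y => !₂[foldSnd l (y 0) (y 2) - ε * foldSnd l (y 1) (y 2), y 1, y 2]
      with hH
    have hpl : ∀ᵐ z : E3, z 0 ≠ 0 := by
      simpa using ae_coord_ne (i := 0) (by decide) (b := 0) one_ne_zero 0
    have hN : volume {z : E3 | z 0 = 0} = 0 := by simpa [ae_iff] using hpl
    have hpre := measure_eq_zero_iff_ae_notMem.1 (volume_preimage_eq_zero_of_det_ne_zero H hN)
    filter_upwards [hpre, ae_generic (i := 0) (by decide), ae_generic (i := 1) (by decide)]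
      with y hy g0 g1 hs0 hs1 hzero
    obtain ⟨a, b, c, a', b', c', e0, -, hne, -⟩ :=
      exists_affine_fold hl g0.1 g0.2.1 hs0 hs1 g0.2.2
    obtain ⟨α, β, γ, α', β', γ', e1, -, -, -⟩ :=
      exists_affine_fold hl g1.1 g1.2.1 hs0 hs1 g1.2.2
    have hder := fderiv_det_eq_matrix_det (f := H) (x := y)
      !![a', -ε * α', b' - ε * β'; 0, 1, 0; 0, 0, 1] (fun i => by
        fin_cases i
        · refine hasFDerivAt_of_eventually_affine (k := c' - ε * γ') ?_
          filter_upwards [(tendsto_pair y 0).eventually e0, (tendsto_pair y 1).eventually e1]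
            with z z0 z1
          simp [hH, z0.2, z1.2]; ring
        · exact hasFDerivAt_of_eventually_affine (k := 0) (by simp [hH])
        · exact hasFDerivAt_of_eventually_affine (k := 0) (by simp [hH]))
    refine hy ⟨hder.1, ?_, by simpa [hH] using hzero⟩
    rw [hder.2, Matrix.det_fin_three]
    simpa using hne
  filter_upwards [key 1, key (-1)] with y h1 h2 hs0 hs1 h
  rcases abs_eq_abs.1 h with h' | h'
  · exact h1 hs0 hs1 (by rw [h']; ring)
  · exact h2 hs0 hs1 (by rw [h']; ring)

/-- Near a generic point the signed minimum is plus or minus the `S` of smaller modulus, the sign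
being that of the other `S`. The determinant then splits into the planar Jacobian for the smaller
one and `∂F/∂y` for the other, times that sign; both factors are at least one. -/
theorem interpMap_hasDerivBoundsOn {l : ℝ} (hl : 8 ≤ l) :
    HasDerivBoundsOn (interpMap l) {y | 0 < y 2 ∧ y 2 < 1} (240 * l) 1 1 := by
  filter_upwards [ae_foldSnd_ne hl, ae_generic (i := 0) (by decide),
    ae_generic (i := 1) (by decide)] with y hne g0 g1 hy
  obtain ⟨hs0, hs1⟩ := hy
  obtain ⟨a, b, c, a', b', c', e0, d0, -, s0⟩ :=
    exists_affine_fold hl g0.1 g0.2.1 hs0 hs1 g0.2.2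
  obtain ⟨α, β, γ, α', β', γ', e1, d1, -, s1⟩ :=
    exists_affine_fold hl g1.1 g1.2.1 hs0 hs1 g1.2.2
  have E0 := (tendsto_pair y 0).eventually e0
  have E1 := (tendsto_pair y 1).eventually e1
  have hcont : ContinuousAt (interpMap l) y := by
    refine (interpMap_lipschitzOnWith (by linarith)).continuousOn.continuousAt ?_
    have hc : Continuous fun z : E3 => z 2 := by fun_prop
    filter_upwards [hc.continuousAt.eventually (lt_mem_nhds hs0),
      hc.continuousAt.eventually (gt_mem_nhds hs1)] with z h1 h2 using ⟨h1.le, h2.le⟩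
  have hnorm : ‖fderiv ℝ (interpMap l) y‖ ≤ 240 * l := by
    have := norm_fderiv_le_of_lipschitzOn ℝ (x₀ := y) (by
      have hc : Continuous fun z : E3 => z 2 := by fun_prop
      filter_upwards [hc.continuousAt.eventually (lt_mem_nhds hs0),
        hc.continuousAt.eventually (gt_mem_nhds hs1)] with z h1 h2 using ⟨h1.le, h2.le⟩)
      (interpMap_lipschitzOnWith (l := l) (by linarith))
    push_cast at this
    rw [Real.coe_toNNReal _ (by linarith)] at this
    linarith
  suffices h : ∃ r0 r1 r2 k : ℝ, (∀ᶠ z in nhds y,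
      signedMin (foldSnd l (z 0) (z 2)) (foldSnd l (z 1) (z 2)) =
        r0 * z 0 + r1 * z 1 + r2 * z 2 + k) ∧
      1 ≤ (!![a, 0, b; 0, α, β; r0, r1, r2] : Matrix (Fin 3) (Fin 3) ℝ).det by
    obtain ⟨r0, r1, r2, k, hev, hdet⟩ := h
    have hder := fderiv_det_eq_matrix_det (f := interpMap l) (x := y)
      !![a, 0, b; 0, α, β; r0, r1, r2] (fun i => by
        fin_cases i
        · refine hasFDerivAt_of_eventually_affine (k := c) ?_
          filter_upwards [E0] with z z0
          simp [interpMap, z0.1]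
        · refine hasFDerivAt_of_eventually_affine (k := γ) ?_
          filter_upwards [E1] with z z1
          simp [interpMap, z1.1]
        · refine hasFDerivAt_of_eventually_affine (k := k) ?_
          filter_upwards [hev] with z hz
          simp [interpMap, hz])
    refine ⟨hder.1, hnorm, ?_⟩
    rw [hder.2, one_mul]; exact hdet
  have C0 : ContinuousAt (fun z : E3 => foldSnd l (z 0) (z 2)) y := by
    refine (ContinuousAt.congr (f := fun z : E3 => a' * z 0 + b' * z 2 + c') (by fun_prop) ?_)
    filter_upwards [E0] with z hz using hz.2.symm
  have C1 : ContinuousAt (fun z : E3 => foldSnd l (z 1) (z 2)) y := by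
    refine (ContinuousAt.congr (f := fun z : E3 => α' * z 1 + β' * z 2 + γ') (by fun_prop) ?_)
    filter_upwards [E1] with z hz using hz.2.symm
  have m1 : ∀ u w : ℝ, 1 ≤ u → 1 ≤ w → 1 ≤ u * w := fun u w hu hw => by nlinarith
  -- The four cases record which `S` has the smaller modulus and the sign of the larger one. The
  -- third row of the matrix comes from the smaller one.
  rcases (hne hs0 hs1).lt_or_gt with h | h
  · rcases s1 with ⟨hp, hα⟩ | ⟨hp, hα⟩
    · rw [abs_of_pos hp] at h
      refine ⟨a', 0, b', c', ?_, ?_⟩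
      · filter_upwards [E0, C0.abs.eventually_lt C1 h] with z h0 h1
        rw [signedMin_of_pos h1.le, h0.2]; ring
      · rw [Matrix.det_fin_three]
        have := m1 _ _ hα d0
        simp; linarith
    · rw [abs_of_neg hp] at h
      refine ⟨-a', 0, -b', -c', ?_, ?_⟩
      · filter_upwards [E0, C0.abs.eventually_lt C1.neg h] with z h0 h1
        rw [signedMin_of_neg h1.le, h0.2]; ring
      · rw [Matrix.det_fin_three]
        have := m1 (-α) _ (by linarith) d0
        simp; linarith
  · rcases s0 with ⟨hp, hα⟩ | ⟨hp, hα⟩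
    · rw [abs_of_pos hp] at h
      refine ⟨0, α', β', γ', ?_, ?_⟩
      · filter_upwards [E1, C1.abs.eventually_lt C0 h] with z h0 h1
        rw [signedMin_comm, signedMin_of_pos h1.le, h0.2]; ring
      · rw [Matrix.det_fin_three]
        have := m1 _ _ hα d1
        simp; linarith
    · rw [abs_of_neg hp] at h
      refine ⟨0, -α', -β', -γ', ?_, ?_⟩
      · filter_upwards [E1, C1.abs.eventually_lt C0.neg h] with z h0 h1
        rw [signedMin_comm, signedMin_of_neg h1.le, h0.2]; ring
      · rw [Matrix.det_fin_three]
        have := m1 (-a) _ (by linarith) d1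
        simp; linarith

/-! ### The map from the bipyramid to the ball -/

/-- The norm whose unit ball is the bipyramid over the square `[-1,1]²` with apexes `±e₃`. -/
noncomputable def bipyramidNorm (w : E3) : ℝ := max |w 0| |w 1| + |w 2|

theorem bipyramidNorm_nonneg (w : E3) : 0 ≤ bipyramidNorm w :=
  add_nonneg (le_max_of_le_left (abs_nonneg _)) (abs_nonneg _)

theorem abs_max_abs_sub_le (w z : E3) {D : ℝ} (h0 : |w 0 - z 0| ≤ D) (h1 : |w 1 - z 1| ≤ D) :
    |max |w 0| |w 1| - (max |z 0| |z 1|)| ≤ D :=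
  (abs_max_sub_max_le_max _ _ _ _).trans
    (max_le ((abs_abs_sub_abs_le _ _).trans h0) ((abs_abs_sub_abs_le _ _).trans h1))

theorem abs_max_sub_le_norm (w z : E3) :
    |max |w 0| |w 1| - (max |z 0| |z 1|)| ≤ ‖w - z‖ :=
  abs_max_abs_sub_le w z (abs_sub_apply_le_norm w z 0) (abs_sub_apply_le_norm w z 1)

theorem abs_bipyramidNorm_sub_le (w z : E3) :
    |bipyramidNorm w - bipyramidNorm z| ≤ 2 * ‖w - z‖ := by
  unfold bipyramidNorm
  have h1 := abs_max_sub_le_norm w z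
  have h2 := (abs_abs_sub_abs_le (w 2) (z 2)).trans (abs_sub_apply_le_norm w z 2)
  rw [add_sub_add_comm]
  exact (abs_add_le _ _).trans (by linarith)

theorem abs_apply_le_bipyramidNorm (w : E3) (i : Fin 3) : |w i| ≤ bipyramidNorm w := by
  unfold bipyramidNorm
  have h0 := le_max_left |w 0| |w 1|
  have h1 := le_max_right |w 0| |w 1|
  fin_cases i
  · exact h0.trans (le_add_of_nonneg_right (abs_nonneg _))
  · exact h1.trans (le_add_of_nonneg_right (abs_nonneg _))
  · exact le_add_of_nonneg_left (le_max_of_le_left (abs_nonneg _))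

theorem bipyramidNorm_lipschitzWith : LipschitzWith 2 bipyramidNorm :=
  LipschitzWith.of_dist_le_mul fun w z => by
    rw [Real.dist_eq, dist_eq_norm]; exact abs_bipyramidNorm_sub_le w z

/-- The latitude of a point of the bipyramid. -/
noncomputable def latitude (w : E3) : ℝ := Real.pi / 2 * (w 2 / bipyramidNorm w)

/-- The Euclidean length of the projection to the first two coordinates. -/
noncomputable def axisDist (w : E3) : ℝ := √(w 0 ^ 2 + w 1 ^ 2)

/-- The homogeneous map taking the bipyramids centred at the origin to the round balls, which
conjugates the Zorich map to a piecewise linear map up to an exponential factor. -/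
noncomputable def roundMap (w : E3) : E3 :=
  !₂[bipyramidNorm w * Real.cos (latitude w) * (w 0 / axisDist w),
    bipyramidNorm w * Real.cos (latitude w) * (w 1 / axisDist w),
    bipyramidNorm w * Real.sin (latitude w)]

theorem axisDist_nonneg (w : E3) : 0 ≤ axisDist w := Real.sqrt_nonneg _

theorem axisDist_sq (w : E3) : axisDist w ^ 2 = w 0 ^ 2 + w 1 ^ 2 := Real.sq_sqrt (by positivity)

theorem max_le_axisDist (w : E3) : max |w 0| |w 1| ≤ axisDist w := by
  refine max_le ?_ ?_ <;> refine Real.abs_le_sqrt ?_ <;>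
    nlinarith [sq_nonneg (w 0), sq_nonneg (w 1)]

theorem axisDist_le (w : E3) : axisDist w ≤ 2 * max |w 0| |w 1| := by
  have h0 := le_max_left |w 0| |w 1|
  have h1 := le_max_right |w 0| |w 1|
  have h2 := abs_nonneg (w 0)
  have h3 := abs_nonneg (w 1)
  unfold axisDist
  rw [Real.sqrt_le_left (by linarith), ← sq_abs (w 0), ← sq_abs (w 1)]
  nlinarith

theorem abs_sqrt_sub_le (a b c d : ℝ) :
    |√(a ^ 2 + b ^ 2) - √(c ^ 2 + d ^ 2)| ≤ √((a - c) ^ 2 + (b - d) ^ 2) := by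
  have h1 := Real.sq_sqrt (by positivity : 0 ≤ a ^ 2 + b ^ 2)
  have h2 := Real.sq_sqrt (by positivity : 0 ≤ c ^ 2 + d ^ 2)
  have h3 := Real.sqrt_nonneg (a ^ 2 + b ^ 2)
  have h4 := Real.sqrt_nonneg (c ^ 2 + d ^ 2)
  refine Real.abs_le_sqrt ?_
  have h5 : a * c + b * d ≤ √(a ^ 2 + b ^ 2) * √(c ^ 2 + d ^ 2) := by
    refine abs_le_of_sq_le_sq' ?_ (by positivity) |>.2
    rw [mul_pow, h1, h2]; nlinarith [sq_nonneg (a * d - b * c)]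
  nlinarith

theorem sq_add_sq_le_norm_sq (x : E3) : x 0 ^ 2 + x 1 ^ 2 + x 2 ^ 2 = ‖x‖ ^ 2 := by
  rw [EuclideanSpace.real_norm_sq_eq, Fin.sum_univ_three]

theorem abs_axisDist_sub_le (w z : E3) : |axisDist w - axisDist z| ≤ ‖w - z‖ := by
  refine (abs_sqrt_sub_le _ _ _ _).trans (Real.sqrt_le_iff.2 ⟨norm_nonneg _, ?_⟩)
  have := sq_add_sq_le_norm_sq (w - z)
  simp only [PiLp.sub_apply] at this
  nlinarith [sq_nonneg (w 2 - z 2)]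

theorem abs_latitude_le (w : E3) : |latitude w| ≤ Real.pi / 2 := by
  have hpi := Real.pi_pos
  rw [latitude, abs_mul, abs_of_pos (by positivity), abs_div,
    abs_of_nonneg (bipyramidNorm_nonneg w)]
  exact mul_le_of_le_one_right (by positivity)
    (div_le_one_of_le₀ (abs_apply_le_bipyramidNorm w 2) (bipyramidNorm_nonneg w))

/-- `N` times the colatitude is proportional to the square norm of the first two coordinates. -/
theorem bipyramidNorm_mul_colatitude (w : E3) :
    bipyramidNorm w * (Real.pi / 2 - |latitude w|) = Real.pi / 2 * max |w 0| |w 1| := by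
  have hpi := Real.pi_pos
  rcases (bipyramidNorm_nonneg w).eq_or_lt with h | h
  · have h0 : max |w 0| |w 1| = 0 := le_antisymm (by
      have := abs_nonneg (w 2)
      have h' := h
      unfold bipyramidNorm at h'
      linarith) (le_max_of_le_left (abs_nonneg _))
    rw [← h, h0]; simp
  · rw [latitude, abs_mul, abs_of_pos (by positivity), abs_div, abs_of_pos h]
    field_simp
    unfold bipyramidNorm; ring

theorem cos_latitude_nonneg (w : E3) : 0 ≤ Real.cos (latitude w) :=
  Real.cos_nonneg_of_mem_Icc (abs_le.1 (abs_latitude_le w))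

/-- The horizontal radius is `N` times the sine of the colatitude, and `N` times the colatitude is
`π / 2` times the square norm. The bounds `2 x / π ≤ sin x ≤ x` therefore keep the radius between
the square norm and `π / 2` times it; the lower half is `le_horizontal`. -/
theorem horizontal_le (w : E3) :
    bipyramidNorm w * Real.cos (latitude w) ≤ Real.pi / 2 * max |w 0| |w 1| := by
  rw [← bipyramidNorm_mul_colatitude, ← Real.cos_abs, ← Real.sin_pi_div_two_sub]
  exact mul_le_mul_of_nonneg_left (Real.sin_le (sub_nonneg.2 (abs_latitude_le w)))
    (bipyramidNorm_nonneg w)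

theorem le_horizontal (w : E3) :
    max |w 0| |w 1| ≤ bipyramidNorm w * Real.cos (latitude w) := by
  have hpi := Real.pi_pos
  have h := bipyramidNorm_mul_colatitude w
  have h2 := Real.mul_le_sin (sub_nonneg.2 (abs_latitude_le w))
    (by linarith [abs_nonneg (latitude w)])
  rw [Real.sin_pi_div_two_sub, Real.cos_abs] at h2
  have h3 := mul_le_mul_of_nonneg_left h2 (bipyramidNorm_nonneg w)
  have h4 : bipyramidNorm w * (2 / Real.pi * (Real.pi / 2 - |latitude w|)) = max |w 0| |w 1| := by
    rw [mul_left_comm, h]; field_simp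
  linarith

theorem abs_apply_le_axisDist (w : E3) : |w 0| ≤ axisDist w ∧ |w 1| ≤ axisDist w :=
  max_le_iff.1 (max_le_axisDist w)

theorem axisDist_roundMap (w : E3) :
    axisDist (roundMap w) = bipyramidNorm w * Real.cos (latitude w) := by
  have hF : 0 ≤ bipyramidNorm w * Real.cos (latitude w) :=
    mul_nonneg (bipyramidNorm_nonneg w) (cos_latitude_nonneg w)
  unfold axisDist
  rw [Real.sqrt_eq_iff_mul_self_eq (by positivity) hF]
  simp only [roundMap, PiLp.toLp_apply, Matrix.cons_val]
  rcases eq_or_ne (axisDist w) 0 with h | h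
  · have h1 := horizontal_le w
    have h2 := max_le_axisDist w
    have : bipyramidNorm w * Real.cos (latitude w) = 0 := by
      refine le_antisymm (h1.trans ?_) hF
      rw [h] at h2
      exact mul_nonpos_of_nonneg_of_nonpos (by positivity) h2
    rw [this]; ring
  · have := axisDist_sq w
    field_simp
    rw [this]

theorem norm_roundMap (w : E3) : ‖roundMap w‖ = bipyramidNorm w := by
  have h1 := sq_add_sq_le_norm_sq (roundMap w)
  have h2 := axisDist_sq (roundMap w)
  rw [axisDist_roundMap] at h2
  have h3 : roundMap w 2 = bipyramidNorm w * Real.sin (latitude w) := rfl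
  rw [← h2, h3] at h1
  have h4 := Real.sin_sq_add_cos_sq (latitude w)
  have h5 : ‖roundMap w‖ ^ 2 = bipyramidNorm w ^ 2 := by
    linear_combination -h1 + (bipyramidNorm w ^ 2) * h4
  exact (pow_left_inj₀ (norm_nonneg _) (bipyramidNorm_nonneg w) two_ne_zero).1 h5

/-- Multiplying points by bounded factors `t` is Lipschitz if `t` times their size is. -/
theorem abs_mul_sub_mul_le {t t' r r' x x' B : ℝ} (h0 : 0 ≤ t) (hB : t ≤ B) (hx : |x'| ≤ r') :
    |t * x - t' * x'| ≤ B * |x - x'| + B * |r - r'| + |t * r - t' * r'| := by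
  have hr : 0 ≤ r' := (abs_nonneg _).trans hx
  have e1 : |t * x - t' * x'| ≤ |t * (x - x')| + |(t - t') * x'| := by
    rw [show t * x - t' * x' = t * (x - x') + (t - t') * x' by ring]; exact abs_add_le _ _
  have e2 : |(t - t') * r'| ≤ |t * (r - r')| + |t * r - t' * r'| := by
    rw [show (t - t') * r' = -(t * (r - r')) + (t * r - t' * r') by ring]
    refine (abs_add_le _ _).trans ?_
    rw [abs_neg]
  have e3 : |(t - t') * x'| ≤ |(t - t') * r'| := by
    rw [abs_mul, abs_mul, abs_of_nonneg hr]; gcongr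
  rw [abs_mul t, abs_of_nonneg h0] at e1 e2
  have e4 : t * |x - x'| ≤ B * |x - x'| := by gcongr
  have e5 : t * |r - r'| ≤ B * |r - r'| := by gcongr
  linarith

/-- Homogeneity of degree one removes the singularity at `N = 0`: the variation of the angle `z / N`
enters only after multiplication by `N'`. -/
theorem abs_homogeneous_sub_le {f : ℝ → ℝ} (hf : ∀ x, |f x| ≤ 1)
    (hf' : ∀ x y, |f x - f y| ≤ |x - y|)
    {c N N' z z' : ℝ} (hc : 0 ≤ c) (hN : 0 ≤ N) (hN' : 0 ≤ N') (hz : |z| ≤ N) (hz' : |z'| ≤ N') :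
    |N * f (c * (z / N)) - N' * f (c * (z' / N'))| ≤
      (1 + c) * |N - N'| + c * |z - z'| := by
  have e1 : |N * f (c * (z / N)) - N' * f (c * (z' / N'))| ≤
      |N - N'| + N' * |c * (z / N) - c * (z' / N')| := by
    rw [show N * f (c * (z / N)) - N' * f (c * (z' / N')) =
      (N - N') * f (c * (z / N)) + N' * (f (c * (z / N)) - f (c * (z' / N'))) by ring]
    refine (abs_add_le _ _).trans ?_
    rw [abs_mul, abs_mul, abs_of_nonneg hN']
    exact add_le_add (mul_le_of_le_one_right (abs_nonneg _) (hf _))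
      (mul_le_mul_of_nonneg_left (hf' _ _) hN')
  have e2 : N' * |z / N - z' / N'| ≤ |N - N'| + |z - z'| := by
    have hcancel : ∀ {z N : ℝ}, |z| ≤ N → z / N * N = z := fun {z N} h => by
      rcases eq_or_ne N 0 with h0 | h0
      · rw [h0] at h ⊢
        rw [abs_nonpos_iff.1 h]; simp
      · field_simp
    rw [← abs_of_nonneg hN', ← abs_mul, abs_of_nonneg hN', mul_sub, mul_comm N' (z' / N'),
      hcancel hz', show N' * (z / N) - z' = -(z / N * (N - N')) + (z / N * N - z') by ring,
      hcancel hz]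
    refine (abs_add_le _ _).trans ?_
    rw [abs_neg, abs_mul]
    gcongr
    exact mul_le_of_le_one_left (abs_nonneg _)
      (by rw [abs_div, abs_of_nonneg hN]; exact div_le_one_of_le₀ hz hN)
  have e3 : N' * |c * (z / N) - c * (z' / N')| = c * (N' * |z / N - z' / N'|) := by
    rw [← mul_sub, abs_mul, abs_of_nonneg hc]; ring
  rw [e3] at e1
  have := mul_le_mul_of_nonneg_left e2 hc
  linarith

theorem abs_cos_sub_cos_le (x y : ℝ) : |Real.cos x - Real.cos y| ≤ |x - y| := by
  simpa [Real.dist_eq] using Real.lipschitzWith_cos.dist_le_mul x y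

theorem abs_sin_sub_sin_le (x y : ℝ) : |Real.sin x - Real.sin y| ≤ |x - y| := by
  simpa [Real.dist_eq] using Real.lipschitzWith_sin.dist_le_mul x y

/-- Height and horizontal radius are homogeneous expressions in sine and cosine. The horizontal
vector is that of `w` times a factor of at most `2`, whose product with the axis distance is
Lipschitz, so `abs_mul_sub_mul_le` applies. -/
theorem roundMap_lipschitzWith : LipschitzWith (3 * (20 : ℝ).toNNReal) roundMap := by
  rw [← lipschitzOnWith_univ]
  refine lipschitzOnWith_of_abs_sub_le (by norm_num) fun w _ z _ i => ?_
  have hpi := Real.pi_pos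
  have hpi4 := Real.pi_le_four
  have hn := norm_nonneg (w - z)
  have hN := abs_bipyramidNorm_sub_le w z
  have hz := abs_sub_apply_le_norm w z 2
  have hbound : (1 + Real.pi / 2) * |bipyramidNorm w - bipyramidNorm z| +
      Real.pi / 2 * |w 2 - z 2| ≤ 8 * ‖w - z‖ := by nlinarith
  have hF := (abs_homogeneous_sub_le Real.abs_cos_le_one abs_cos_sub_cos_le
    (by positivity : 0 ≤ Real.pi / 2) (bipyramidNorm_nonneg w) (bipyramidNorm_nonneg z)
    (abs_apply_le_bipyramidNorm w 2) (abs_apply_le_bipyramidNorm z 2)).trans hbound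
  have hG := (abs_homogeneous_sub_le Real.abs_sin_le_one abs_sin_sub_sin_le
    (by positivity : 0 ≤ Real.pi / 2) (bipyramidNorm_nonneg w) (bipyramidNorm_nonneg z)
    (abs_apply_le_bipyramidNorm w 2) (abs_apply_le_bipyramidNorm z 2)).trans hbound
  have hr := abs_axisDist_sub_le w z
  have hmul : ∀ w : E3, bipyramidNorm w * Real.cos (latitude w) / axisDist w * axisDist w =
      bipyramidNorm w * Real.cos (latitude w) := fun w => by
    rcases eq_or_ne (axisDist w) 0 with h | h
    · have h1 := horizontal_le w
      have h2 := max_le_axisDist w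
      rw [h] at h2 ⊢
      have h3 := mul_nonneg (bipyramidNorm_nonneg w) (cos_latitude_nonneg w)
      nlinarith
    · field_simp
  have hle : bipyramidNorm w * Real.cos (latitude w) / axisDist w ≤ 2 := by
    refine div_le_of_le_mul₀ (axisDist_nonneg w) (by norm_num) ((horizontal_le w).trans ?_)
    have := max_le_axisDist w
    have h0 : 0 ≤ max |w 0| |w 1| := le_max_of_le_left (abs_nonneg _)
    nlinarith
  have h0 : 0 ≤ bipyramidNorm w * Real.cos (latitude w) / axisDist w :=
    div_nonneg (mul_nonneg (bipyramidNorm_nonneg w) (cos_latitude_nonneg w)) (axisDist_nonneg w)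
  have hcomp : ∀ i : Fin 3, |z i| ≤ axisDist z →
      |bipyramidNorm w * Real.cos (latitude w) * (w i / axisDist w) -
        bipyramidNorm z * Real.cos (latitude z) * (z i / axisDist z)| ≤ 20 * ‖w - z‖ := by
    intro i hi
    have := abs_mul_sub_mul_le (t := bipyramidNorm w * Real.cos (latitude w) / axisDist w)
      (t' := bipyramidNorm z * Real.cos (latitude z) / axisDist z) (r := axisDist w)
      (r' := axisDist z) (x := w i) (x' := z i) h0 hle hi
    rw [hmul, hmul] at this
    rw [mul_div_left_comm, mul_comm (w i), mul_div_left_comm _ (z i), mul_comm (z i)]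
    refine this.trans ?_
    have h3 := abs_sub_apply_le_norm w z i
    unfold latitude
    linarith
  fin_cases i
  · exact hcomp 0 (abs_apply_le_axisDist z).1
  · exact hcomp 1 (abs_apply_le_axisDist z).2
  · refine le_trans ?_ (by linarith : 8 * ‖w - z‖ ≤ 20 * ‖w - z‖)
    exact hG

/-! ### The inverse Lipschitz estimate for the rounding map. -/

/-- By the law of cosines the squared distance is `(N - N')² + 2 N N' (1 - cos (θ - θ'))`, and `1 -
cos x ≥ 2 x² / π²` for `|x| ≤ π`. -/
theorem abs_sub_le_of_polar {N N' θ θ' D : ℝ} (hN : 0 ≤ N) (hN' : 0 ≤ N')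
    (hθ : |θ - θ'| ≤ Real.pi) (hD : 0 ≤ D)
    (h : (N * Real.cos θ - N' * Real.cos θ') ^ 2 +
      (N * Real.sin θ - N' * Real.sin θ') ^ 2 ≤ D ^ 2) :
    |N - N'| ≤ D ∧ min N N' * |θ - θ'| ≤ Real.pi / 2 * D := by
  have hpi := Real.pi_pos
  have hmn := mul_nonneg hN hN'
  have e : (N * Real.cos θ - N' * Real.cos θ') ^ 2 + (N * Real.sin θ - N' * Real.sin θ') ^ 2 =
      (N - N') ^ 2 + 2 * (N * N') * (1 - Real.cos (θ - θ')) := by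
    rw [Real.cos_sub]
    linear_combination N ^ 2 * Real.sin_sq_add_cos_sq θ + N' ^ 2 * Real.sin_sq_add_cos_sq θ'
  rw [e] at h
  have hc := Real.cos_le_one_sub_mul_cos_sq hθ
  have hc1 := Real.cos_le_one (θ - θ')
  have hc2 : 0 ≤ (N * N') * (1 - Real.cos (θ - θ')) := mul_nonneg hmn (by linarith)
  constructor
  · exact abs_le_of_sq_le_sq (by linarith) hD
  · have hmin : min N N' ^ 2 ≤ N * N' := by
      rw [sq]
      exact mul_le_mul (min_le_left _ _) (min_le_right _ _) (le_min hN hN') hN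
    have h1 : (N * N') * (2 / Real.pi ^ 2 * (θ - θ') ^ 2) ≤ (N * N') * (1 - Real.cos (θ - θ')) :=
      mul_le_mul_of_nonneg_left (by linarith) hmn
    have h2 : min N N' ^ 2 * (2 / Real.pi ^ 2 * (θ - θ') ^ 2) ≤
        (N * N') * (2 / Real.pi ^ 2 * (θ - θ') ^ 2) := by gcongr
    have h3 : 2 * (min N N' ^ 2 * (2 / Real.pi ^ 2 * (θ - θ') ^ 2)) ≤ D ^ 2 := by
      nlinarith [sq_nonneg (N - N')]
    refine abs_le_of_sq_le_sq' ?_ (by positivity) |>.2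
    rw [mul_pow, sq_abs]
    calc min N N' ^ 2 * (θ - θ') ^ 2 = Real.pi ^ 2 / 4 *
          (2 * (min N N' ^ 2 * (2 / Real.pi ^ 2 * (θ - θ') ^ 2))) := by field_simp; ring
      _ ≤ Real.pi ^ 2 / 4 * D ^ 2 := by gcongr
      _ = (Real.pi / 2 * D) ^ 2 := by ring

theorem apply_two_eq_mul_latitude (w : E3) :
    w 2 = bipyramidNorm w * (2 / Real.pi * latitude w) := by
  have hpi := Real.pi_pos
  rcases eq_or_ne (bipyramidNorm w) 0 with h | h
  · have := abs_apply_le_bipyramidNorm w 2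
    rw [h] at this ⊢
    rw [abs_nonpos_iff.1 this, zero_mul]
  · rw [latitude]; field_simp

theorem abs_sub_le_roundMap (w z : E3) :
    |bipyramidNorm w - bipyramidNorm z| ≤ ‖roundMap w - roundMap z‖ ∧
      |w 2 - z 2| ≤ 2 * ‖roundMap w - roundMap z‖ := by
  have hpi := Real.pi_pos
  set D := ‖roundMap w - roundMap z‖ with hD
  have hD0 : 0 ≤ D := norm_nonneg _
  have hθ : |latitude w - latitude z| ≤ Real.pi := by
    refine (abs_sub _ _).trans ?_
    linarith [abs_latitude_le w, abs_latitude_le z]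
  have hpol : (bipyramidNorm w * Real.cos (latitude w) -
      bipyramidNorm z * Real.cos (latitude z)) ^ 2
      + (bipyramidNorm w * Real.sin (latitude w) - bipyramidNorm z * Real.sin (latitude z)) ^ 2
      ≤ D ^ 2 := by
    rw [← axisDist_roundMap, ← axisDist_roundMap, hD, ← sq_add_sq_le_norm_sq]
    have h1 := sq_le_sq' (abs_le.1 (abs_sqrt_sub_le (roundMap w 0) (roundMap w 1) (roundMap z 0)
      (roundMap z 1))).1 (abs_le.1 (abs_sqrt_sub_le (roundMap w 0) (roundMap w 1) (roundMap z 0)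
      (roundMap z 1))).2
    rw [Real.sq_sqrt (by positivity)] at h1
    simp only [PiLp.sub_apply]
    exact add_le_add h1 le_rfl
  obtain ⟨h1, h2⟩ := abs_sub_le_of_polar (bipyramidNorm_nonneg w) (bipyramidNorm_nonneg z) hθ hD0
    hpol
  refine ⟨h1, ?_⟩
  have key : ∀ N N' θ θ' : ℝ, 0 ≤ N' → N' ≤ N → |θ| ≤ Real.pi / 2 → |N - N'| ≤ D →
      min N N' * |θ - θ'| ≤ Real.pi / 2 * D →
      |N * (2 / Real.pi * θ) - N' * (2 / Real.pi * θ')| ≤ 2 * D := by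
    intro N N' θ θ' h0 hle hθ hN hmin
    rw [min_eq_right hle] at hmin
    have e : N * (2 / Real.pi * θ) - N' * (2 / Real.pi * θ') =
      (2 / Real.pi) * (θ * (N - N')) + 2 / Real.pi * (N' * (θ - θ')) := by ring
    rw [e]
    refine (abs_add_le _ _).trans ?_
    rw [abs_mul, abs_mul, abs_mul (2 / Real.pi), abs_mul N', abs_of_nonneg h0,
      abs_of_pos (by positivity : 0 < 2 / Real.pi)]
    have e1 : |θ| * |N - N'| ≤ Real.pi / 2 * D := by gcongr
    calc 2 / Real.pi * (|θ| * |N - N'|) + 2 / Real.pi * (N' * |θ - θ'|) ≤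
        2 / Real.pi * (Real.pi / 2 * D) + 2 / Real.pi * (Real.pi / 2 * D) := by gcongr
      _ = 2 * D := by field_simp; ring
  rw [apply_two_eq_mul_latitude w, apply_two_eq_mul_latitude z]
  rcases le_total (bipyramidNorm z) (bipyramidNorm w) with h | h
  · exact key _ _ _ _ (bipyramidNorm_nonneg z) h (abs_latitude_le w) h1 h2
  · rw [abs_sub_comm]
    rw [abs_sub_comm] at h1
    rw [min_comm, abs_sub_comm (latitude w)] at h2
    exact key _ _ _ _ (bipyramidNorm_nonneg w) h (abs_latitude_le z) h1 h2

/-- Polar coordinates control `N` and the height, hence the square norm `m = N - |w 2|`. The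
horizontal part is recovered by two radial rescalings, each handled by `abs_mul_sub_mul_le`; the
constant is `23 + 23 + 2`. -/
theorem norm_sub_le_roundMap (w z : E3) : ‖w - z‖ ≤ 48 * ‖roundMap w - roundMap z‖ := by
  obtain ⟨hN, h2⟩ := abs_sub_le_roundMap w z
  set D := ‖roundMap w - roundMap z‖ with hD
  have hD0 : 0 ≤ D := norm_nonneg _
  set m : E3 → ℝ := fun w => max |w 0| |w 1| with hm
  set F : E3 → ℝ := fun w => bipyramidNorm w * Real.cos (latitude w) with hF
  have m0 : ∀ w, 0 ≤ m w := fun w => le_max_of_le_left (abs_nonneg _)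
  have hmF : ∀ w, m w ≤ F w := le_horizontal
  have F0 : ∀ w, 0 ≤ F w := fun w => (m0 w).trans (hmF w)
  have hmr : ∀ w, m w ≤ axisDist w := max_le_axisDist
  have hrm : ∀ w, axisDist w ≤ 2 * m w := axisDist_le
  have hFF : |F w - F z| ≤ D := by
    have := abs_axisDist_sub_le (roundMap w) (roundMap z)
    rwa [axisDist_roundMap, axisDist_roundMap] at this
  have hmm : |m w - m z| ≤ 3 * D := by
    have e : ∀ w, m w = bipyramidNorm w - |w 2| := fun w => by rw [hm, bipyramidNorm]; ring
    rw [e, e, sub_sub_sub_comm]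
    refine (abs_sub _ _).trans ?_
    have := abs_abs_sub_abs_le (w 2) (z 2)
    linarith
  -- Intermediate horizontal vector with the direction of `w` and Euclidean length `m w`: it is the
  -- horizontal part of `roundMap w` times `m / F ≤ 1`, and `w` is recovered from it by the factor
  -- `axisDist / m ≤ 2`.
  set p : Fin 3 → E3 → ℝ := fun i w => m w / axisDist w * w i with hp
  have hm_ne : ∀ w, axisDist w ≠ 0 → m w ≠ 0 := fun w h h' => by
    have := hrm w
    rw [h', mul_zero] at this
    exact h (le_antisymm this (axisDist_nonneg w))
  have hpX : ∀ w i, (i = 0 ∨ i = 1) → p i w = m w / F w * roundMap w i := fun w i hi => by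
    have hX : roundMap w i = F w * (w i / axisDist w) := by
      rcases hi with rfl | rfl <;> rfl
    rw [hX]
    rcases eq_or_ne (F w) 0 with h | h
    · have : m w = 0 := le_antisymm (h ▸ hmF w) (m0 w)
      simp [hp, this]
    · simp only [hp]; field_simp
  have hXF : ∀ w i, (i = 0 ∨ i = 1) → |roundMap w i| ≤ F w := fun w i hi => by
    have := abs_apply_le_axisDist (roundMap w)
    rw [axisDist_roundMap] at this
    rcases hi with rfl | rfl
    · exact this.1
    · exact this.2
  have hpp : ∀ i, (i = 0 ∨ i = 1) → |p i w - p i z| ≤ 5 * D := fun i hi => by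
    have h := abs_mul_sub_mul_le (t := m w / F w) (t' := m z / F z) (B := 1) (r := F w) (r' := F z)
      (x := roundMap w i) (x' := roundMap z i) (div_nonneg (m0 w) (F0 w))
      (div_le_one_of_le₀ (hmF w) (F0 w)) (hXF z i hi)
    have hc : ∀ w, m w / F w * F w = m w := fun w => by
      rcases eq_or_ne (F w) 0 with h | h
      · rw [h, mul_zero]; exact (le_antisymm (h ▸ hmF w) (m0 w)).symm
      · field_simp
    rw [hc, hc, ← hpX w i hi, ← hpX z i hi] at h
    have := abs_sub_apply_le_norm (roundMap w) (roundMap z) i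
    linarith
  have hw : ∀ w i, (i = 0 ∨ i = 1) → w i = axisDist w / m w * p i w := fun w i hi => by
    rcases eq_or_ne (axisDist w) 0 with h | h
    · have hle : |w i| ≤ axisDist w := by
        rcases hi with rfl | rfl
        · exact (abs_apply_le_axisDist w).1
        · exact (abs_apply_le_axisDist w).2
      rw [h] at hle
      rw [abs_nonpos_iff.1 hle, h]; simp
    · have := hm_ne w h
      simp only [hp]; field_simp
  set M : E3 → ℝ := fun w => max |p 0 w| |p 1 w| with hM
  have hMM : |M w - M z| ≤ 5 * D :=
    (abs_max_sub_max_le_max _ _ _ _).trans (max_le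
      ((abs_abs_sub_abs_le _ _).trans (hpp 0 (Or.inl rfl)))
      ((abs_abs_sub_abs_le _ _).trans (hpp 1 (Or.inr rfl))))
  have hMeq : ∀ w, axisDist w / m w * M w = m w := fun w => by
    have e : M w = m w / axisDist w * m w := by
      simp only [hM, hp, abs_mul, abs_of_nonneg (div_nonneg (m0 w) (axisDist_nonneg w))]
      rw [← mul_max_of_nonneg _ _ (div_nonneg (m0 w) (axisDist_nonneg w))]
    rw [e]
    rcases eq_or_ne (axisDist w) 0 with h | h
    · have : m w = 0 := le_antisymm (h ▸ hmr w) (m0 w)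
      simp [this]
    · have := hm_ne w h
      field_simp
  have hfin : ∀ i, (i = 0 ∨ i = 1) → |w i - z i| ≤ 23 * D := fun i hi => by
    have h := abs_mul_sub_mul_le (t := axisDist w / m w) (t' := axisDist z / m z) (B := 2)
      (r := M w) (r' := M z) (x := p i w) (x' := p i z) (div_nonneg (axisDist_nonneg w) (m0 w))
      (div_le_of_le_mul₀ (m0 w) (by norm_num) (hrm w)) (by
        rcases hi with rfl | rfl
        · exact le_max_left _ _
        · exact le_max_right _ _)
    rw [hMeq, hMeq, ← hw w i hi, ← hw z i hi] at h
    have := hpp i hi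
    linarith
  have := norm_le_sum_abs (w - z)
  simp only [PiLp.sub_apply] at this
  linarith [hfin 0 (Or.inl rfl), hfin 1 (Or.inr rfl)]

/-! ### The Jacobian of the rounding map. -/

/-- Euler's identity for `max |w 0| |w 1|`, which is homogeneous of degree one in the horizontal
variables. It replaces a case distinction on which coordinate realises the maximum. -/
theorem fderiv_bipyramidNorm_horizontal {w : E3} {ν : E3 →L[ℝ] ℝ}
    (h : HasFDerivAt bipyramidNorm ν w) :
    ν (EuclideanSpace.single 0 1) * w 0 + ν (EuclideanSpace.single 1 1) * w 1 =
      max |w 0| |w 1| := by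
  set p : E3 := !₂[w 0, w 1, 0] with hp
  have h1 : HasDerivAt (fun t : ℝ => bipyramidNorm (w + t • p)) (ν p) 0 := h.hasLineDerivAt p
  have h2 : HasDerivAt (fun t : ℝ => (1 + t) * max |w 0| |w 1| + |w 2|) (max |w 0| |w 1|) 0 := by
    simpa using (((hasDerivAt_id (0 : ℝ)).const_add 1).mul_const (max |w 0| |w 1|)).add_const |w 2|
  have h3 : (fun t : ℝ => bipyramidNorm (w + t • p)) =ᶠ[nhds 0]
      fun t : ℝ => (1 + t) * max |w 0| |w 1| + |w 2| := by
    filter_upwards [lt_mem_nhds (by norm_num : (-1 : ℝ) < 0)] with t ht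
    have ht' : 0 ≤ 1 + t := by linarith
    simp only [bipyramidNorm, hp, PiLp.add_apply, PiLp.smul_apply, smul_eq_mul,
      Matrix.cons_val, mul_zero, add_zero]
    rw [mul_max_of_nonneg _ _ ht', ← abs_of_nonneg ht', ← abs_mul, ← abs_mul]
    congr 3 <;> ring
  have h4 := h1.unique (h2.congr_of_eventuallyEq h3)
  have h5 : p = w 0 • EuclideanSpace.single 0 1 + w 1 • EuclideanSpace.single 1 1 := by
    ext i; fin_cases i <;> simp [hp]
  rw [h5, map_add, map_smul, map_smul, smul_eq_mul, smul_eq_mul] at h4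
  linarith

theorem fderiv_bipyramidNorm_vertical {w : E3} {ν : E3 →L[ℝ] ℝ} {ε : ℝ}
    (h : HasFDerivAt bipyramidNorm ν w) (hw : 0 < ε * w 2) (hε : ε = 1 ∨ ε = -1) :
    ν (EuclideanSpace.single 2 1) = ε := by
  have h1 : HasDerivAt (fun t : ℝ => bipyramidNorm (w + t • EuclideanSpace.single 2 1))
      (ν (EuclideanSpace.single 2 1)) 0 := h.hasLineDerivAt _
  have h2 : HasDerivAt (fun t : ℝ => max |w 0| |w 1| + ε * (w 2 + t)) ε 0 := by
    simpa using (((hasDerivAt_id (0 : ℝ)).const_add (w 2)).const_mul ε).const_add (max |w 0| |w 1|)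
  have h3 : (fun t : ℝ => bipyramidNorm (w + t • EuclideanSpace.single 2 1)) =ᶠ[nhds 0]
      fun t : ℝ => max |w 0| |w 1| + ε * (w 2 + t) := by
    have hc : ContinuousAt (fun t : ℝ => ε * (w 2 + t)) 0 := by fun_prop
    filter_upwards [hc.eventually (lt_mem_nhds (by simpa using hw))] with t ht
    have : |w 2 + t| = ε * (w 2 + t) := by
      rcases hε with rfl | rfl
      · rw [one_mul] at ht ⊢; exact abs_of_pos ht
      · rw [neg_one_mul] at ht ⊢; exact abs_of_neg (by linarith)
    simp [bipyramidNorm, this]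
  exact h1.unique (h2.congr_of_eventuallyEq h3)

theorem fderiv_det_eq_matrix_det' {f : E3 → E3} {x : E3} {R : Fin 3 → E3 →L[ℝ] ℝ}
    (h : ∀ i, HasFDerivAt (fun x => f x i) (R i) x) :
    DifferentiableAt ℝ f x ∧
      (fderiv ℝ f x).det = (Matrix.of fun i j => R i (EuclideanSpace.single j 1)).det := by
  refine fderiv_det_eq_matrix_det _ fun i => (h i).congr_fderiv ?_
  ext v
  have : v = v 0 • EuclideanSpace.single 0 1 + v 1 • EuclideanSpace.single 1 1
      + v 2 • EuclideanSpace.single 2 1 := by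
    ext i; fin_cases i <;> simp
  conv_lhs => rw [this]
  simp [mul_comm]

theorem hasFDerivAt_euclidean_apply (w : E3) (i : Fin 3) :
    HasFDerivAt (fun x : E3 => x i) (EuclideanSpace.proj i : E3 →L[ℝ] ℝ) w :=
  (EuclideanSpace.proj i : E3 →L[ℝ] ℝ).hasFDerivAt

/-- In spherical coordinates the volume form is a product of the differentials of norm, latitude and
longitude. The first two contribute `ν ∧ ζ = ν ∧ e 2`, so the vertical derivative of `N` drops out,
and the longitude form leaves only the horizontal radial derivative, known by Euler's identity. -/
theorem det_fderiv_roundMap {w : E3} {ν : E3 →L[ℝ] ℝ} (h : HasFDerivAt bipyramidNorm ν w)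
    (h0 : w 0 ≠ 0) :
    DifferentiableAt ℝ roundMap w ∧ (fderiv ℝ roundMap w).det =
      Real.pi / 2 * (bipyramidNorm w * Real.cos (latitude w)) * (axisDist w)⁻¹ ^ 2 *
        max |w 0| |w 1| := by
  have hN : bipyramidNorm w ≠ 0 := fun h' => by
    have := abs_apply_le_bipyramidNorm w 0
    rw [h'] at this
    exact h0 (abs_nonpos_iff.1 this)
  have hq : w 0 ^ 2 + w 1 ^ 2 ≠ 0 := by positivity
  have hr : axisDist w ≠ 0 := fun h' => by
    have := axisDist_sq w
    rw [h'] at this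
    exact hq (by linarith)
  have dr : HasFDerivAt axisDist ((axisDist w)⁻¹ • (w 0 • (EuclideanSpace.proj 0 : E3 →L[ℝ] ℝ)
      + w 1 • (EuclideanSpace.proj 1 : E3 →L[ℝ] ℝ))) w := by
    have := (((hasFDerivAt_euclidean_apply w 0).pow 2).add
      ((hasFDerivAt_euclidean_apply w 1).pow 2)).sqrt hq
    refine this.congr_fderiv ?_
    have hr' : √(w 0 ^ 2 + w 1 ^ 2) = axisDist w := rfl
    ext v
    simp [hr']
    field_simp
  have hρ : (axisDist w)⁻¹ ^ 2 * (w 0 ^ 2 + w 1 ^ 2) = 1 := by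
    rw [← axisDist_sq]; field_simp
  have dri : HasFDerivAt (fun x => (axisDist x)⁻¹) _ w := (hasDerivAt_inv hr).comp_hasFDerivAt w dr
  have dNi : HasFDerivAt (fun x => (bipyramidNorm x)⁻¹) _ w :=
    (hasDerivAt_inv hN).comp_hasFDerivAt w h
  have dθ : HasFDerivAt latitude _ w :=
    (((hasFDerivAt_euclidean_apply w 2).mul dNi).const_mul (Real.pi / 2))
  set N := bipyramidNorm w with hNdef
  set c := Real.cos (latitude w) with hc
  set s := Real.sin (latitude w) with hs
  set ρ := (axisDist w)⁻¹ with hρdef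
  set k := Real.pi / 2 with hk
  set e : Fin 3 → E3 →L[ℝ] ℝ := fun i => EuclideanSpace.proj i with he
  -- This is `N` times the differential of `w 2 / N`, so `k • ζ` is `N` times that of the latitude.
  set ζ : E3 →L[ℝ] ℝ := e 2 - (w 2 * N⁻¹) • ν with hζ
  set a := w 0 * ρ with ha
  set b := w 1 * ρ with hb
  have hab : a ^ 2 + b ^ 2 = 1 := by rw [ha, hb]; linear_combination hρ
  have hcs : c ^ 2 + s ^ 2 = 1 := Real.cos_sq_add_sin_sq _
  have dF : HasFDerivAt (fun x => bipyramidNorm x * Real.cos (latitude x))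
      (c • ν - (s * k) • ζ) w := by
    refine (h.mul dθ.cos).congr_fderiv ?_
    ext v
    simp [hζ, he, ← hNdef, ← hc, ← hs]
    field_simp
    ring
  have dG : HasFDerivAt (fun x => bipyramidNorm x * Real.sin (latitude x))
      (s • ν + (c * k) • ζ) w := by
    refine (h.mul dθ.sin).congr_fderiv ?_
    ext v
    simp [hζ, he, ← hNdef, ← hc, ← hs]
    field_simp
    ring
  have da : HasFDerivAt (fun x => x 0 * (axisDist x)⁻¹) ((ρ * b) • (b • e 0 - a • e 1)) w := by
    refine ((hasFDerivAt_euclidean_apply w 0).mul dri).congr_fderiv ?_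
    ext v
    simp [he, ← hρdef, ← inv_pow (axisDist w)]
    rw [ha, hb]
    linear_combination -(ρ * v 0) * hρ
  have db : HasFDerivAt (fun x => x 1 * (axisDist x)⁻¹) ((-(ρ * a)) • (b • e 0 - a • e 1)) w := by
    refine ((hasFDerivAt_euclidean_apply w 1).mul dri).congr_fderiv ?_
    ext v
    simp [he, ← hρdef, ← inv_pow (axisDist w)]
    rw [ha, hb]
    linear_combination -(ρ * v 1) * hρ
  obtain ⟨e1, e2⟩ := fderiv_det_eq_matrix_det' (f := roundMap) (x := w)
    (R := ![(N * c) • ((ρ * b) • (b • e 0 - a • e 1)) + a • (c • ν - (s * k) • ζ),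
      (N * c) • ((-(ρ * a)) • (b • e 0 - a • e 1)) + b • (c • ν - (s * k) • ζ),
      s • ν + (c * k) • ζ]) (fun i => by
      fin_cases i
      · exact dF.mul da
      · exact dF.mul db
      · exact dG)
  refine ⟨e1, ?_⟩
  rw [e2, Matrix.det_fin_three, ← fderiv_bipyramidNorm_horizontal h]
  simp only [Matrix.of_apply, Matrix.cons_val, add_apply, sub_apply, smul_apply, smul_eq_mul, hζ, he,
    EuclideanSpace.coe_proj, PiLp.single_apply, Fin.isValue, Fin.reduceEq, if_true, if_false]
  generalize ν (EuclideanSpace.single 0 1) = n0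
  generalize ν (EuclideanSpace.single 1 1) = n1
  generalize ν (EuclideanSpace.single 2 1) = n2
  have e3 : k * (N * c) * ρ ^ 2 * (n0 * w 0 + n1 * w 1) = k * (N * c) * ρ * (n0 * a + n1 * b) := by
    rw [ha, hb]; ring
  rw [e3]
  clear_value a b c s k N
  linear_combination (k * (N * c) * ρ * (n0 * a + n1 * b)) * ((c ^ 2 + s ^ 2) * hab + hcs)

theorem ae_det_fderiv_roundMap_pos :
    ∀ᵐ w : E3, DifferentiableAt ℝ roundMap w ∧ 0 < (fderiv ℝ roundMap w).det := by
  have h0 : ∀ᵐ w : E3, w 0 ≠ 0 := by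
    simpa using ae_coord_ne (i := 0) (by decide) (b := 0) one_ne_zero 0
  filter_upwards [bipyramidNorm_lipschitzWith.ae_differentiableAt (μ := (volume : Measure E3)), h0]
    with w hd hw
  obtain ⟨h1, h2⟩ := det_fderiv_roundMap hd.hasFDerivAt hw
  refine ⟨h1, ?_⟩
  rw [h2]
  have hm : 0 < max |w 0| |w 1| := lt_max_of_lt_left (abs_pos.2 hw)
  have hr : 0 < axisDist w := hm.trans_le (max_le_axisDist w)
  have hF := hm.trans_le (le_horizontal w)
  have := Real.pi_pos
  positivity

/-! ### The Zorich map in bipyramid coordinates -/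

theorem signedMin_of_nonneg {a b : ℝ} (ha : 0 ≤ a) (hb : 0 ≤ b) : signedMin a b = min a b := by
  rcases le_total a b with h | h
  · rw [min_eq_left h, signedMin_of_pos (by rwa [abs_of_nonneg ha])]
  · rw [min_eq_right h, signedMin_comm, signedMin_of_pos (by rwa [abs_of_nonneg hb])]

/-- The piecewise linear analogue of the Zorich map, onto the complement of the origin foliated by
bipyramids. -/
noncomputable def boxMap (y : E3) : E3 :=
  !₂[Real.exp (y 2) * beamCoord (y 0), Real.exp (y 2) * beamCoord (y 1),
    Real.exp (y 2) * signedMin (beamCoord (y 0 + 1)) (beamCoord (y 1 + 1))]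

theorem signedMin_beamCoord (s t : ℝ) : signedMin (beamCoord (s + 1)) (beamCoord (t + 1)) =
    (-1) ^ (beamIndex s + beamIndex t) * (1 - max |beamCoord s| |beamCoord t|) := by
  rw [beamCoord_add_one, beamCoord_add_one, signedMin_sign_mul (abs_neg_one_zpow_cases _)
    (abs_neg_one_zpow_cases _), signedMin_of_nonneg (sub_nonneg.2 (abs_beamCoord_le _))
    (sub_nonneg.2 (abs_beamCoord_le _)), min_sub_sub_left, zpow_add₀ (by norm_num)]

theorem max_abs_beamCoord_le (s t : ℝ) : max |beamCoord s| |beamCoord t| ≤ 1 :=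
  max_le (abs_beamCoord_le s) (abs_beamCoord_le t)

theorem bipyramidNorm_boxMap (y : E3) : bipyramidNorm (boxMap y) = Real.exp (y 2) := by
  have he := (Real.exp_pos (y 2)).le
  have hm := max_abs_beamCoord_le (y 0) (y 1)
  simp only [bipyramidNorm, boxMap, PiLp.toLp_apply, Matrix.cons_val]
  rw [abs_mul, abs_mul, abs_mul, abs_of_nonneg he, ← mul_max_of_nonneg _ _ he, signedMin_beamCoord,
    abs_mul, abs_neg_one_zpow, abs_of_nonneg (a := 1 - max _ _) (by linarith)]
  ring

/-- With `M` the maximum of the folded coordinates in modulus, `boxMap y` has latitude `±(π / 2) (1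
- M)`, signed by the parity of the beam, and the longitude of the folded point; these are the
spherical coordinates of `h` up to the reflection. -/
theorem roundMap_boxMap (y : E3) : roundMap (boxMap y) = zorich y := by
  have he := Real.exp_pos (y 2)
  obtain ⟨z0, z1, z2⟩ := zorich_apply y
  have hlat : latitude (boxMap y) = (-1) ^ (beamIndex (y 0) + beamIndex (y 1)) *
      (Real.pi / 2 - Real.pi * max |beamCoord (y 0)| |beamCoord (y 1)| / 2) := by
    rw [latitude, bipyramidNorm_boxMap]
    simp only [boxMap, PiLp.toLp_apply, Matrix.cons_val]
    rw [mul_div_cancel_left₀ _ he.ne', signedMin_beamCoord]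
    ring
  have hr : axisDist (boxMap y) =
      Real.exp (y 2) * √(beamCoord (y 0) ^ 2 + beamCoord (y 1) ^ 2) := by
    simp only [axisDist, boxMap, PiLp.toLp_apply, Matrix.cons_val]
    rw [mul_pow, mul_pow, ← mul_add, Real.sqrt_mul (by positivity), Real.sqrt_sq he.le]
  have hcos : Real.cos (latitude (boxMap y)) =
      Real.sin (Real.pi * max |beamCoord (y 0)| |beamCoord (y 1)| / 2) := by
    rw [hlat]
    rcases abs_neg_one_zpow_cases (beamIndex (y 0) + beamIndex (y 1)) with h | h <;> rw [h]
    · rw [one_mul, Real.cos_pi_div_two_sub]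
    · rw [neg_one_mul, Real.cos_neg, Real.cos_pi_div_two_sub]
  have hsin : Real.sin (latitude (boxMap y)) = (-1) ^ (beamIndex (y 0) + beamIndex (y 1)) *
      Real.cos (Real.pi * max |beamCoord (y 0)| |beamCoord (y 1)| / 2) := by
    rw [hlat]
    rcases abs_neg_one_zpow_cases (beamIndex (y 0) + beamIndex (y 1)) with h | h <;> rw [h]
    · rw [one_mul, one_mul, Real.sin_pi_div_two_sub]
    · rw [neg_one_mul, neg_one_mul, Real.sin_neg, Real.sin_pi_div_two_sub]
  ext i
  fin_cases i
  · refine Eq.trans ?_ z0.symm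
    have hb : boxMap y 0 = Real.exp (y 2) * beamCoord (y 0) := rfl
    have hR : roundMap (boxMap y) 0 = bipyramidNorm (boxMap y) * Real.cos (latitude (boxMap y)) *
        (boxMap y 0 / axisDist (boxMap y)) := rfl
    refine hR.trans ?_
    rw [hb, hcos, hr, bipyramidNorm_boxMap, mul_div_mul_left _ _ he.ne']
    simp only [hemisphereMap, PiLp.toLp_apply, Matrix.cons_val]
    ring
  · refine Eq.trans ?_ z1.symm
    have hb : boxMap y 1 = Real.exp (y 2) * beamCoord (y 1) := rfl
    have hR : roundMap (boxMap y) 1 = bipyramidNorm (boxMap y) * Real.cos (latitude (boxMap y)) *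
        (boxMap y 1 / axisDist (boxMap y)) := rfl
    refine hR.trans ?_
    rw [hb, hcos, hr, bipyramidNorm_boxMap, mul_div_mul_left _ _ he.ne']
    simp only [hemisphereMap, PiLp.toLp_apply, Matrix.cons_val]
    ring
  · refine Eq.trans ?_ z2.symm
    simp [roundMap, hemisphereMap, hsin, bipyramidNorm_boxMap]

/-! ### The inverse of the rounding map -/

theorem roundMap_surjective : Function.Surjective roundMap := by
  intro x
  rcases eq_or_ne x 0 with rfl | hx
  · refine ⟨0, ?_⟩
    rw [← norm_eq_zero, norm_roundMap]
    simp [bipyramidNorm]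
  · have : x ∈ range zorich := by rw [range_zorich]; exact hx
    obtain ⟨y, rfl⟩ := this
    exact ⟨boxMap y, roundMap_boxMap y⟩

/-- The inverse of `roundMap`. -/
noncomputable def unroundMap : E3 → E3 := Function.surjInv roundMap_surjective

theorem roundMap_unroundMap (x : E3) : roundMap (unroundMap x) = x :=
  Function.surjInv_eq roundMap_surjective x

theorem roundMap_injective : Function.Injective roundMap := fun w z h => by
  have := norm_sub_le_roundMap w z
  rw [h, sub_self, norm_zero, mul_zero] at this
  exact sub_eq_zero.1 (norm_le_zero_iff.1 this)

theorem unroundMap_roundMap (w : E3) : unroundMap (roundMap w) = w :=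
  roundMap_injective (roundMap_unroundMap _)

theorem unroundMap_lipschitzWith : LipschitzWith 48 unroundMap :=
  LipschitzWith.of_dist_le_mul fun x y => by
    have := norm_sub_le_roundMap (unroundMap x) (unroundMap y)
    rwa [roundMap_unroundMap, roundMap_unroundMap] at this

theorem bipyramidNorm_unroundMap (x : E3) : bipyramidNorm (unroundMap x) = ‖x‖ := by
  rw [← norm_roundMap, roundMap_unroundMap]

/-- The Jacobian of `f` is the reciprocal of that of `g`, which is at most `C' ^ 3`. Bad points of
`g` cause no harm: any `x` with `f x` bad is `g (f x)`, in the Lipschitz image of a null set. Thus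
mere positivity of one Jacobian yields quantitative lower bounds, first for `unroundMap` and then
for `roundMap`. -/
theorem LipschitzWith.hasDerivBoundsOn_of_leftInverse {f g : E3 → E3} {C C' : NNReal}
    (hf : LipschitzWith C f) (hg : LipschitzWith C' g) (hgf : ∀ x, g (f x) = x)
    (hpos : ∀ᵐ y, DifferentiableAt ℝ g y ∧ 0 < (fderiv ℝ g y).det) :
    HasDerivBoundsOn f univ C ((C' : ℝ) ^ 3)⁻¹ 1 := by
  have hnull : ∀ᵐ x, DifferentiableAt ℝ g (f x) ∧ 0 < (fderiv ℝ g (f x)).det := by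
    refine measure_mono_null (fun x hx => ?_) (volume_image_eq_zero_of_lipschitzWith hg hpos)
    exact ⟨f x, hx, hgf x⟩
  filter_upwards [hnull, hf.ae_differentiableAt (μ := (volume : Measure E3))] with x hx hfx _
  refine ⟨hfx, norm_fderiv_le_of_lipschitz ℝ hf, ?_⟩
  have hcomp : (fderiv ℝ g (f x)).comp (fderiv ℝ f x) = ContinuousLinearMap.id ℝ E3 := by
    rw [← fderiv_comp x hx.1 hfx, show g ∘ f = id from funext hgf, fderiv_id]
  have hdet : (fderiv ℝ g (f x)).det * (fderiv ℝ f x).det = 1 := by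
    have h1 : ((fderiv ℝ g (f x)).comp (fderiv ℝ f x)).det =
        (fderiv ℝ g (f x)).det * (fderiv ℝ f x).det := LinearMap.det_comp _ _
    rw [← h1, hcomp]
    exact LinearMap.det_id
  have hle : (fderiv ℝ g (f x)).det ≤ (C' : ℝ) ^ 3 :=
    (le_abs_self _).trans ((abs_det_le_norm_pow _).trans
      (pow_le_pow_left₀ (norm_nonneg _) (norm_fderiv_le_of_lipschitz ℝ hg) 3))
  rw [one_mul, eq_inv_of_mul_eq_one_right hdet]
  exact inv_anti₀ hx.2 hle

theorem unroundMap_hasDerivBoundsOn :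
    HasDerivBoundsOn unroundMap univ 48 (60 ^ 3)⁻¹ 1 := by
  have := unroundMap_lipschitzWith.hasDerivBoundsOn_of_leftInverse roundMap_lipschitzWith
    roundMap_unroundMap ae_det_fderiv_roundMap_pos
  norm_num at this ⊢
  exact this

theorem roundMap_hasDerivBoundsOn :
    HasDerivBoundsOn roundMap univ 60 (48 ^ 3)⁻¹ 1 := by
  have := roundMap_lipschitzWith.hasDerivBoundsOn_of_leftInverse unroundMap_lipschitzWith
    unroundMap_roundMap (by
      filter_upwards [unroundMap_hasDerivBoundsOn] with y hy
      obtain ⟨h1, -, h2⟩ := hy (mem_univ _)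
      rw [one_mul] at h2
      exact ⟨h1, lt_of_lt_of_le (by norm_num) h2⟩)
  norm_num at this ⊢
  exact this

/-! ### Logarithmic coordinates on the bipyramids -/

/-- The inverse of `boxMap` on the central beam, followed by the dilation with factor `d`. -/
noncomputable def logMap (d : ℝ) (w : E3) : E3 :=
  !₂[d * (w 0 / bipyramidNorm w), d * (w 1 / bipyramidNorm w), d * Real.log (bipyramidNorm w)]

theorem abs_div_bipyramidNorm_sub_le {w z : E3} (hw : 1 ≤ bipyramidNorm w)
    (hz : 1 ≤ bipyramidNorm z) (i : Fin 3) :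
    |w i / bipyramidNorm w - z i / bipyramidNorm z| ≤ 3 * ‖w - z‖ := by
  have hN := abs_bipyramidNorm_sub_le w z
  have hi := abs_sub_apply_le_norm w z i
  have hzi := abs_apply_le_bipyramidNorm z i
  set N := bipyramidNorm w
  set N' := bipyramidNorm z
  have e : w i / N - z i / N' = ((w i - z i) - z i / N' * (N - N')) / N := by
    have : N ≠ 0 := by positivity
    have : N' ≠ 0 := by positivity
    field_simp; ring
  rw [e, abs_div, abs_of_pos (by linarith : 0 < N)]
  refine (div_le_self (abs_nonneg _) hw).trans ((abs_sub _ _).trans ?_)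
  have h1 : |z i / N' * (N - N')| ≤ |N - N'| := by
    rw [abs_mul, abs_div, abs_of_pos (by linarith : 0 < N')]
    exact mul_le_of_le_one_left (abs_nonneg _) (div_le_one_of_le₀ hzi (by linarith))
  linarith

theorem abs_log_sub_le {a b : ℝ} (ha : 1 ≤ a) (hb : 1 ≤ b) :
    |Real.log a - Real.log b| ≤ |a - b| := by
  have key : ∀ a b : ℝ, 1 ≤ a → 1 ≤ b → Real.log a - Real.log b ≤ |a - b| := fun a b ha hb => by
    have h := Real.log_le_sub_one_of_pos (div_pos (by linarith : 0 < a) (by linarith : 0 < b))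
    rw [Real.log_div (by positivity) (by positivity)] at h
    refine h.trans ?_
    rw [div_sub_one (by positivity)]
    refine (div_le_div_of_nonneg_right (le_abs_self _) (by linarith)).trans
      (div_le_self (abs_nonneg _) hb)
  rw [abs_le]
  have h1 := key a b ha hb
  have h2 := key b a hb ha
  rw [abs_sub_comm] at h2
  constructor <;> linarith

theorem logMap_lipschitzOnWith {d : ℝ} (hd : 0 ≤ d) :
    LipschitzOnWith (3 * (3 * d).toNNReal) (logMap d) {w | 1 ≤ bipyramidNorm w} := by
  refine lipschitzOnWith_of_abs_sub_le (by linarith) fun w hw z hz i => ?_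
  have h := abs_div_bipyramidNorm_sub_le hw hz
  have hl := (abs_log_sub_le hw hz).trans (abs_bipyramidNorm_sub_le w z)
  have hn := norm_nonneg (w - z)
  have key : ∀ a b : ℝ, |a - b| ≤ 3 * ‖w - z‖ → |d * a - d * b| ≤ 3 * d * ‖w - z‖ := fun a b h => by
    rw [← mul_sub, abs_mul, abs_of_nonneg hd]
    calc d * |a - b| ≤ d * (3 * ‖w - z‖) := by gcongr
      _ = 3 * d * ‖w - z‖ := by ring
  fin_cases i
  · exact key _ _ (h 0)
  · exact key _ _ (h 1)
  · exact key _ _ (by linarith)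

/-- Multiples of the third row clear `ν` from the first two, leaving the determinant `(d / N)³
∂N/∂w₃`, where the vertical derivative is the sign of the height. So `logMap` preserves orientation
above the plane and reverses it below. -/
theorem logMap_hasDerivBoundsOn {d M ε : ℝ} (hd : 0 < d) (hε : ε = 1 ∨ ε = -1) :
    HasDerivBoundsOn (logMap d) {w | 1 < bipyramidNorm w ∧ bipyramidNorm w < M ∧ 0 < ε * w 2}
      (9 * d) (d ^ 3 * (M ^ 3)⁻¹) ε := by
  filter_upwards [bipyramidNorm_lipschitzWith.ae_differentiableAt (μ := (volume : Measure E3))]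
    with w hw hwU
  obtain ⟨h1, hM, h2⟩ := hwU
  have h := hw.hasFDerivAt
  set ν := fderiv ℝ bipyramidNorm w
  have hN : bipyramidNorm w ≠ 0 := by positivity
  have hopen : {w | 1 ≤ bipyramidNorm w} ∈ nhds w := by
    filter_upwards [bipyramidNorm_lipschitzWith.continuous.continuousAt.eventually
      (lt_mem_nhds h1)] with z hz using hz.le
  have hν := fderiv_bipyramidNorm_vertical h h2 hε
  have dNi : HasFDerivAt (fun x => (bipyramidNorm x)⁻¹) _ w :=
    (hasDerivAt_inv hN).comp_hasFDerivAt w h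
  set e : Fin 3 → E3 →L[ℝ] ℝ := fun i => EuclideanSpace.proj i with he
  set n := (bipyramidNorm w)⁻¹ with hn
  have hq : ∀ i, HasFDerivAt (fun x => d * (x i / bipyramidNorm x))
      ((d * n) • (e i - (w i * n) • ν)) w := fun i => by
    refine (((hasFDerivAt_euclidean_apply w i).mul dNi).const_mul d).congr_fderiv ?_
    ext v
    simp [he, ← inv_pow (bipyramidNorm w), ← hn]
    ring
  have hl : HasFDerivAt (fun x => d * Real.log (bipyramidNorm x)) ((d * n) • ν) w := by
    refine ((h.log hN).const_mul d).congr_fderiv ?_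
    rw [smul_smul]
  obtain ⟨e1, e2⟩ := fderiv_det_eq_matrix_det' (f := logMap d) (x := w)
    (R := ![(d * n) • (e 0 - (w 0 * n) • ν), (d * n) • (e 1 - (w 1 * n) • ν), (d * n) • ν])
    (fun i => by
      fin_cases i
      · exact hq 0
      · exact hq 1
      · exact hl)
  refine ⟨e1, ?_, ?_⟩
  · have := norm_fderiv_le_of_lipschitzOn ℝ hopen (logMap_lipschitzOnWith hd.le)
    push_cast at this
    rw [Real.coe_toNNReal _ (by linarith)] at this
    linarith
  · have hdet : (fderiv ℝ (logMap d) w).det = (d * n) ^ 3 * ε := by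
      rw [e2, Matrix.det_fin_three, ← hν]
      simp only [Matrix.of_apply, Matrix.cons_val, sub_apply, smul_apply, smul_eq_mul, he,
        EuclideanSpace.coe_proj, PiLp.single_apply, Fin.isValue, Fin.reduceEq, if_true, if_false]
      ring
    have hεε : ε * ε = 1 := by rcases hε with h | h <;> rw [h] <;> norm_num
    rw [hdet, show ε * ((d * n) ^ 3 * ε) = (d * n) ^ 3 * (ε * ε) by ring, hεε, mul_one, mul_pow]
    have : (M ^ 3)⁻¹ ≤ n ^ 3 := by
      rw [hn, inv_pow]
      exact inv_anti₀ (by positivity) (by gcongr)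
    gcongr

/-! ### The interpolating map in bipyramid coordinates -/

/-- The map `interpMap` transported by `logMap`, extended by reflection in the plane `{x₃ = 0}`. -/
noncomputable def boxInterp (l d : ℝ) (w : E3) : E3 :=
  if 0 ≤ w 2 then interpMap l (logMap d w) else reflect3 (interpMap l (logMap d w))

theorem logMap_two_mem_Icc {d : ℝ} (hd : 0 < d) {w : E3} (h1 : 1 ≤ bipyramidNorm w)
    (h2 : bipyramidNorm w ≤ Real.exp (1 / d)) : logMap d w 2 ∈ Icc (0 : ℝ) 1 := by
  have e : logMap d w 2 = d * Real.log (bipyramidNorm w) := rfl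
  have hl := (Real.log_le_iff_le_exp (by linarith : 0 < bipyramidNorm w)).2 h2
  rw [e]
  refine ⟨mul_nonneg hd.le (Real.log_nonneg h1), ?_⟩
  rw [le_div_iff₀ hd] at hl
  linarith

theorem logMap_two_mem_Ioo {d : ℝ} (hd : 0 < d) {w : E3} (h1 : 1 < bipyramidNorm w)
    (h2 : bipyramidNorm w < Real.exp (1 / d)) : logMap d w 2 ∈ Ioo (0 : ℝ) 1 := by
  have e : logMap d w 2 = d * Real.log (bipyramidNorm w) := rfl
  have hl := (Real.log_lt_iff_lt_exp (by linarith : 0 < bipyramidNorm w)).2 h2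
  rw [e]
  refine ⟨mul_pos hd (Real.log_pos h1), ?_⟩
  rw [lt_div_iff₀ hd] at hl
  linarith

/-- If `|w i|` realises the square norm, then `d * w i / N` lies within `d * |w 2|` of the odd
integer `±d`, where `foldSnd` vanishes; its Lipschitz bound does the rest. -/
theorem abs_foldSnd_logMap_le {l : ℝ} (hl : 1 ≤ l) {d : ℕ} (hd : Odd d) {w : E3}
    (h1 : 1 ≤ bipyramidNorm w) (h2 : bipyramidNorm w ≤ Real.exp (1 / d)) {i : Fin 3}
    (hi : logMap d w i = d * (w i / bipyramidNorm w)) (hw : bipyramidNorm w = |w i| + |w 2|) :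
    |foldSnd l (logMap d w i) (logMap d w 2)| ≤ 20 * l * (d * |w 2|) := by
  have hd0 : (0 : ℝ) < d := by exact_mod_cast hd.pos
  have hs := logMap_two_mem_Icc hd0 h1 h2
  obtain ⟨σ, hσ, hwσ⟩ : ∃ σ : ℝ, |σ| = 1 ∧ w i = σ * |w i| := by
    rcases le_total 0 (w i) with h | h
    · exact ⟨1, by simp, by rw [abs_of_nonneg h, one_mul]⟩
    · exact ⟨-1, by simp, by rw [abs_of_nonpos h]; ring⟩
  have h0 := foldSnd_eq_zero l hs.2 (abs_beamCoord_odd_mul hd hσ)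
  have h := abs_foldSnd_sub_le hl (y := logMap d w i) (y' := d * σ) hs hs
  rw [h0, sub_zero, sub_self, abs_zero, add_zero] at h
  refine h.trans ?_
  have hN : 0 < bipyramidNorm w := by linarith
  have e : w i / bipyramidNorm w - σ = -(σ * (|w 2| / bipyramidNorm w)) := by
    have : |w 2| = bipyramidNorm w - |w i| := by linarith
    rw [this]
    nth_rw 1 [hwσ]
    field_simp
    ring
  have e2 : |logMap d w i - d * σ| ≤ d * |w 2| := by
    rw [hi, ← mul_sub, e, abs_mul, abs_of_pos hd0, abs_neg, abs_mul, hσ, one_mul, abs_div, abs_abs,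
      abs_of_pos hN]
    exact mul_le_mul_of_nonneg_left (div_le_self (abs_nonneg _) h1) hd0.le
  gcongr

theorem abs_interpMap_logMap_two_le {l : ℝ} (hl : 1 ≤ l) {d : ℕ} (hd : Odd d) {w : E3}
    (h1 : 1 ≤ bipyramidNorm w) (h2 : bipyramidNorm w ≤ Real.exp (1 / d)) :
    |interpMap l (logMap d w) 2| ≤ 20 * l * (d * |w 2|) := by
  have e : |interpMap l (logMap d w) 2| = min |foldSnd l (logMap d w 0) (logMap d w 2)|
    |foldSnd l (logMap d w 1) (logMap d w 2)| := abs_signedMin _ _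
  rw [e]
  rcases le_total |w 0| |w 1| with h | h
  · refine (min_le_right _ _).trans (abs_foldSnd_logMap_le hl hd h1 h2 rfl ?_)
    rw [bipyramidNorm, max_eq_right h]
  · refine (min_le_left _ _).trans (abs_foldSnd_logMap_le hl hd h1 h2 rfl ?_)
    rw [bipyramidNorm, max_eq_left h]

theorem boxInterp_horizontal (l d : ℝ) (w : E3) {i : Fin 3} (hi : i ≠ 2) :
    boxInterp l d w i = interpMap l (logMap d w) i := by
  unfold boxInterp
  split_ifs
  · rfl
  · fin_cases i
    · rfl
    · rfl
    · exact absurd rfl hi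

theorem boxInterp_two (l d : ℝ) (w : E3) : boxInterp l d w 2 =
    if 0 ≤ w 2 then interpMap l (logMap d w) 2 else -interpMap l (logMap d w) 2 := by
  unfold boxInterp
  split_ifs <;> rfl

/-- The two branches match along the plane because the third coordinate vanishes linearly there. For
points on opposite sides, `|w 2| + |z 2| = |w 2 - z 2|`. The constant may depend on `d`, since it is
used only qualitatively. -/
theorem boxInterp_lipschitzOnWith {l : ℝ} (hl : 1 ≤ l) {d : ℕ} (hd : Odd d) :
    ∃ C, LipschitzOnWith C (boxInterp l d)
      {w | 1 ≤ bipyramidNorm w ∧ bipyramidNorm w ≤ Real.exp (1 / d)} := by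
  have hd0 : (0 : ℝ) < d := by exact_mod_cast hd.pos
  have hI := (interpMap_lipschitzOnWith hl).comp
    ((logMap_lipschitzOnWith hd0.le).mono (t := {w | 1 ≤ bipyramidNorm w})
      (s := {w | 1 ≤ bipyramidNorm w ∧ bipyramidNorm w ≤ Real.exp (1 / d)}) fun w hw => hw.1)
    (fun w hw => logMap_two_mem_Icc hd0 hw.1 hw.2)
  set C := 3 * (80 * l).toNNReal * (3 * (3 * (d : ℝ)).toNNReal)
  refine ⟨_, lipschitzOnWith_of_abs_sub_le (C := C + 20 * l * d) (by positivity)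
    fun w hw z hz i => ?_⟩
  have h : ∀ i, |interpMap l (logMap d w) i - interpMap l (logMap d z) i| ≤ C * ‖w - z‖ := fun i =>
    (abs_sub_apply_le_norm _ _ i).trans (by
      have := hI.dist_le_mul w hw z hz
      rwa [dist_eq_norm, dist_eq_norm] at this)
  have hn : 0 ≤ 20 * l * d * ‖w - z‖ := by positivity
  rw [add_mul]
  by_cases hi : i = 2
  · subst hi
    have hw2 := abs_interpMap_logMap_two_le hl hd hw.1 hw.2
    have hz2 := abs_interpMap_logMap_two_le hl hd hz.1 hz.2
    have hC : 0 ≤ C * ‖w - z‖ := by positivity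
    have hwz := abs_sub_apply_le_norm w z 2
    have key : |w 2| + |z 2| = |w 2 - z 2| →
        20 * l * (d * |w 2|) + 20 * l * (d * |z 2|) ≤ 20 * l * d * ‖w - z‖ := fun he => by
      rw [show 20 * l * (d * |w 2|) + 20 * l * (d * |z 2|) = 20 * l * d * (|w 2| + |z 2|) by ring,
        he]
      gcongr
    rw [boxInterp_two, boxInterp_two]
    split_ifs with a b b
    · linarith [h 2]
    · have := key (by rw [abs_of_nonneg a, abs_of_neg (not_le.1 b), abs_of_nonneg] <;> linarith)
      refine (abs_sub _ _).trans ?_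
      rw [abs_neg]
      linarith
    · have := key (by
        rw [abs_of_nonneg b, abs_of_neg (not_le.1 a), abs_of_nonpos] <;> linarith)
      refine (abs_sub _ _).trans ?_
      rw [abs_neg]
      linarith
    · rw [← neg_sub', abs_neg]
      linarith [h 2]
  · rw [boxInterp_horizontal _ _ _ hi, boxInterp_horizontal _ _ _ hi]
    linarith [h i]

/-- `max |F₀| |F₁| + min |S₀| |S₁|` is at most the larger of the two planar sums `|Fᵢ| + |Sᵢ|`, each
bounded by `l`. -/
theorem bipyramidNorm_boxInterp_le {l : ℝ} (hl : 8 ≤ l) {d : ℝ} (hd : 0 < d) {w : E3}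
    (h1 : 1 ≤ bipyramidNorm w) (h2 : bipyramidNorm w ≤ Real.exp (1 / d)) :
    bipyramidNorm (boxInterp l d w) ≤ l := by
  have hs := logMap_two_mem_Icc hd h1 h2
  have e2 : |boxInterp l d w 2| = min |foldSnd l (logMap d w 0) (logMap d w 2)|
      |foldSnd l (logMap d w 1) (logMap d w 2)| := by
    rw [← abs_signedMin, boxInterp_two]
    split_ifs
    · rfl
    · rw [abs_neg]; rfl
  rw [bipyramidNorm, boxInterp_horizontal l d w (by decide), boxInterp_horizontal l d w (by decide),
    e2]
  refine (max_add _ _ _).le.trans (max_le ?_ ?_)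
  · exact (add_le_add_right (min_le_left _ _) _).trans (abs_fold_add_le hl hs _)
  · exact (add_le_add_right (min_le_right _ _) _).trans (abs_fold_add_le hl hs _)

/-- Here the choice of the central beam is seen to be harmless. Folding `y` changes the third
coordinate of `interpMap` by the parity of the beam, and the same parity decides on which side of
the plane `boxMap y` lies. -/
theorem boxInterp_boxMap (l : ℝ) {d : ℕ} (hd : Odd d) {y : E3} (hy : d * y 2 ≤ 1) :
    boxInterp l d (boxMap y) = interpMap l ((d : ℝ) • y) := by
  have he := Real.exp_pos (y 2)
  have L0 : logMap d (boxMap y) 0 = d * beamCoord (y 0) := by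
    change d * (Real.exp (y 2) * beamCoord (y 0) / bipyramidNorm (boxMap y)) = _
    rw [bipyramidNorm_boxMap, mul_div_cancel_left₀ _ he.ne']
  have L1 : logMap d (boxMap y) 1 = d * beamCoord (y 1) := by
    change d * (Real.exp (y 2) * beamCoord (y 1) / bipyramidNorm (boxMap y)) = _
    rw [bipyramidNorm_boxMap, mul_div_cancel_left₀ _ he.ne']
  have L2 : logMap d (boxMap y) 2 = d * y 2 := by
    change d * Real.log (bipyramidNorm (boxMap y)) = _
    rw [bipyramidNorm_boxMap, Real.log_exp]
  have hy2 : boxMap y 2 = Real.exp (y 2) * ((-1) ^ (beamIndex (y 0) + beamIndex (y 1)) *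
      (1 - max |beamCoord (y 0)| |beamCoord (y 1)|)) := by
    rw [← signedMin_beamCoord]; rfl
  have hT : interpMap l ((d : ℝ) • y) 2 = (-1) ^ (beamIndex (y 0) + beamIndex (y 1)) *
      interpMap l (logMap d (boxMap y)) 2 := by
    change signedMin (foldSnd l (d * y 0) (d * y 2)) (foldSnd l (d * y 1) (d * y 2)) = _ *
      signedMin (foldSnd l (logMap d (boxMap y) 0) (logMap d (boxMap y) 2))
        (foldSnd l (logMap d (boxMap y) 1) (logMap d (boxMap y) 2))
    rw [L0, L1, L2, foldSnd_odd_mul l hd (y 0) hy, foldSnd_odd_mul l hd (y 1) hy,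
      signedMin_sign_mul (abs_neg_one_zpow_cases _) (abs_neg_one_zpow_cases _),
      zpow_add₀ (by norm_num)]
  ext i
  by_cases hi : i = 2
  · subst hi
    rw [boxInterp_two, hT, hy2]
    have hm := max_abs_beamCoord_le (y 0) (y 1)
    rcases abs_neg_one_zpow_cases (beamIndex (y 0) + beamIndex (y 1)) with h | h <;> rw [h]
    · rw [if_pos (by rw [one_mul]; exact mul_nonneg he.le (by linarith)), one_mul]
    · rcases hm.lt_or_eq with hlt | heq
      · rw [if_neg (not_le.2 (by
          rw [neg_one_mul, mul_neg, neg_lt_zero]; exact mul_pos he (by linarith))), neg_one_mul]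
      -- On the boundary of an odd beam `boxMap y` lies in the plane, so the upper branch is taken
      -- although the parity sign is `-1`. Both sides vanish, because an odd multiple of `±1` folds
      -- to `±1`.
      · have h0 : interpMap l (logMap d (boxMap y)) 2 = 0 := by
          change signedMin (foldSnd l (logMap d (boxMap y) 0) (logMap d (boxMap y) 2))
            (foldSnd l (logMap d (boxMap y) 1) (logMap d (boxMap y) 2)) = 0
          rw [L0, L1, L2]
          rcases max_choice |beamCoord (y 0)| |beamCoord (y 1)| with hc | hc <;> rw [heq] at hc
          · rw [foldSnd_eq_zero l hy (abs_beamCoord_odd_mul hd hc.symm), zero_signedMin]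
          · rw [foldSnd_eq_zero l hy (abs_beamCoord_odd_mul hd hc.symm), signedMin_zero]
        rw [h0]; simp
  · rw [boxInterp_horizontal _ _ _ hi]
    fin_cases i
    · change foldFst l (logMap d (boxMap y) 0) (logMap d (boxMap y) 2) =
        foldFst l (d * y 0) (d * y 2)
      rw [L0, L2, foldFst_odd_mul l hd]
    · change foldFst l (logMap d (boxMap y) 1) (logMap d (boxMap y) 2) =
        foldFst l (d * y 1) (d * y 2)
      rw [L1, L2, foldFst_odd_mul l hd]
    · exact absurd rfl hi

theorem interpMap_bottom (l : ℝ) {y : E3} (hy : y 2 = 0) : interpMap l y = boxMap y := by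
  unfold interpMap boxMap
  rw [hy, foldFst_bottom, foldFst_bottom, foldSnd_bottom, foldSnd_bottom, Real.exp_zero, one_mul,
    one_mul, one_mul]

/-- The choice `l = e^3` is forced by the height `3` of `3 y` at the top. -/
theorem interpMap_top {y : E3} (hy : y 2 = 1) :
    interpMap (Real.exp 3) y = boxMap ((3 : ℝ) • y) := by
  unfold interpMap boxMap
  rw [hy, foldFst_top, foldFst_top, foldSnd_top, foldSnd_top,
    signedMin_mul_left (Real.exp_pos 3).le]
  simp [hy]

theorem reflect3_hasDerivBoundsOn : HasDerivBoundsOn reflect3 univ 3 1 (-1) := by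
  refine Filter.Eventually.of_forall fun x _ => ?_
  obtain ⟨h1, h2⟩ := fderiv_det_eq_matrix_det' (f := reflect3) (x := x)
    (R := ![EuclideanSpace.proj 0, EuclideanSpace.proj 1, -EuclideanSpace.proj 2])
    (fun i => by
      fin_cases i
      · exact hasFDerivAt_euclidean_apply x 0
      · exact hasFDerivAt_euclidean_apply x 1
      · exact (hasFDerivAt_euclidean_apply x 2).neg)
  refine ⟨h1, ?_, ?_⟩
  · have hL := lipschitzOnWith_of_abs_sub_le (f := reflect3) (D := univ) (C := 1) zero_le_one
      fun x _ y _ i => by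
        have h := abs_sub_apply_le_norm x y
        rw [one_mul]
        fin_cases i
        · exact h 0
        · exact h 1
        · have := h 2
          rw [← abs_neg, neg_sub'] at this
          exact this
    have := norm_fderiv_le_of_lipschitzOn ℝ (Filter.univ_mem (f := nhds x)) hL
    simpa using this
  · rw [h2, Matrix.det_fin_three]
    simp

/-- Below the plane the reflection compensates the reversed orientation of `logMap`. The inequality
`e^{1/d} ≤ e` keeps the loss in the Jacobian independent of `d`. -/
theorem boxInterp_hasDerivBoundsOn {l : ℝ} (hl : 8 ≤ l) {d : ℕ} (hd : Odd d) :
    HasDerivBoundsOn (boxInterp l d)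
      {w | 1 < bipyramidNorm w ∧ bipyramidNorm w < Real.exp (1 / d)}
      (3 * (240 * l * (9 * d))) (d ^ 3 * (Real.exp 1 ^ 3)⁻¹) 1 := by
  have hd0 : (0 : ℝ) < d := by exact_mod_cast hd.pos
  have hM : Real.exp (1 / d) ≤ Real.exp 1 := by
    rw [Real.exp_le_exp]
    exact div_le_self zero_le_one (by exact_mod_cast hd.pos)
  have hpos : 0 < (d : ℝ) ^ 3 * (Real.exp 1 ^ 3)⁻¹ := by positivity
  have hN := bipyramidNorm_lipschitzWith.continuous
  have hI : ∀ ε : ℝ, ε = 1 ∨ ε = -1 → HasDerivBoundsOn (interpMap l ∘ logMap d)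
      {w | 1 < bipyramidNorm w ∧ bipyramidNorm w < Real.exp (1 / d) ∧ 0 < ε * w 2}
      (240 * l * (9 * d)) (1 * (d ^ 3 * (Real.exp 1 ^ 3)⁻¹)) (1 * ε) := fun ε hε =>
    (interpMap_hasDerivBoundsOn hl).comp ((logMap_hasDerivBoundsOn hd0 hε).mono
      fun w hw => ⟨hw.1, hw.2.1.trans_le hM, hw.2.2⟩)
      (fun w hw => logMap_two_mem_Ioo hd0 hw.1 hw.2.1) (by positivity) zero_le_one hpos
  have hopen : ∀ ε : ℝ, IsOpen
      {w : E3 | 1 < bipyramidNorm w ∧ bipyramidNorm w < Real.exp (1 / d) ∧ 0 < ε * w 2} := fun ε =>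
    (isOpen_lt continuous_const hN).inter ((isOpen_lt hN continuous_const).inter
      (isOpen_lt continuous_const (by fun_prop : Continuous fun w : E3 => ε * w 2)))
  have hup := (hI 1 (Or.inl rfl)).congr (g := boxInterp l d) (hopen 1) fun w hw =>
    if_pos (by linarith [hw.2.2])
  have hdown := (reflect3_hasDerivBoundsOn.comp (hI (-1) (Or.inr rfl)) (mapsTo_univ _ _)
    (by norm_num) zero_le_one (by linarith)).congr (g := boxInterp l d) (hopen (-1)) fun w hw =>
    if_neg (not_le.2 (by linarith [hw.2.2]))
  have hplane : ∀ᵐ w : E3, w 2 ≠ 0 :=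
    ae_linear_ne (ℓ := (EuclideanSpace.proj 2 : E3 →L[ℝ] ℝ).toLinearMap) (fun h => by
      have := congrArg (fun L : E3 →ₗ[ℝ] ℝ => L (EuclideanSpace.single 2 1)) h
      simp at this) 0
  filter_upwards [hup, hdown, hplane] with w h1 h2 h3 hw
  rcases h3.lt_or_gt with h | h
  · obtain ⟨a, b, c⟩ := h2 ⟨hw.1, hw.2, by linarith⟩
    exact ⟨a, b, by linarith⟩
  · obtain ⟨a, b, c⟩ := h1 ⟨hw.1, hw.2, by linarith⟩
    refine ⟨a, b.trans ?_, by linarith⟩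
    have : 0 ≤ 240 * l * (9 * d) := by positivity
    linarith

/-! ### The interpolating map between power maps -/

/-- A map of the ring `A(1, e^{1/d})` which is `p_d` on the inner and `p_{3d}` on the outer
sphere. -/
noncomputable def powerInterp (d : ℕ) : E3 → E3 :=
  roundMap ∘ boxInterp (Real.exp 3) d ∘ unroundMap

theorem eight_le_exp_three : (8 : ℝ) ≤ Real.exp 3 := by
  have h := Real.add_one_le_exp (1 : ℝ)
  have e : Real.exp 3 = Real.exp 1 ^ 3 := by rw [← Real.exp_nat_mul]; norm_num
  rw [e]
  calc (8 : ℝ) = (1 + 1) ^ 3 := by norm_num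
    _ ≤ _ := by gcongr

theorem powerInterp_lipschitzOnWith {d : ℕ} (hd : Odd d) :
    ∃ C, LipschitzOnWith C (powerInterp d) (closedRing 1 (Real.exp (1 / d))) := by
  obtain ⟨C, hC⟩ := boxInterp_lipschitzOnWith
    ((by norm_num : (1 : ℝ) ≤ 8).trans eight_le_exp_three) hd
  refine ⟨_, roundMap_lipschitzWith.comp_lipschitzOnWith
    (hC.comp unroundMap_lipschitzWith.lipschitzOnWith fun x hx => ?_)⟩
  rw [mem_ofPred_eq, bipyramidNorm_unroundMap]
  exact hx

/-- The degree enters only through the factors `d` and `d ^ 3` of a conformal dilation, which cancel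
in the dilatation. -/
theorem powerInterp_hasDerivBoundsOn {d : ℕ} (hd : Odd d) :
    HasDerivBoundsOn (powerInterp d) {x | 1 < ‖x‖ ∧ ‖x‖ < Real.exp (1 / d)}
      (60 * (3 * (240 * Real.exp 3 * 9) * 48) * d)
      ((48 ^ 3)⁻¹ * ((Real.exp 1 ^ 3)⁻¹ * (60 ^ 3)⁻¹) * d ^ 3) 1 := by
  have hd0 : (0 : ℝ) < d := by exact_mod_cast hd.pos
  have h := roundMap_hasDerivBoundsOn.comp ((boxInterp_hasDerivBoundsOn eight_le_exp_three hd).comp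
    (unroundMap_hasDerivBoundsOn.mono (U' := {x | 1 < ‖x‖ ∧ ‖x‖ < Real.exp (1 / d)})
      (subset_univ _))
    (fun x hx => by rw [mem_ofPred_eq, bipyramidNorm_unroundMap]; exact hx) (by positivity)
    (by positivity) (by positivity)) (mapsTo_univ _ _) (by norm_num) (by positivity) (by positivity)
  convert h using 1
  · rfl
  all_goals ring

theorem powerInterp_mapsTo {d : ℕ} (hd : Odd d) : MapsTo (powerInterp d)
    (closedRing 1 (Real.exp (1 / d))) (Metric.closedBall 0 (Real.exp 3)) := fun x hx => by
  have hd0 : (0 : ℝ) < d := by exact_mod_cast hd.pos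
  rw [mem_closedBall_zero_iff]
  refine (norm_roundMap _).le.trans (bipyramidNorm_boxInterp_le eight_le_exp_three hd0 ?_ ?_) <;>
    rw [bipyramidNorm_unroundMap]
  · exact hx.1
  · exact hx.2

theorem powerInterp_zorich {d : ℕ} (hd : Odd d) {y : E3} (hy : d * y 2 ≤ 1) :
    powerInterp d (zorich y) = roundMap (interpMap (Real.exp 3) ((d : ℝ) • y)) := by
  rw [powerInterp, Function.comp_apply, Function.comp_apply, ← roundMap_boxMap, unroundMap_roundMap,
    boxInterp_boxMap _ hd hy]

theorem exists_zorich_eq {x : E3} (hx : 0 < ‖x‖) : ∃ y, zorich y = x ∧ y 2 = Real.log ‖x‖ := by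
  have : x ∈ range zorich := by rw [range_zorich]; exact norm_pos_iff.1 hx
  obtain ⟨y, rfl⟩ := this
  exact ⟨y, rfl, by rw [norm_zorich, Real.log_exp]⟩

theorem powerInterp_of_norm_eq_one {d : ℕ} (hd : Odd d) {x : E3} (hx : ‖x‖ = 1) :
    powerInterp d x = powerMap d x := by
  obtain ⟨y, rfl, hy⟩ := exists_zorich_eq (hx ▸ one_pos)
  rw [hx, Real.log_one] at hy
  rw [powerInterp_zorich hd (by rw [hy]; simp), interpMap_bottom _ (by simp [hy]), roundMap_boxMap,
    powerMap_zorich hd]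

theorem powerInterp_of_norm_eq_exp {d : ℕ} (hd : Odd d) {x : E3} (hx : ‖x‖ = Real.exp (1 / d)) :
    powerInterp d x = powerMap (3 * d) x := by
  have hd0 : (d : ℝ) ≠ 0 := by exact_mod_cast hd.pos.ne'
  obtain ⟨y, rfl, hy⟩ := exists_zorich_eq (hx ▸ Real.exp_pos _)
  rw [hx, Real.log_exp] at hy
  have hy' : d * y 2 = 1 := by rw [hy]; field_simp
  rw [powerInterp_zorich hd hy'.le, interpMap_top (by simpa using hy'), roundMap_boxMap,
    powerMap_zorich ((by decide : Odd 3).mul hd), smul_smul]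
  push_cast
  rfl

/-! ### Rescaling -/

theorem smul_hasDerivBoundsOn {t : ℝ} (ht : 0 < t) :
    HasDerivBoundsOn (fun x : E3 => t • x) univ t (t ^ 3) 1 := by
  refine Filter.Eventually.of_forall fun x _ => ?_
  have h : HasFDerivAt (fun x : E3 => t • x) (t • ContinuousLinearMap.id ℝ E3) x :=
    (hasFDerivAt_id x).const_smul t
  refine ⟨h.differentiableAt, ?_, ?_⟩
  · rw [h.fderiv, norm_smul, Real.norm_of_nonneg ht.le]
    exact mul_le_of_le_one_right ht.le ContinuousLinearMap.norm_id_le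
  · rw [h.fderiv, one_mul]
    have : (t • ContinuousLinearMap.id ℝ E3).det =
        LinearMap.det (t • (LinearMap.id : E3 →ₗ[ℝ] E3)) :=
      rfl
    rw [this, LinearMap.det_smul, LinearMap.det_id]
    simp

theorem zorich_add_height (y : E3) (s : ℝ) :
    zorich !₂[y 0, y 1, y 2 + s] = Real.exp s • zorich y := by
  unfold zorich
  simp only [Matrix.cons_val]
  rw [Real.exp_add, smul_smul, mul_comm (Real.exp s)]
  rfl

/-- Scaling by `t` raises a Zorich preimage by `log t`; multiplication by `d` turns this into `d log
t`, that is, scaling by `t ^ d`. -/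
theorem powerMap_smul {d : ℕ} (hd : Odd d) {t : ℝ} (ht : 0 < t) {x : E3} (hx : 0 < ‖x‖) :
    powerMap d (t • x) = t ^ d • powerMap d x := by
  obtain ⟨y, rfl, -⟩ := exists_zorich_eq hx
  have h := zorich_add_height y (Real.log t)
  rw [Real.exp_log ht] at h
  rw [← h, powerMap_zorich hd, powerMap_zorich hd]
  have e : (d : ℝ) • (!₂[y 0, y 1, y 2 + Real.log t] : E3) =
      !₂[((d : ℝ) • y) 0, ((d : ℝ) • y) 1, ((d : ℝ) • y) 2 + d * Real.log t] := by
    ext i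
    fin_cases i <;> simp [mul_add]
  rw [e, zorich_add_height, Real.exp_nat_mul, Real.exp_log ht]

theorem isQuasiregularOn_smul_comp_smul {f : E3 → E3} {r s a b κ K k t : ℝ} {C : NNReal}
    (hf : LipschitzOnWith C f (closedRing r s)) (ha : 0 ≤ a) (hb : 0 < b) (hκ : 0 < κ)
    (h : HasDerivBoundsOn f {x | r < ‖x‖ ∧ ‖x‖ < s} (a * κ) (b * κ ^ 3) 1)
    (hK : a ^ 3 / b ≤ K) (hK' : (a ^ 3 / b) ^ 2 ≤ K) (hk : 0 < k) (ht : 0 < t) :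
    IsQuasiregularOn K (fun x => k • f (t⁻¹ • x)) (closedRing (t * r) (t * s)) := by
  have hn : ∀ x : E3, ‖t⁻¹ • x‖ = ‖x‖ / t := fun x => by
    rw [norm_smul, norm_inv, Real.norm_of_nonneg ht.le, div_eq_inv_mul]
  refine isQuasiregularOn_closedRing (κ := k * (κ * t⁻¹)) (a := a) (b := b)
    ((lipschitzWith_smul k).comp_lipschitzOnWith
      (hf.comp (lipschitzWith_smul t⁻¹).lipschitzOnWith fun x hx => ?_))
    hb (by positivity) ?_ hK hK'
  · refine ⟨?_, ?_⟩ <;> rw [hn]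
    · rw [le_div_iff₀ ht, mul_comm]; exact hx.1
    · rw [div_le_iff₀ ht, mul_comm]; exact hx.2
  · have := (smul_hasDerivBoundsOn hk).comp (h.comp ((smul_hasDerivBoundsOn (inv_pos.2 ht)).mono
      (subset_univ {x | t * r < ‖x‖ ∧ ‖x‖ < t * s})) (fun x hx => ?_) (by positivity)
      (by positivity) (by positivity)) (mapsTo_univ _ _) hk.le (by positivity) (by positivity)
    · convert this using 1
      · rfl
      all_goals ring
    · refine ⟨?_, ?_⟩ <;> rw [hn]
      · rw [lt_div_iff₀ ht, mul_comm]; exact hx.1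
      · rw [div_lt_iff₀ ht, mul_comm]; exact hx.2

theorem theorem3p1 :
    ∃ K : ℝ, 1 ≤ K ∧ ∀ d : ℕ, Odd d →
      ∃ P : E3 → E3,
        (IsQuasiregularOn K P (closedRing 1 (Real.exp (1 / d))) ∧
          MapsTo P (closedRing 1 (Real.exp (1 / d))) (Metric.closedBall 0 (Real.exp 3)) ∧
          (∀ x, ‖x‖ = 1 → P x = powerMap d x) ∧
          (∀ x, ‖x‖ = Real.exp (1 / d) → P x = powerMap (3 * d) x)) ∧
        ∀ R c c' : ℝ, 1 < R → 0 < c → c' = c * R ^ (-(2 * d : ℤ)) →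
          ∃ F : E3 → E3,
            IsQuasiregularOn K F (closedRing R (R * Real.exp (1 / d))) ∧
            MapsTo F (closedRing R (R * Real.exp (1 / d)))
              (Metric.closedBall 0 (c' * R ^ (3 * d) * Real.exp 3)) ∧
            (∀ x, ‖x‖ = R → F x = c • powerMap d x) ∧
            (∀ x, ‖x‖ = R * Real.exp (1 / d) → F x = c' • powerMap (3 * d) x) ∧
            ∀ x, F x = (c' * R ^ (3 * d)) • P (R⁻¹ • x) := by
  -- The factors of `a` bound the derivatives of `roundMap`, the reflection, `interpMap`, `logMap`
  -- (without `d`) and `unroundMap`; those of `b` bound the Jacobians of `roundMap`, `logMap` and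
  -- `unroundMap` from below.
  set a : ℝ := 60 * (3 * (240 * Real.exp 3 * 9) * 48) with ha
  set b : ℝ := (48 ^ 3)⁻¹ * ((Real.exp 1 ^ 3)⁻¹ * (60 ^ 3)⁻¹) with hb
  have ha0 : 0 ≤ a := by positivity
  have hb0 : 0 < b := by positivity
  set K := max 1 (max (a ^ 3 / b) ((a ^ 3 / b) ^ 2)) with hK
  have hK1 : a ^ 3 / b ≤ K := (le_max_left _ _).trans (le_max_right _ _)
  have hK2 : (a ^ 3 / b) ^ 2 ≤ K := (le_max_right _ _).trans (le_max_right _ _)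
  refine ⟨K, le_max_left _ _, fun d hd => ⟨powerInterp d, ⟨?_, powerInterp_mapsTo hd,
    fun x hx => powerInterp_of_norm_eq_one hd hx, fun x hx => powerInterp_of_norm_eq_exp hd hx⟩,
    fun R c c' hR hc hc' => ⟨_, ?_, ?_, ?_, ?_, fun x => rfl⟩⟩⟩
  all_goals
    have hd0 : (0 : ℝ) < d := by exact_mod_cast hd.pos
    obtain ⟨C, hC⟩ := powerInterp_lipschitzOnWith hd
    have hD := powerInterp_hasDerivBoundsOn hd
  · exact isQuasiregularOn_closedRing hC hb0 hd0 hD hK1 hK2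
  all_goals
    have hR0 : 0 < R := one_pos.trans hR
    have hc0 : 0 < c' := by rw [hc']; positivity
    have hn : ∀ x : E3, ‖R⁻¹ • x‖ = ‖x‖ / R := fun x => by
      rw [norm_smul, norm_inv, Real.norm_of_nonneg hR0.le, div_eq_inv_mul]
  · have := isQuasiregularOn_smul_comp_smul hC ha0 hb0 hd0 hD hK1 hK2
      (by positivity : 0 < c' * R ^ (3 * d)) hR0
    rwa [mul_one] at this
  · intro x hx
    have hm : R⁻¹ • x ∈ closedRing 1 (Real.exp (1 / d)) := by
      refine ⟨?_, ?_⟩ <;> rw [hn]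
      · rw [le_div_iff₀ hR0, one_mul]; exact hx.1
      · rw [div_le_iff₀ hR0, mul_comm]; exact hx.2
    have := powerInterp_mapsTo hd hm
    rw [mem_closedBall_zero_iff] at this ⊢
    rw [norm_smul, Real.norm_of_nonneg (by positivity)]
    gcongr
  · intro x hx
    -- Homogeneity of `p_d` gives the factor `R^{-d}`, leaving `c' R^{2d}`: this dictates the
    -- relation between `c'` and `c`.
    have h1 : c' * R ^ (3 * d) * R⁻¹ ^ d = c := by
      rw [hc', show 3 * d = 2 * d + d by ring, pow_add, zpow_neg,
        show (2 * d : ℤ) = ((2 * d : ℕ) : ℤ) by push_cast; rfl, zpow_natCast, inv_pow]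
      field_simp
    change (c' * R ^ (3 * d)) • powerInterp d (R⁻¹ • x) = _
    rw [powerInterp_of_norm_eq_one hd (by rw [hn, hx, div_self hR0.ne']),
      powerMap_smul hd (inv_pos.2 hR0) (hx ▸ hR0), smul_smul, h1]
  · intro x hx
    have h1 : c' * R ^ (3 * d) * R⁻¹ ^ (3 * d) = c' := by
      rw [inv_pow]
      field_simp
    change (c' * R ^ (3 * d)) • powerInterp d (R⁻¹ • x) = _
    rw [powerInterp_of_norm_eq_exp hd (by rw [hn, hx, mul_div_cancel_left₀ _ hR0.ne']),
      powerMap_smul ((by decide : Odd 3).mul hd) (inv_pos.2 hR0) (hx ▸ by positivity), smul_smul,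
      h1]
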